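/- Let $\mathbf{k}$ be a finite field of odd characteristic and let $R$ be an algebraically closed field of characteristic $2$. For $m\ge 1$ write $G_m=\mathrm{GL}_m(\mathbf{k})$, and let $(H_m)_{m\ge 1}$ be one of the following two families of subgroups $H_m\subseteq G_m$: - (Galois case) $\mathbf{k}$ is a quadratic extension of a subfield $\mathbf{k}_0$, and $H_m=\mathrm{GL}_m(\mathbf{k}_0)$; - (Levi case) $H_m$ is the centralizer in $G_m$ of the diagonal matrix $\mathrm{diag}(-1,1,\dots,(-1)^m)$. Representations are on $R$-vector spaces. For representations $\pi_1$ of $G_a$ and $\pi_2$ of $G_b$, let $\pi_1\times\pi_2$ be the representation of $G_{a+b}$ parabolically induced from $\pi_1\otimes\pi_2$ along the standard parabolic subgroup of block upper triangular matrices of size $(a,b)$. An irreducible representation of $G_n$ is called cuspidal if it does not embed in any $\pi_1\times\pi_2$ with $a,b\ge 1$ and $a+b=n$. A representation $\pi$ of $G_n$ is called $H_n$-distinguished if the space $\mathrm{Hom}_{H_n}(\pi,1)$ of $H_n$-invariant linear forms on $\pi$ is non-zero. Let $n\ge 1$, let $\pi$ be an $H_n$-distinguished cuspidal representation of $G_n$,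 and let $\tau$ be the irreducible quotient of $\pi\times\pi$ (which is unique up to isomorphism). Then $$\dim_R \mathrm{Hom}_{H_{2n}}(\tau,1)\le 1 .$$ -/

import Mathlib

open scoped TensorProduct MatrixGroups

universe u

namespace ModularGL

section Parabolic

variable {a b n : ℕ}

/-- For `a + b = n`, the ring isomorphism from `n × n` matrices to matrices partitioned into
blocks of sizes `a` and `b` (in this order). -/
noncomputable def blocks (k : Type*) [Field k] (h : a + b = n) :
    Matrix (Fin n) (Fin n) k ≃ₐ[k] Matrix (Fin a ⊕ Fin b) (Fin a ⊕ Fin b) k :=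
  Matrix.reindexAlgEquiv k k (finSumFinEquiv.trans (finCongr h)).symm

lemma blocks_mul {k : Type*} [Field k] (h : a + b = n) (g g' : GL (Fin n) k) :
    blocks k h (g * g' : GL (Fin n) k).val
      = Matrix.fromBlocks
          ((blocks k h g.val).toBlocks₁₁ * (blocks k h g'.val).toBlocks₁₁
            + (blocks k h g.val).toBlocks₁₂ * (blocks k h g'.val).toBlocks₂₁)
          ((blocks k h g.val).toBlocks₁₁ * (blocks k h g'.val).toBlocks₁₂
            + (blocks k h g.val).toBlocks₁₂ * (blocks k h g'.val).toBlocks₂₂)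
          ((blocks k h g.val).toBlocks₂₁ * (blocks k h g'.val).toBlocks₁₁
            + (blocks k h g.val).toBlocks₂₂ * (blocks k h g'.val).toBlocks₂₁)
          ((blocks k h g.val).toBlocks₂₁ * (blocks k h g'.val).toBlocks₁₂
            + (blocks k h g.val).toBlocks₂₂ * (blocks k h g'.val).toBlocks₂₂) := by
  rw [Units.val_mul, map_mul, ← Matrix.fromBlocks_multiply, Matrix.fromBlocks_toBlocks,
    Matrix.fromBlocks_toBlocks]

lemma blocks_one {k : Type*} [Field k] (h : a + b = n) :
    blocks k h (1 : GL (Fin n) k).val = Matrix.fromBlocks 1 0 0 1 := by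
  rw [Units.val_one, map_one, Matrix.fromBlocks_one]

/-- The standard parabolic subgroup of `GL_n(k)` of size `(a, b)`: the invertible block upper
triangular matrices. -/
def parabolic (k : Type*) [Field k] (h : a + b = n) : Subgroup (GL (Fin n) k) where
  carrier := {g | (blocks k h g.val).toBlocks₂₁ = 0}
  one_mem' := by
    change (blocks k h (1 : GL (Fin n) k).val).toBlocks₂₁ = 0
    rw [blocks_one, Matrix.toBlocks_fromBlocks₂₁]
  mul_mem' {g g'} hg hg' := by
    change (blocks k h (g * g' : GL (Fin n) k).val).toBlocks₂₁ = 0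
    change (blocks k h g.val).toBlocks₂₁ = 0 at hg
    change (blocks k h g'.val).toBlocks₂₁ = 0 at hg'
    rw [blocks_mul, Matrix.toBlocks_fromBlocks₂₁, hg, hg', Matrix.zero_mul, Matrix.mul_zero, add_zero]
  inv_mem' {g} hg := by
    change (blocks k h (g⁻¹).val).toBlocks₂₁ = 0
    change (blocks k h g.val).toBlocks₂₁ = 0 at hg
    have e := blocks_mul h g g⁻¹
    rw [mul_inv_cancel, blocks_one, hg, Matrix.fromBlocks_inj] at e
    obtain ⟨-, -, e₂₁, e₂₂⟩ := e
    rw [Matrix.zero_mul, zero_add] at e₂₁ e₂₂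
    have e' := mul_eq_one_comm.1 e₂₂.symm
    rw [← Matrix.one_mul ((blocks k h (g⁻¹).val).toBlocks₂₁), ← e', Matrix.mul_assoc, ← e₂₁, Matrix.mul_zero]

/-- The upper left diagonal block, as a homomorphism from the standard parabolic subgroup. -/
noncomputable def leviFst (k : Type*) [Field k] (h : a + b = n) :
    parabolic k h →* GL (Fin a) k :=
  MonoidHom.toHomUnits
    { toFun := fun g => (blocks k h g.val.val).toBlocks₁₁
      map_one' := by
        rw [OneMemClass.coe_one, blocks_one, Matrix.toBlocks_fromBlocks₁₁]
      map_mul' := fun g g' => by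
        have hg' : (blocks k h g'.val.val).toBlocks₂₁ = 0 := g'.property
        rw [MulMemClass.coe_mul, blocks_mul, Matrix.toBlocks_fromBlocks₁₁, hg', Matrix.mul_zero,
          add_zero] }

/-- The lower right diagonal block, as a homomorphism from the standard parabolic subgroup. -/
noncomputable def leviSnd (k : Type*) [Field k] (h : a + b = n) :
    parabolic k h →* GL (Fin b) k :=
  MonoidHom.toHomUnits
    { toFun := fun g => (blocks k h g.val.val).toBlocks₂₂
      map_one' := by
        rw [OneMemClass.coe_one, blocks_one, Matrix.toBlocks_fromBlocks₂₂]
      map_mul' := fun g g' => by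
        have hg : (blocks k h g.val.val).toBlocks₂₁ = 0 := g.property
        rw [MulMemClass.coe_mul, blocks_mul, Matrix.toBlocks_fromBlocks₂₂, hg, Matrix.zero_mul,
          zero_add] }

variable {k : Type*} [Field k] {R : Type*} [Field R] {V₁ V₂ : Type*}
  [AddCommGroup V₁] [Module R V₁] [AddCommGroup V₂] [Module R V₂]

/-- The inflation of `π₁ ⊗ π₂` to the standard parabolic subgroup of size `(a, b)`. -/
noncomputable def inflation (h : a + b = n) (π₁ : Representation R (GL (Fin a) k) V₁)
    (π₂ : Representation R (GL (Fin b) k) V₂) : Representation R (parabolic k h) (V₁ ⊗[R] V₂) :=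
  Representation.tprod (π₁.comp (leviFst k h)) (π₂.comp (leviSnd k h))

/-- The parabolically induced representation `π₁ × π₂` of `GL_n(k)`, where `n = a + b`: the group
acts by right translations on the space of functions `f : GL_n(k) → V₁ ⊗ V₂` such that
`f (q g) = (π₁ ⊗ π₂)(q) (f g)` for all `q` in the standard parabolic subgroup of size `(a, b)`. -/
noncomputable def parabolicInduction (h : a + b = n) (π₁ : Representation R (GL (Fin a) k) V₁)
    (π₂ : Representation R (GL (Fin b) k) V₂) :
    Representation R (GL (Fin n) k)
      (Representation.coindV (parabolic k h).subtype (inflation h π₁ π₂)) :=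
  Representation.coind (parabolic k h).subtype (inflation h π₁ π₂)

end Parabolic

/-- A representation `π` of `GL_n(k)` is cuspidal if it is irreducible and does not embed in any
properly parabolically induced representation.  By transitivity of parabolic induction it is enough
to consider two blocks, and by irreducibility of `π` (the field `k` being finite in the
applications) it is enough to let the inducing representations live in the universe of `R`. -/
def IsCuspidal {k : Type*} [Field k] {R : Type u} [Field R] {n : ℕ}
    {V : Type*} [AddCommGroup V] [Module R V] (π : Representation R (GL (Fin n) k) V) : Prop :=
  π.IsIrreducible ∧
    ∀ (a b : ℕ) (h : a + b = n), 0 < a → 0 < b →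
      ∀ (V₁ V₂ : Type u) [AddCommGroup V₁] [Module R V₁] [AddCommGroup V₂] [Module R V₂]
        (π₁ : Representation R (GL (Fin a) k) V₁) (π₂ : Representation R (GL (Fin b) k) V₂),
        ¬ ∃ f : π.IntertwiningMap (parabolicInduction h π₁ π₂), Function.Injective f

/-- The space `Hom_H(π, 1)` of `H`-invariant linear forms on a representation `π` of `G`. -/
abbrev InvariantForms {R G V : Type*} [Field R] [Group G] [AddCommGroup V] [Module R V]
    (π : Representation R G V) (H : Subgroup G) : Type _ :=
  Representation.IntertwiningMap (π.comp H.subtype) (Representation.trivial R H R)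

/-- `π` is `H`-distinguished if it carries a non-zero `H`-invariant linear form. -/
def IsDistinguished {R G V : Type*} [Field R] [Group G] [AddCommGroup V] [Module R V]
    (π : Representation R G V) (H : Subgroup G) : Prop :=
  ∃ l : InvariantForms π H, l ≠ 0

/-- The two cases for the family of symmetric subgroups: either a subfield `k₀` over which `k` is
quadratic is given (Galois case), or no further datum is needed (Levi case). -/
inductive SymmetricCase (k : Type*) [Field k]
  | galois (k₀ : Subfield k) (quadratic : Module.finrank k₀ k = 2)
  | levi

/-- The diagonal matrix `diag(-1, 1, -1, …, (-1)^n)` of `GL_n(k)`. -/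
def alternatingSigns (k : Type*) [Field k] (n : ℕ) : GL (Fin n) k :=
  have hsq : (Matrix.diagonal fun i : Fin n => (-1 : k) ^ (i.val + 1))
      * (Matrix.diagonal fun i : Fin n => (-1 : k) ^ (i.val + 1)) = 1 := by
    rw [Matrix.diagonal_mul_diagonal, ← Matrix.diagonal_one]
    congr 1
    funext i
    rw [← mul_pow, neg_one_mul, neg_neg, one_pow]
  ⟨Matrix.diagonal fun i : Fin n => (-1 : k) ^ (i.val + 1),
    Matrix.diagonal fun i : Fin n => (-1 : k) ^ (i.val + 1), hsq, hsq⟩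

/-- The subgroup `H_n` of `GL_n(k)`: it is `GL_n(k₀)` in the Galois case, and the centralizer of
`diag(-1, 1, …, (-1)^n)` in the Levi case. -/
noncomputable def symmetricSubgroup {k : Type*} [Field k] (c : SymmetricCase k) (n : ℕ) :
    Subgroup (GL (Fin n) k) :=
  match c with
  | .galois k₀ _ => (Matrix.GeneralLinearGroup.map (n := Fin n) k₀.subtype).range
  | .levi => Subgroup.centralizer {alternatingSigns k n}

end ModularGL

/-! Fix a non-trivial additive character `ψ` of `k` with values in `R`, trivial on `k₀` in the
Galois case. For a representation of `GL_m(k)`, call derivative of level `d` the space of vectors on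
which `unitri k m d` acts through `superdiagChar ψ d`: they are fixed by the unipotent radical of
the parabolic of size `(d, m - d)` and are Whittaker vectors for the lower right `GL_{m-d}`. Level
`0` is the space of Whittaker vectors. All unipotent groups have odd order, which equals `1` in `R`,
so passing to eigenvectors is exact.

A linear form invariant under `H_m` that vanishes on the derivatives of all levels `d < m` is zero
(`eq_zero_of_forall_derivative`). Vectors are decomposed one column at a time under the characters
of the column group. The form kills components whose character is non-trivial on the part of that
group lying in `H_m`; the trivial character leads to a derivative; the remaining ones are moved by
`H_m` to the standard generic character.

For cuspidal `π` only level `0` survives, and it has dimension at most one by the Gelfand-Graev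
argument (`exists_whittaker_le_span`). So an invariant form on `π` is determined by its value at one
vector `ω`. For a quotient `τ` of `π × π`, a Mackey computation (`apply_eq_zero_of_initial`) leaves
only levels `0` and `n`. Level `n` is the image of `π ⊗ ω`, where an `H_{2n}`-invariant form becomes
an `H_n`-invariant form on `π`; hence it is determined by its value at the image of `ω ⊗ ω`.

What remains, and where characteristic two is essential, is that `τ` has no Whittaker vectors. The
standard intertwining operator `T` on `π × π` satisfies `T² = 1`, since `-1` acts trivially on `π`
and the unwanted terms cancel in pairs. The Whittaker vectors of `π × π` form at most a line, on
which `T` is a square root of `1`, hence `1`. Finally every vector fixed by `T` dies in every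
irreducible quotient (`map_eq_zero_of_involution`). -/

namespace ModularGL

/-! ### Isotypic projectors for subgroups of odd order -/

section Eigenvectors

variable {R G V W : Type*} [Field R] [Group G] [AddCommGroup V] [Module R V]
  [AddCommGroup W] [Module R W]

lemma rep_mul_apply (ρ : Representation R G V) (g h : G) (v : V) :
    ρ (g * h) v = ρ g (ρ h v) := by
  rw [_root_.map_mul, Module.End.mul_apply]

lemma rep_inv_apply (ρ : Representation R G V) (g : G) (v : V) : ρ g (ρ g⁻¹ v) = v := by
  rw [← rep_mul_apply, mul_inv_cancel, map_one, Module.End.one_apply]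

/-- `χ` restricts to a character of the subgroup `U`. -/
structure IsCharOn (U : Subgroup G) (χ : G → R) : Prop where
  map_one : χ 1 = 1
  map_mul : ∀ u ∈ U, ∀ v ∈ U, χ (u * v) = χ u * χ v

lemma IsCharOn.const_one (U : Subgroup G) : IsCharOn U (fun _ : G => (1 : R)) :=
  ⟨rfl, fun _ _ _ _ => (mul_one 1).symm⟩

/-- The vectors on which the subgroup `U` acts through `χ`. -/
def eigenvectors (ρ : Representation R G V) (U : Subgroup G) (χ : G → R) : Submodule R V where
  carrier := {v | ∀ u ∈ U, ρ u v = χ u • v}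
  add_mem' := fun {v w} hv hw u hu => by rw [map_add, hv u hu, hw u hu, smul_add]
  zero_mem' := fun u _ => by rw [map_zero, smul_zero]
  smul_mem' := fun c v hv u hu => by rw [map_smul, hv u hu, smul_comm]

/-- The projector onto the vectors on which `U` acts through `χ`, up to the order of `U`. -/
noncomputable def eigenProjector [Finite G] (ρ : Representation R G V) (U : Subgroup G)
    (χ : G → R) : V →ₗ[R] V :=
  letI := Fintype.ofFinite U
  ∑ u : U, χ ((u : G)⁻¹) • ρ u

variable [Finite G] {ρ : Representation R G V} {σ : Representation R G W} {U : Subgroup G}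
  {χ : G → R}

lemma eigenProjector_mem (hχ : IsCharOn U χ) (v : V) :
    eigenProjector ρ U χ v ∈ eigenvectors ρ U χ := by
  intro u hu
  simp only [eigenProjector, LinearMap.sum_apply, LinearMap.smul_apply, map_sum, map_smul,
    Finset.smul_sum]
  let _ := Fintype.ofFinite U
  refine Fintype.sum_equiv (Equiv.mulLeft ⟨u, hu⟩) _ _ fun x => ?_
  have h1 : χ ((x : G)⁻¹) = χ u * χ ((u * x)⁻¹) := by
    rw [mul_comm, ← hχ.map_mul _ (U.inv_mem (U.mul_mem hu x.2)) u hu, mul_inv_rev,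
      inv_mul_cancel_right]
  simp only [Equiv.coe_mulLeft, Subgroup.coe_mul, h1, mul_smul, _root_.map_mul, Module.End.mul_apply]

/-- The odd order of `U` is `1` in `R`, so the unnormalized sum is already a projector. -/
lemma eigenProjector_apply_of_mem [CharP R 2] (hχ : IsCharOn U χ) (hU : Odd (Nat.card U)) {v : V}
    (hv : v ∈ eigenvectors ρ U χ) : eigenProjector ρ U χ v = v := by
  let _ := Fintype.ofFinite U
  have hc : ((Nat.card U : ℕ) : R) = 1 := by
    obtain ⟨m, hm⟩ := hU
    rw [hm]
    push_cast
    rw [CharTwo.two_eq_zero, zero_mul, zero_add]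
  have : ∀ u : U, (χ ((u : G)⁻¹) • ρ u) v = v := fun u => by
    rw [LinearMap.smul_apply, hv u u.2, ← mul_smul, ← hχ.map_mul _ (U.inv_mem u.2) _ u.2,
      inv_mul_cancel, hχ.map_one, one_smul]
  have h2 : eigenProjector ρ U χ v = ∑ u : U, (χ ((u : G)⁻¹) • ρ u) v := by
    rw [eigenProjector, LinearMap.sum_apply]
  rw [h2]
  simp only [this, Finset.sum_const, Finset.card_univ, ← Nat.card_eq_fintype_card]
  rw [← Nat.cast_smul_eq_nsmul R, hc, one_smul]

/-- Moving an element of `U` into the projector. -/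
lemma eigenProjector_apply_group (hχ : IsCharOn U χ) {u : G} (hu : u ∈ U) (v : V) :
    eigenProjector ρ U χ (ρ u v) = χ u • eigenProjector ρ U χ v := by
  simp only [eigenProjector, LinearMap.sum_apply, LinearMap.smul_apply, Finset.smul_sum]
  let _ := Fintype.ofFinite U
  refine Fintype.sum_equiv (Equiv.mulRight ⟨u, hu⟩) _ _ fun x => ?_
  have h1 : χ ((x : G)⁻¹) = χ u * χ ((x * u : G)⁻¹) := by
    rw [← hχ.map_mul u hu _ (inv_mem (mul_mem x.2 hu)), mul_inv_rev, mul_inv_cancel_left]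
  simp only [Equiv.coe_mulRight, Subgroup.coe_mul, h1, mul_smul, _root_.map_mul,
    Module.End.mul_apply]

lemma map_eigenProjector (L : V →ₗ[R] W) (hL : ∀ u ∈ U, ∀ v, L (ρ u v) = σ u (L v)) (v : V) :
    L (eigenProjector ρ U χ v) = eigenProjector σ U χ (L v) := by
  simp only [eigenProjector, LinearMap.sum_apply, LinearMap.smul_apply, map_sum, map_smul]
  refine Finset.sum_congr rfl fun u _ => ?_
  rw [hL u u.2]

/-- Exactness of taking eigenvectors: project an arbitrary preimage. -/
lemma exists_mem_eigenvectors [CharP R 2] (hχ : IsCharOn U χ) (hU : Odd (Nat.card U))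
    (f : ρ.IntertwiningMap σ) (hf : Function.Surjective f) {w : W} (hw : w ∈ eigenvectors σ U χ) :
    ∃ v ∈ eigenvectors ρ U χ, f v = w := by
  obtain ⟨v, rfl⟩ := hf w
  refine ⟨eigenProjector ρ U χ v, eigenProjector_mem hχ v, ?_⟩
  have := map_eigenProjector (U := U) (χ := χ) (σ := σ) f.toLinearMap
    (fun u _ v => f.isIntertwining _ _ u v) v
  rw [Representation.IntertwiningMap.toLinearMap_apply,
    Representation.IntertwiningMap.toLinearMap_apply] at this
  rw [this, eigenProjector_apply_of_mem hχ hU hw]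

end Eigenvectors

/-! ### Unipotent groups attached to nil algebras of matrices -/

section Unipotent

variable {k : Type*} [Field k] [Finite k] {m : ℕ}

/-- The unipotent group `1 + 𝔫` attached to a nil subalgebra `𝔫` of the algebra of matrices. -/
def unipotent (N : NonUnitalSubalgebra k (Matrix (Fin m) (Fin m) k)) : Subgroup (GL (Fin m) k) where
  carrier := {g | g.val - 1 ∈ N}
  one_mem' := by simp
  mul_mem' {g h} hg hh := by
    have : (g * h).val - 1 = (g.val - 1) * (h.val - 1) + (g.val - 1) + (h.val - 1) := by
      rw [Units.val_mul]; noncomm_ring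
    change (g * h).val - 1 ∈ N
    rw [this]
    exact N.add_mem (N.add_mem (N.mul_mem hg hh) hg) hh
  inv_mem' {g} hg := by
    have hpow : ∀ j : ℕ, (g ^ j).val - 1 ∈ N := by
      intro j
      induction j with
      | zero => simp
      | succ j ih =>
        have : (g ^ (j + 1)).val - 1
            = ((g ^ j).val - 1) * (g.val - 1) + ((g ^ j).val - 1) + (g.val - 1) := by
          rw [pow_succ, Units.val_mul]; noncomm_ring
        rw [this]
        exact N.add_mem (N.add_mem (N.mul_mem ih hg) ih) hg
    change (g⁻¹).val - 1 ∈ N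
    -- In a finite group the inverse is a power, so closure under products is enough.
    have h1 : g ^ (Nat.card (GL (Fin m) k) - 1) = g⁻¹ := by
      rw [eq_inv_iff_mul_eq_one, ← pow_succ, Nat.sub_add_cancel Nat.card_pos, pow_card_eq_one']
    rw [← h1]
    exact hpow _

lemma mem_unipotent {N : NonUnitalSubalgebra k (Matrix (Fin m) (Fin m) k)}
    {g : GL (Fin m) k} : g ∈ unipotent N ↔ g.val - 1 ∈ N := Iff.rfl

lemma odd_card_field (hk : ringChar k ≠ 2) : Odd (Nat.card k) := by
  have := Fintype.ofFinite k
  rw [Nat.card_eq_fintype_card]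
  exact Nat.odd_iff.2 (FiniteField.odd_card_of_char_ne_two hk)

lemma odd_card_module (hk : ringChar k ≠ 2) (M : Type*) [AddCommGroup M] [Module k M]
    [Module.Finite k M] : Odd (Nat.card M) := by
  rw [Module.natCard_eq_pow_finrank (K := k)]
  exact (odd_card_field hk).pow

lemma odd_card_unipotent (hk : ringChar k ≠ 2)
    {N : NonUnitalSubalgebra k (Matrix (Fin m) (Fin m) k)} (hN : ∀ x ∈ N, IsNilpotent x) :
    Odd (Nat.card (unipotent N)) := by
  have e : unipotent N ≃ N.toSubmodule :=
    { toFun := fun g => ⟨g.1.val - 1, g.2⟩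
      invFun := fun x => ⟨(hN x.1 x.2).isUnit_one_add.unit, by
        rw [mem_unipotent, IsUnit.unit_spec, add_sub_cancel_left]; exact x.2⟩
      left_inv := fun g => by
        ext1; ext1
        rw [IsUnit.unit_spec]
        exact add_sub_cancel 1 _
      right_inv := fun x => by
        ext1
        exact add_sub_cancel_left 1 x.1 }
  rw [Nat.card_congr e]
  exact odd_card_module hk _

end Unipotent

/-! ### Irreducible representations of finite groups and Burnside's theorem -/

section Burnside

variable {R G V : Type*} [Field R] [Group G] [AddCommGroup V] [Module R V]

lemma subrep_eq_top {ρ : Representation R G V} (hρ : ρ.IsIrreducible) (S : Submodule R V)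
    (hS : ∀ g, ∀ v ∈ S, ρ g v ∈ S) {v : V} (hv : v ∈ S) (hv0 : v ≠ 0) : S = ⊤ := by
  have := hρ
  let S' : Subrepresentation ρ := ⟨S, fun g v hv => hS g v hv⟩
  rcases eq_bot_or_eq_top S' with h | h
  · exfalso
    have : v ∈ S' := hv
    rw [h] at this
    exact hv0 this
  · exact congrArg Subrepresentation.toSubmodule h

lemma injective_of_irreducible {ρ : Representation R G V} (hρ : ρ.IsIrreducible) {W : Type*}
    [AddCommGroup W] [Module R W] (f : V →ₗ[R] W) (hf : ∀ g v, f v = 0 → f (ρ g v) = 0) {v : V}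
    (hv : f v ≠ 0) : Function.Injective f := by
  rw [injective_iff_map_eq_zero]
  intro x hx
  by_contra hx0
  have h := subrep_eq_top hρ (LinearMap.ker f) (fun g w hw => hf g w hw) (v := x) hx hx0
  exact hv (LinearMap.mem_ker.1 (h ▸ Submodule.mem_top))

lemma exists_ne_zero_of_irreducible {ρ : Representation R G V} (hρ : ρ.IsIrreducible) :
    ∃ v : V, v ≠ 0 := by
  by_contra! h
  have := hρ
  have h1 : (⊥ : Subrepresentation ρ) ≠ ⊤ := bot_ne_top
  apply h1
  ext v
  rw [h v]
  exact ⟨fun _ => Submodule.zero_mem _, fun _ => Submodule.zero_mem _⟩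

lemma finiteDimensional_of_irreducible [Finite G] {ρ : Representation R G V} (hρ : ρ.IsIrreducible) :
    FiniteDimensional R V := by
  obtain ⟨v, hv⟩ := exists_ne_zero_of_irreducible hρ
  have h : Submodule.span R (Set.range fun g => ρ g v) = ⊤ := by
    refine subrep_eq_top hρ _ (fun g w hw => ?_) (v := v) (Submodule.subset_span ⟨1, by simp⟩) hv
    induction hw using Submodule.span_induction with
    | mem x hx =>
      obtain ⟨h, rfl⟩ := hx
      exact Submodule.subset_span ⟨g * h, by simp⟩
    | zero => simp
    | add x y _ _ hx hy => rw [map_add]; exact Submodule.add_mem _ hx hy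
    | smul c x _ hx => rw [map_smul]; exact Submodule.smul_mem _ _ hx
  exact ⟨(Submodule.fg_def).2 ⟨_, Set.finite_range _, h⟩⟩

open scoped MonoidAlgebra in
/-- **Burnside's theorem** for irreducible representations of a finite group. -/
theorem span_range_eq_top [Finite G] [IsAlgClosed R] {ρ : Representation R G V} (hρ : ρ.IsIrreducible) :
    Submodule.span R (Set.range ρ) = ⊤ := by
  have := hρ
  have := finiteDimensional_of_irreducible hρ
  have hfin : FiniteDimensional R ρ.asModule := this
  rw [eq_top_iff]
  intro A _
  classical
  let b := Module.finBasis R V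
  have hb := IsSimpleModule.algebraMap_end_bijective_of_isAlgClosed (A := R[G]) (V := ρ.asModule) R
  -- By Schur's lemma the commutant of `ρ` consists of scalars, so any `R`-linear `A` is linear over
  -- it. The density theorem then matches `A` on a basis with an element of the group algebra.
  let A' : Module.End (Module.End R[G] ρ.asModule) ρ.asModule :=
    { toFun := fun v => A v
      map_add' := fun v w => map_add A v w
      map_smul' := fun c v => by
        obtain ⟨r, rfl⟩ := hb.2 c
        exact map_smul A r v }
  obtain ⟨r, hr⟩ := jacobson_density A' (Finset.univ.image fun i => (b i : ρ.asModule))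
  have hA : A = ρ.asAlgebraHom r := by
    refine b.ext fun i => ?_
    exact hr (b i) (Finset.mem_image_of_mem _ (Finset.mem_univ i))
  rw [hA]
  clear hA hr
  induction r using MonoidAlgebra.induction_linear with
  | zero => rw [map_zero]; exact Submodule.zero_mem _
  | add x y hx hy =>
    rw [map_add]
    exact Submodule.add_mem _ hx hy
  | single g a =>
    rw [Representation.asAlgebraHom_single]
    exact Submodule.smul_mem _ _ (Submodule.subset_span ⟨g, rfl⟩)

end Burnside

/-! ### Unitriangular groups and their generic and degenerate characters -/

section Triangular

variable {k : Type*} [Field k] {m : ℕ}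

/-- The strictly upper triangular matrices whose first `d` columns vanish. -/
def upperFrom (k : Type*) [Field k] (m d : ℕ) :
    NonUnitalSubalgebra k (Matrix (Fin m) (Fin m) k) where
  carrier := {x | ∀ i j : Fin m, (j ≤ i ∨ j.val < d) → x i j = 0}
  add_mem' := fun {x y} hx hy i j h => by rw [Matrix.add_apply, hx i j h, hy i j h, add_zero]
  zero_mem' := fun i j _ => rfl
  smul_mem' := fun c x hx i j h => by rw [Matrix.smul_apply, hx i j h, smul_zero]
  mul_mem' := fun {x y} hx hy i j h => by
    rw [Matrix.mul_apply]
    refine Finset.sum_eq_zero fun l _ => ?_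
    by_cases hl : l ≤ i
    · rw [hx i l (Or.inl hl), zero_mul]
    · rw [hy l j, mul_zero]
      rcases h with h | h
      · exact Or.inl (h.trans (not_le.1 hl).le)
      · exact Or.inr h

lemma upperFrom_le {d d' : ℕ} (h : d ≤ d') {x : Matrix (Fin m) (Fin m) k}
    (hx : x ∈ upperFrom k m d') : x ∈ upperFrom k m d :=
  fun i j hij => hx i j (hij.imp_right fun h' => h'.trans_le h)

lemma isNilpotent_of_mem_upperFrom {d : ℕ} {x : Matrix (Fin m) (Fin m) k}
    (hx : x ∈ upperFrom k m d) : IsNilpotent x := by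
  have h : ∀ p : ℕ, ∀ i j : Fin m, j.val < i.val + p → (x ^ p) i j = 0 := by
    intro p
    induction p with
    | zero =>
      intro i j hij
      rw [pow_zero, Matrix.one_apply_ne]
      exact fun h => by simp [h] at hij
    | succ p ih =>
      intro i j hij
      rw [pow_succ, Matrix.mul_apply]
      refine Finset.sum_eq_zero fun l _ => ?_
      by_cases hl : l.val < i.val + p
      · rw [ih i l hl, zero_mul]
      · rw [hx l j (Or.inl (Fin.le_def.2 (by omega))), mul_zero]
  refine ⟨m, ?_⟩
  ext i j
  exact h m i j (by omega)

/-- The sum of the entries of `x` at the places `(i, i + 1)` with `d ≤ i`. -/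
def superdiag (d : ℕ) (x : Matrix (Fin m) (Fin m) k) : k :=
  ∑ i, ∑ j, if i.val + 1 = j.val ∧ d ≤ i.val then x i j else 0

lemma superdiag_add (d : ℕ) (x y : Matrix (Fin m) (Fin m) k) :
    superdiag d (x + y) = superdiag d x + superdiag d y := by
  simp only [superdiag, ← Finset.sum_add_distrib]
  refine Finset.sum_congr rfl fun i _ => Finset.sum_congr rfl fun j _ => ?_
  split_ifs <;> simp

lemma superdiag_congr (d : ℕ) {x y : Matrix (Fin m) (Fin m) k}
    (h : ∀ i j : Fin m, i.val + 1 = j.val → d ≤ i.val → x i j = y i j) :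
    superdiag d x = superdiag d y := by
  refine Finset.sum_congr rfl fun i _ => Finset.sum_congr rfl fun j _ => ?_
  split_ifs with hij
  · exact h i j hij.1 hij.2
  · rfl

lemma superdiag_eq_zero (d : ℕ) {x : Matrix (Fin m) (Fin m) k}
    (h : ∀ i j : Fin m, i.val + 1 = j.val → d ≤ i.val → x i j = 0) : superdiag d x = 0 := by
  rw [superdiag_congr d (y := 0) h]
  simp [superdiag]

lemma superdiag_eq_single (d : ℕ) {x : Matrix (Fin m) (Fin m) k} (i₀ j₀ : Fin m)
    (h0 : i₀.val + 1 = j₀.val) (hd : d ≤ i₀.val)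
    (h : ∀ i j : Fin m, i.val + 1 = j.val → i ≠ i₀ → x i j = 0) :
    superdiag d x = x i₀ j₀ := by
  rw [superdiag, Finset.sum_eq_single i₀, Finset.sum_eq_single j₀]
  · rw [if_pos ⟨h0, hd⟩]
  · intro j _ hj
    rw [if_neg]
    rintro ⟨h1, -⟩
    exact hj (Fin.ext (h1.symm.trans h0))
  · simp
  · intro i _ hi
    refine Finset.sum_eq_zero fun j _ => ?_
    split_ifs with hij
    · exact h i j hij.1 hi
    · rfl
  · simp

lemma superdiag_one (d : ℕ) : superdiag d (1 : Matrix (Fin m) (Fin m) k) = 0 :=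
  superdiag_eq_zero d fun i j h _ => Matrix.one_apply_ne fun h' => by simp [h'] at h

lemma superdiag_one_add (d : ℕ) (x : Matrix (Fin m) (Fin m) k) :
    superdiag d (1 + x) = superdiag d x := by
  rw [superdiag_add, superdiag_one, zero_add]

variable {R : Type*} [Field R]

/-- The function on `GL_m(k)` which sends `g` to the value of the additive character `ψ` at the sum
of the entries of `g` at the places `(i, i + 1)` with `d ≤ i`. -/
def superdiagChar (ψ : AddChar k R) (d : ℕ) (g : GL (Fin m) k) : R := ψ (superdiag d g.val)

variable [Finite k]

/-- The upper unitriangular matrices whose first `d` columns are those of the identity. -/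
abbrev unitri (k : Type*) [Field k] [Finite k] (m d : ℕ) : Subgroup (GL (Fin m) k) :=
  unipotent (upperFrom k m d)

lemma unitri_le {d d' : ℕ} (h : d ≤ d') : unitri k m d' ≤ unitri k m d :=
  fun _ hu => upperFrom_le h hu

lemma unitri_apply {d : ℕ} {u : GL (Fin m) k} (hu : u ∈ unitri k m d) (i j : Fin m)
    (h : j ≤ i ∨ j.val < d) : u.val i j = (1 : Matrix (Fin m) (Fin m) k) i j := by
  have := hu i j h
  rwa [Matrix.sub_apply, sub_eq_zero] at this

lemma odd_card_unitri (hk : ringChar k ≠ 2) (d : ℕ) : Odd (Nat.card (unitri k m d)) :=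
  odd_card_unipotent hk fun _ hx => isNilpotent_of_mem_upperFrom hx

/-- The product of two strictly upper triangular matrices vanishes on the first superdiagonal. -/
lemma superdiag_mul (d : ℕ) {u v : GL (Fin m) k} (hu : u ∈ unitri k m 0) (hv : v ∈ unitri k m 0) :
    superdiag d (u * v).val = superdiag d u.val + superdiag d v.val := by
  have h : (u * v).val = u.val + ((v.val - 1) + (u.val - 1) * (v.val - 1)) := by
    rw [Units.val_mul]; noncomm_ring
  have h2 : v.val = 1 + (v.val - 1) := (add_sub_cancel _ _).symm
  rw [h, superdiag_add, superdiag_add, superdiag_eq_zero (x := (u.val - 1) * (v.val - 1)), add_zero]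
  · conv_rhs => rw [h2, superdiag_one_add]
  · intro i j hij _
    rw [Matrix.mul_apply]
    refine Finset.sum_eq_zero fun l _ => ?_
    by_cases hl : l ≤ i
    · rw [hu i l (Or.inl hl), zero_mul]
    · rw [hv l j (Or.inl (Fin.le_def.2 (by rw [Fin.le_def] at hl; omega))), mul_zero]

lemma isCharOn_superdiagChar (ψ : AddChar k R) (d d' : ℕ) :
    IsCharOn (unitri k m d) (superdiagChar ψ d') :=
  ⟨by rw [superdiagChar, Units.val_one, superdiag_one, AddChar.map_zero_eq_one],
   fun u hu v hv => by
    rw [superdiagChar, superdiag_mul d' (unitri_le (Nat.zero_le d) hu)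
      (unitri_le (Nat.zero_le d) hv), AddChar.map_add_eq_mul]; rfl⟩

omit [Finite k] in
lemma superdiagChar_ne_zero (ψ : AddChar k R) (d : ℕ) (u : GL (Fin m) k) :
    superdiagChar ψ d u ≠ 0 := (ψ.val_isUnit _).ne_zero

omit [Finite k] in
/-- The transvection `1 + c ρ`, where `ρ c = 0`. -/
lemma exists_transvection (c ρ : Fin m → k) (h : ρ ⬝ᵥ c = 0) :
    ∃ u : GL (Fin m) k, u.val = 1 + Matrix.vecMulVec c ρ := by
  have h0 : Matrix.vecMulVec c ρ * Matrix.vecMulVec c ρ = 0 := by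
    rw [Matrix.vecMulVec_mul_vecMulVec, h]
    simp
  exact ⟨⟨1 + Matrix.vecMulVec c ρ, 1 - Matrix.vecMulVec c ρ,
    by rw [add_mul, mul_sub, mul_sub, h0]; simp, by rw [sub_mul, mul_add, mul_add, h0]; simp⟩, rfl⟩

lemma exists_unitri_transvection (d : ℕ) (c ρ : Fin m → k)
    (h : ∀ i j, (j ≤ i ∨ j.val < d) → c i = 0 ∨ ρ j = 0) :
    ∃ u ∈ unitri k m d, u.val = 1 + Matrix.vecMulVec c ρ := by
  obtain ⟨u, hu⟩ := exists_transvection c ρ (by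
    rw [dotProduct]
    exact Finset.sum_eq_zero fun i _ => by
      rcases h i i (Or.inl le_rfl) with h | h <;> simp [h])
  refine ⟨u, fun i j hij => ?_, hu⟩
  rw [hu, add_sub_cancel_left, Matrix.vecMulVec_apply]
  rcases h i j hij with h | h <;> simp [h]

end Triangular

/-! ### Bi-equivariant functions and reflection in the antidiagonal -/

section GelfandGraev

variable {k : Type*} [Field k] {n : ℕ}

/-- The reflection of a square matrix in its antidiagonal. -/
def antiTranspose (x : Matrix (Fin n) (Fin n) k) : Matrix (Fin n) (Fin n) k :=
  fun i j => x j.rev i.rev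

lemma antiTranspose_mul (x y : Matrix (Fin n) (Fin n) k) :
    antiTranspose (x * y) = antiTranspose y * antiTranspose x := by
  ext i j
  simp only [antiTranspose, Matrix.mul_apply]
  refine Fintype.sum_equiv Fin.revPerm _ _ fun l => ?_
  simp [mul_comm]

lemma antiTranspose_one : antiTranspose (1 : Matrix (Fin n) (Fin n) k) = 1 := by
  ext i j
  simp only [antiTranspose, Matrix.one_apply, Fin.rev_inj, eq_comm]

/-- The reflection in the antidiagonal, as an anti-automorphism of `GL_n(k)`. -/
def antiTransposeGL (g : GL (Fin n) k) : GL (Fin n) k :=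
  ⟨antiTranspose g.val, antiTranspose (g⁻¹).val,
    by rw [← antiTranspose_mul, Units.inv_mul, antiTranspose_one],
    by rw [← antiTranspose_mul, Units.mul_inv, antiTranspose_one]⟩

lemma antiTransposeGL_mul (g h : GL (Fin n) k) :
    antiTransposeGL (g * h) = antiTransposeGL h * antiTransposeGL g := by
  ext1; exact antiTranspose_mul _ _

lemma antiTransposeGL_antiTransposeGL (g : GL (Fin n) k) :
    antiTransposeGL (antiTransposeGL g) = g := by
  ext i j
  simp [antiTransposeGL, antiTranspose]

lemma superdiag_antiTranspose (x : Matrix (Fin n) (Fin n) k) :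
    superdiag 0 (antiTranspose x) = superdiag 0 x := by
  rw [superdiag, superdiag, Finset.sum_comm]
  refine Fintype.sum_equiv Fin.revPerm _ _ fun j => ?_
  refine Fintype.sum_equiv Fin.revPerm _ _ fun i => ?_
  simp only [antiTranspose, Fin.revPerm_apply, Fin.val_rev]
  congr 1
  simp only [Nat.zero_le, and_true, eq_iff_iff]
  omega

variable [Finite k]

lemma antiTransposeGL_mem {u : GL (Fin n) k} (hu : u ∈ unitri k n 0) :
    antiTransposeGL u ∈ unitri k n 0 := by
  intro i j hij
  have := hu j.rev i.rev (Or.inl (by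
    rcases hij with h | h
    · exact Fin.rev_le_rev.2 h
    · simp at h))
  rw [Matrix.sub_apply] at this ⊢
  rw [← this]
  congr 1
  simp only [Matrix.one_apply, Fin.rev_inj, eq_comm]

/-- The matrix `g` is block antidiagonal, its lower left block being of size `m` and symmetric with
respect to the antidiagonal. -/
structure IsAntiBlock (m : ℕ) (g : Matrix (Fin n) (Fin n) k) : Prop where
  lower : ∀ i j : Fin n, n ≤ i.val + m → m ≤ j.val → g i j = 0
  upper : ∀ i j : Fin n, i.val + m < n → j.val < m → g i j = 0
  symm : ∀ i j : Fin n, n ≤ i.val + m → j.val < m → g i j = g j.rev i.rev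

variable {R A : Type*} [Field R] [AddCommGroup A] [Module R A]

/-- The function `f` transforms on both sides under the upper unitriangular matrices by the
generic character attached to `ψ`. -/
structure IsBiWhittaker (ψ : AddChar k R) (f : GL (Fin n) k → A) : Prop where
  left : ∀ u ∈ unitri k n 0, ∀ g, f (u * g) = superdiagChar ψ 0 u • f g
  right : ∀ u ∈ unitri k n 0, ∀ g, f (g * u) = superdiagChar ψ 0 u • f g

variable {ψ : AddChar k R} {f : GL (Fin n) k → A}

omit [Finite k] in
-- The dilates of a non-trivial `ψ` separate the points of `k`: solve `s * (a - b) = x` for any `x`.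
lemma eq_of_forall_addChar (hψ : ψ ≠ 1) {a b : k} (h : ∀ s, ψ (s * a) = ψ (s * b)) : a = b := by
  by_contra hab
  apply hψ
  ext x
  have h1 : ψ (x / (a - b) * a - x / (a - b) * b) = 1 := by
    rw [sub_eq_add_neg, AddChar.map_add_eq_mul, h, ← AddChar.map_add_eq_mul, add_neg_cancel,
      AddChar.map_zero_eq_one]
  rw [← mul_sub, div_mul_cancel₀ _ (sub_ne_zero.2 hab)] at h1
  rw [h1]; rfl

/-- Clearing row `i₀` and column `p` around a pivot at `(i₀, p)`. -/
lemma exists_clear (g : GL (Fin n) k) (i₀ p : Fin n) (ht : g.val i₀ p ≠ 0)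
    (hrow : ∀ c < p, g.val i₀ c = 0) (hcol : ∀ a, i₀ < a → g.val a p = 0) :
    ∃ u ∈ unitri k n 0, ∃ u' ∈ unitri k n 0,
      ∀ a c, (u * g * u').val a c = if a = i₀ then (if c = p then g.val i₀ p else 0) else
        if c = p then 0 else g.val a c - g.val a p * (g.val i₀ p)⁻¹ * g.val i₀ c := by
  obtain ⟨u', hu', hu'v⟩ := exists_unitri_transvection 0 (Pi.single p 1)
    (fun c => if p < c then -((g.val i₀ p)⁻¹ * g.val i₀ c) else 0) (fun a c h => by
      rcases eq_or_ne a p with rfl | ha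
      · right
        rw [if_neg]
        rcases h with h | h
        · exact not_lt.2 h
        · simp at h
      · left; rw [Pi.single_eq_of_ne ha])
  obtain ⟨u, hu, huv⟩ := exists_unitri_transvection 0
    (fun a => if a < i₀ then -((g.val i₀ p)⁻¹ * g.val a p) else 0) (Pi.single i₀ 1) (fun a c h => by
      rcases eq_or_ne c i₀ with rfl | hc
      · left
        rw [if_neg]
        rcases h with h | h
        · exact not_lt.2 h
        · simp at h
      · right; rw [Pi.single_eq_of_ne hc])
  have h1 : ∀ a c, (g * u').val a c
      = g.val a c + g.val a p * if p < c then -((g.val i₀ p)⁻¹ * g.val i₀ c) else 0 := by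
    intro a c
    rw [Units.val_mul, hu'v, mul_add, mul_one, Matrix.add_apply, Matrix.mul_vecMulVec,
      Matrix.vecMulVec_apply, Matrix.mulVec_single_one, Matrix.col_apply]
  have h2 : ∀ c, (g * u').val i₀ c = if c = p then g.val i₀ p else 0 := by
    intro c
    rw [h1]
    rcases lt_trichotomy c p with hc | rfl | hc
    · rw [if_neg hc.not_gt, if_neg hc.ne, hrow c hc]; simp
    · simp
    · rw [if_pos hc, if_neg hc.ne']
      field_simp
      simp
  refine ⟨u, hu, u', hu', fun a c => ?_⟩
  have h3 : (u * g * u').val a c = (g * u').val a c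
      + (if a < i₀ then -((g.val i₀ p)⁻¹ * g.val a p) else 0) * (g * u').val i₀ c := by
    rw [mul_assoc, Units.val_mul u, huv, add_mul, one_mul, Matrix.add_apply, Matrix.vecMulVec_mul,
      Matrix.vecMulVec_apply, Matrix.single_one_vecMul, Matrix.row_apply]
  rw [h3, h2]
  by_cases ha : a = i₀
  · rw [if_pos ha, ha, h2, if_neg (lt_irrefl _), zero_mul, add_zero]
  · rw [if_neg ha, h1]
    rcases lt_trichotomy c p with hc | rfl | hc
    · rw [if_neg hc.ne, if_neg hc.not_gt, hrow c hc, if_neg hc.ne]; simp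
    · rw [if_pos rfl, if_pos rfl, if_neg (lt_irrefl _)]
      rcases lt_or_gt_of_ne ha with h | h
      · rw [if_pos h]; field_simp; simp
      · rw [hcol a h]; simp
    · rw [if_neg hc.ne', if_pos hc, if_neg hc.ne']; ring

omit [Finite k] in
-- The pivot lies outside the rows and columns of the lower left block. The pivot column vanishes on
-- the last `m` rows and the pivot row on the first `m` columns, so the clearing does not disturb
-- that block.
lemma IsAntiBlock.clear {m : ℕ} {g g' : Matrix (Fin n) (Fin n) k} (hg : IsAntiBlock m g)
    {i₀ p : Fin n} (hi : i₀.val + m < n) (hp : m ≤ p.val)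
    (h : ∀ a c, g' a c = if a = i₀ then (if c = p then g i₀ p else 0) else
        if c = p then 0 else g a c - g a p * (g i₀ p)⁻¹ * g i₀ c) : IsAntiBlock m g' := by
  have hs : ∀ a c : Fin n, n ≤ a.val + m → c.val < m → g' a c = g a c := by
    intro a c ha hc
    rw [h, if_neg (by rintro rfl; omega), if_neg (by rintro rfl; omega), hg.lower a p ha hp]
    simp
  refine ⟨fun a c ha hc => ?_, fun a c ha hc => ?_, fun a c ha hc => ?_⟩
  · rw [h, if_neg (by rintro rfl; omega), hg.lower a p ha hp, hg.lower a c ha hc]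
    simp
  · have hcp : c ≠ p := by rintro rfl; omega
    rw [h, if_neg hcp, if_neg hcp, hg.upper a c ha hc, hg.upper i₀ c hi hc]
    simp
  · rw [hs a c ha hc, hs _ _ (by rw [Fin.val_rev]; omega) (by rw [Fin.val_rev]; omega),
      hg.symm a c ha hc]

/-- The next `r` rows and columns of `g`, after a symmetric lower left block of size `m`, are those
of a scalar block ending in column `j₀`. -/
structure IsPartialBlock (m r j₀ : ℕ) (t : k) (g : Matrix (Fin n) (Fin n) k) : Prop where
  block : IsAntiBlock m g
  row : ∀ s < r, ∀ a c : Fin n, a.val + m + 1 + s = n → g a c = if c.val + s = j₀ then t else 0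
  col : ∀ s < r, ∀ a c : Fin n, c.val + s = j₀ → g a c = if a.val + m + 1 + s = n then t else 0

omit [Finite k] in
-- The equation `m + r = j₀ + 1` says that the scalar block starts in column `m`, right after the
-- old block. A scalar block is symmetric about the antidiagonal, so the two blocks together are
-- again symmetric.
lemma IsPartialBlock.isAntiBlock {m r j₀ : ℕ} {t : k} {g : Matrix (Fin n) (Fin n) k}
    (hg : IsPartialBlock m r j₀ t g) (h : m + r = j₀ + 1) :
    IsAntiBlock (m + r) g := by
  refine ⟨fun a c ha hc => ?_, fun a c ha hc => ?_, fun a c ha hc => ?_⟩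
  · by_cases h1 : n ≤ a.val + m
    · exact hg.block.lower a c h1 (by omega)
    · rw [hg.row (n - 1 - m - a.val) (by omega) a c (by omega), if_neg (by omega)]
  · by_cases h1 : c.val < m
    · exact hg.block.upper a c (by omega) h1
    · rw [hg.col (j₀ - c.val) (by omega) a c (by omega), if_neg (by omega)]
  · by_cases h1 : n ≤ a.val + m
    · by_cases h2 : c.val < m
      · exact hg.block.symm a c h1 h2
      · rw [hg.block.lower a c h1 (by omega),
          hg.block.upper _ _ (by rw [Fin.val_rev]; omega) (by rw [Fin.val_rev]; omega)]
    · by_cases h2 : c.val < m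
      · rw [hg.block.upper a c (by omega) h2,
          hg.block.lower _ _ (by rw [Fin.val_rev]; omega) (by rw [Fin.val_rev]; omega)]
      · rw [hg.row (n - 1 - m - a.val) (by omega) a c (by omega),
          hg.row (c.val - m) (by omega) c.rev a.rev (by rw [Fin.val_rev]; omega), Fin.val_rev]
        congr 1
        rw [eq_iff_iff]
        omega

omit [Finite k] in
lemma exists_ne_zero_row (g : GL (Fin n) k) (i : Fin n) : ∃ j, g.val i j ≠ 0 := by
  by_contra! h
  have h1 : (g * g⁻¹).val i i = 0 := by
    rw [Units.val_mul, Matrix.mul_apply]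
    exact Finset.sum_eq_zero fun j _ => by rw [h j, zero_mul]
  rw [mul_inv_cancel, Units.val_one, Matrix.one_apply_eq] at h1
  exact one_ne_zero h1

/-- The pivot is the leftmost non-zero entry of the first row above the old block; the block shape
makes its column vanish below it. -/
lemma exists_isPartialBlock_one {m : ℕ} (hm : m < n) {g : GL (Fin n) k}
    (hg : IsAntiBlock m g.val) :
    ∃ j₀, m ≤ j₀ ∧ j₀ < n ∧ ∃ t : k, t ≠ 0 ∧ ∃ u ∈ unitri k n 0, ∃ u' ∈ unitri k n 0,
      IsPartialBlock m 1 j₀ t (u * g * u').val := by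
  classical
  let i₀ : Fin n := ⟨n - m - 1, by omega⟩
  obtain ⟨p, hp, hmin⟩ : ∃ p, g.val i₀ p ≠ 0 ∧ ∀ c < p, g.val i₀ c = 0 := by
    have hne : (Finset.univ.filter fun j => g.val i₀ j ≠ 0).Nonempty := by
      obtain ⟨j, hj⟩ := exists_ne_zero_row g i₀
      exact ⟨j, by simpa using hj⟩
    refine ⟨Finset.min' _ hne, ?_, fun c hc => ?_⟩
    · simpa using Finset.min'_mem _ hne
    · by_contra h
      exact absurd (Finset.min'_le (Finset.univ.filter fun j => g.val i₀ j ≠ 0) c (by simpa using h))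
        (not_le.2 hc)
  have hmp : m ≤ p.val := by
    by_contra h
    exact hp (hg.upper i₀ p (by simp only [i₀]; omega) (by omega))
  obtain ⟨u, hu, u', hu', h⟩ := exists_clear g i₀ p hp hmin (fun a ha =>
    hg.lower a p (by rw [Fin.lt_def] at ha; simp only [i₀] at ha; omega) hmp)
  refine ⟨p, hmp, p.2, g.val i₀ p, hp, u, hu, u', hu',
    hg.clear (i₀ := i₀) (by simp only [i₀]; omega) hmp h, ?_, ?_⟩
  · intro s hs a c hac
    have ha : a = i₀ := by ext; simp only [i₀]; omega
    rw [h, if_pos ha]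
    congr 1
    rw [eq_iff_iff, Fin.ext_iff]
    omega
  · intro s hs a c hac
    have hc : c = p := by ext; omega
    rw [h, if_pos hc, if_pos hc]
    congr 1
    rw [eq_iff_iff, Fin.ext_iff]
    simp only [i₀]
    omega

/-- Since row `i₀ + 1` of `g` is `t` times a basis vector, a transvection on the left of `g`, built
from column `c` of `g`, equals one on the right. Comparing the two characters on `f g ≠ 0` gives `ψ
(s * t⁻¹ * g i₀ c) = ψ (s * δ)`, with `δ` equal to `1` if `c = p` and `0` otherwise, for all `s`. -/
lemma IsBiWhittaker.entry_eq (hψ : ψ ≠ 1) (hf : IsBiWhittaker ψ f) {m r j₀ : ℕ} {t : k}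
    (ht : t ≠ 0) {g : GL (Fin n) k} (hfg : f g ≠ 0) (hg : IsPartialBlock m r j₀ t g.val)
    (hr : 1 ≤ r) (hm : m + r ≤ j₀) (hj : j₀ < n) (i₀ p c : Fin n) (hi : i₀.val + m + 1 + r = n)
    (hp : p.val + r = j₀) (hc : c ≤ p) : g.val i₀ c = if c = p then t else 0 := by
  rw [Fin.le_def] at hc
  by_cases hcm : c.val < m
  · rw [hg.block.upper i₀ c (by omega) hcm, if_neg (by rintro rfl; omega)]
  have hcol : ∀ a : Fin n, i₀ < a → g.val a c = 0 := by
    intro a ha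
    rw [Fin.lt_def] at ha
    by_cases h : n ≤ a.val + m
    · exact hg.block.lower a c h (by omega)
    · rw [hg.row (n - 1 - m - a.val) (by omega) a c (by omega), if_neg (by omega)]
  let l : Fin n := ⟨p.val + 1, by omega⟩
  let i₁ : Fin n := ⟨i₀.val + 1, by omega⟩
  have hrow : ∀ b : Fin n, g.val i₁ b = if b = l then t else 0 := by
    intro b
    rw [hg.row (r - 1) (by omega) i₁ b (by simp only [i₁]; omega)]
    congr 1
    rw [eq_iff_iff, Fin.ext_iff]
    simp only [l]
    omega
  have key : ∀ s : k, ψ (s * (t⁻¹ * g.val i₀ c)) = ψ (s * if c = p then 1 else 0) := by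
    intro s
    obtain ⟨u, hu, huv⟩ := exists_unitri_transvection 0 (fun a => s * t⁻¹ * g.val a c)
      (Pi.single i₁ 1) (fun a b h => by
        rcases eq_or_ne b i₁ with rfl | hb
        · left
          rw [hcol a, mul_zero]
          rcases h with h | h
          · rw [Fin.le_def] at h
            rw [Fin.lt_def]
            simp only [i₁] at h
            omega
          · simp at h
        · right; rw [Pi.single_eq_of_ne hb])
    obtain ⟨u', hu', hu'v⟩ := exists_unitri_transvection 0 (Pi.single c s)
      (Pi.single l (1 : k)) (fun a b h => by
        rcases eq_or_ne b l with rfl | hb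
        · left
          rw [Pi.single_eq_of_ne]
          rintro rfl
          rcases h with h | h
          · rw [Fin.le_def] at h
            simp only [l] at h
            omega
          · simp at h
        · right; rw [Pi.single_eq_of_ne hb])
    have hcomm : u * g = g * u' := by
      ext a b
      rw [Units.val_mul, Units.val_mul, huv, hu'v, add_mul, mul_add, one_mul, mul_one,
        Matrix.vecMulVec_mul, Matrix.mul_vecMulVec, Matrix.add_apply, Matrix.add_apply,
        Matrix.vecMulVec_apply, Matrix.vecMulVec_apply, Matrix.single_one_vecMul, Matrix.row_apply,
        hrow, Matrix.mulVec_single]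
      congr 1
      rcases eq_or_ne b l with rfl | hb
      · simp; field_simp
      · simp [hb]
    have h1 := hf.left u hu g
    rw [hcomm, hf.right u' hu' g] at h1
    have h2 := smul_left_injective R hfg h1
    simp only [superdiagChar, huv, hu'v, superdiag_one_add] at h2
    rw [superdiag_eq_single 0 p l rfl (Nat.zero_le _), superdiag_eq_single 0 i₀ i₁ rfl
      (Nat.zero_le _)] at h2
    · rw [Matrix.vecMulVec_apply, Matrix.vecMulVec_apply, Pi.single_eq_same, Pi.single_eq_same,
        mul_one, mul_one] at h2
      rw [← mul_assoc, ← h2]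
      rcases eq_or_ne c p with rfl | hcp
      · simp
      · simp [hcp]
    · intro a b hab ha
      rw [Matrix.vecMulVec_apply, Pi.single_eq_of_ne (i := i₁), mul_zero]
      rintro rfl
      apply ha
      ext
      simp only [i₁] at hab
      omega
    · intro a b hab ha
      rw [Matrix.vecMulVec_apply, Pi.single_eq_of_ne (i := l), mul_zero]
      rintro rfl
      apply ha
      ext
      simp only [l] at hab
      omega
  have h3 := eq_of_forall_addChar hψ key
  rw [inv_mul_eq_iff_eq_mul₀ ht] at h3
  rw [h3]
  simp

/-- Equivariance forces the next row to vanish to the left of column `p` and to have the same entry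
`t` there, so this entry can serve as a pivot and the scalar block extends diagonally. -/
lemma IsBiWhittaker.exists_isPartialBlock_succ (hψ : ψ ≠ 1) (hf : IsBiWhittaker ψ f) {m r j₀ : ℕ}
    {t : k} (ht : t ≠ 0) {g : GL (Fin n) k} (hfg : f g ≠ 0) (hg : IsPartialBlock m r j₀ t g.val)
    (hr : 1 ≤ r) (hm : m + r ≤ j₀) (hj : j₀ < n) :
    ∃ u ∈ unitri k n 0, ∃ u' ∈ unitri k n 0, IsPartialBlock m (r + 1) j₀ t (u * g * u').val := by
  let i₀ : Fin n := ⟨n - m - 1 - r, by omega⟩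
  let p : Fin n := ⟨j₀ - r, by omega⟩
  have hi₀ : i₀.val + m + 1 + r = n := by simp only [i₀]; omega
  have hp₀ : p.val + r = j₀ := by simp only [p]; omega
  have hent := fun c => hf.entry_eq hψ ht hfg hg hr hm hj i₀ p c hi₀ hp₀
  have hpt : g.val i₀ p = t := by rw [hent p le_rfl, if_pos rfl]
  have hlow : ∀ a, i₀ < a → g.val a p = 0 := by
    intro a ha
    rw [Fin.lt_def] at ha
    by_cases h : n ≤ a.val + m
    · exact hg.block.lower a p h (by omega)
    · rw [hg.row (n - 1 - m - a.val) (by omega) a p (by omega), if_neg (by omega)]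
  obtain ⟨u, hu, u', hu', h⟩ := exists_clear g i₀ p (by rwa [hpt])
    (fun c hc => by rw [hent c hc.le, if_neg hc.ne]) hlow
  refine ⟨u, hu, u', hu', hg.block.clear (by omega) (by omega) h, ?_, ?_⟩
  · intro s hs a c hac
    rw [h]
    by_cases hsr : s = r
    · rw [if_pos (by ext; omega), hpt]
      congr 1
      rw [eq_iff_iff, Fin.ext_iff]
      omega
    · rw [if_neg (by rintro rfl; omega)]
      by_cases hc : c = p
      · rw [if_pos hc, if_neg (by rw [hc]; omega)]
      · rw [if_neg hc, hlow a (by rw [Fin.lt_def]; omega), hg.row s (by omega) a c hac]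
        simp
  · intro s hs a c hac
    rw [h]
    by_cases hsr : s = r
    · have hc : c = p := by ext; omega
      rw [if_pos hc, if_pos hc, hpt]
      congr 1
      rw [eq_iff_iff, Fin.ext_iff]
      omega
    · have hc : c ≠ p := by rintro rfl; omega
      rw [if_neg hc, if_neg hc]
      by_cases ha : a = i₀
      · rw [if_pos ha, if_neg (by rw [ha]; omega)]
      · rw [if_neg ha, hg.col s (by omega) i₀ c hac, if_neg (c := i₀.val + m + 1 + s = n) (by omega),
          mul_zero, sub_zero, hg.col s (by omega) a c hac]

lemma IsBiWhittaker.mul_mul_ne_zero (hf : IsBiWhittaker ψ f) {u u' g : GL (Fin n) k}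
    (hu : u ∈ unitri k n 0) (hu' : u' ∈ unitri k n 0) (h : f g ≠ 0) : f (u * g * u') ≠ 0 := by
  rw [hf.right u' hu', hf.left u hu]
  exact smul_ne_zero (superdiagChar_ne_zero ψ 0 u') (smul_ne_zero (superdiagChar_ne_zero ψ 0 u) h)

/-- The scalar block is extended up and to the left until it reaches column `m`, that is, to size
`j₀ + 1 - m`. -/
lemma IsBiWhittaker.exists_larger (hψ : ψ ≠ 1) (hf : IsBiWhittaker ψ f) {m : ℕ} (hm : m < n)
    {g : GL (Fin n) k} (hfg : f g ≠ 0) (hg : IsAntiBlock m g.val) :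
    ∃ m', m < m' ∧ m' ≤ n ∧ ∃ u ∈ unitri k n 0, ∃ u' ∈ unitri k n 0,
      IsAntiBlock m' (u * g * u').val := by
  obtain ⟨j₀, hmj, hj, t, ht, u₁, hu₁, u₁', hu₁', h₁⟩ := exists_isPartialBlock_one hm hg
  have key : ∀ r, 1 ≤ r → m + r ≤ j₀ + 1 → ∃ u ∈ unitri k n 0, ∃ u' ∈ unitri k n 0,
      IsPartialBlock m r j₀ t (u * g * u').val := by
    intro r hr
    induction r, hr using Nat.le_induction with
    | base => exact fun _ => ⟨u₁, hu₁, u₁', hu₁', h₁⟩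
    | succ r hr ih =>
      intro hmr
      obtain ⟨u, hu, u', hu', h⟩ := ih (by omega)
      obtain ⟨v, hv, v', hv', h'⟩ := hf.exists_isPartialBlock_succ hψ ht
        (hf.mul_mul_ne_zero hu hu' hfg) h hr (by omega) hj
      exact ⟨v * u, mul_mem hv hu, u' * v', mul_mem hu' hv', by simpa only [mul_assoc] using h'⟩
  obtain ⟨u, hu, u', hu', h⟩ := key (j₀ + 1 - m) (by omega) (by omega)
  exact ⟨m + (j₀ + 1 - m), by omega, by omega, u, hu, u', hu', h.isAntiBlock (by omega)⟩

/-- Induction on the size `j = n - m` of the part not yet normalized; when it is `0` the matrix is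
its own reflection. -/
lemma IsBiWhittaker.eq_of_isAntiBlock (hψ : ψ ≠ 1) (hf : IsBiWhittaker ψ f) (j : ℕ) :
    ∀ m, m + j = n → ∀ g : GL (Fin n) k, f g ≠ 0 → IsAntiBlock m g.val →
      f (antiTransposeGL g) = f g := by
  induction j using Nat.strong_induction_on with
  | _ j ih =>
    intro m hm g hfg hg
    rcases Nat.eq_zero_or_pos j with rfl | hj
    · congr 1
      ext a c
      exact (hg.symm a c (by omega) (by omega)).symm
    · obtain ⟨m', h1, h2, u, hu, u', hu', h⟩ := hf.exists_larger hψ (by omega) hfg hg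
      have h3 := ih (n - m') (by omega) m' (by omega) _ (hf.mul_mul_ne_zero hu hu' hfg) h
      rw [antiTransposeGL_mul, antiTransposeGL_mul, hf.left _ (antiTransposeGL_mem hu'),
        hf.right _ (antiTransposeGL_mem hu), hf.right u' hu', hf.left u hu] at h3
      -- Reflection interchanges the left and right unipotent factors but preserves their
      -- characters, so both scalars cancel.
      have h4 : ∀ v : GL (Fin n) k, superdiagChar ψ 0 (antiTransposeGL v) = superdiagChar ψ 0 v :=
        fun v => congrArg ψ (superdiag_antiTranspose _)
      rw [h4, h4] at h3
      exact smul_right_injective _ (superdiagChar_ne_zero ψ 0 u)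
        (smul_right_injective _ (superdiagChar_ne_zero ψ 0 u') h3)

/-- A function on `GL_n(k)` transforming on both sides under a generic character of the upper
unitriangular matrices is invariant under reflection in the antidiagonal. -/
theorem IsBiWhittaker.apply_antiTransposeGL (hψ : ψ ≠ 1) (hf : IsBiWhittaker ψ f)
    (g : GL (Fin n) k) : f (antiTransposeGL g) = f g := by
  have key : ∀ g, f g ≠ 0 → f (antiTransposeGL g) = f g := fun g hg =>
    hf.eq_of_isAntiBlock hψ n 0 (zero_add n) g hg
      ⟨fun a c h _ => absurd h (by omega), fun a c _ h => absurd h (Nat.not_lt_zero _),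
        fun a c _ h => absurd h (Nat.not_lt_zero _)⟩
  by_cases h : f g = 0
  · by_contra h'
    rw [h] at h'
    have := key _ h'
    rw [antiTransposeGL_antiTransposeGL, h] at this
    exact h' this.symm
  · exact key g h

end GelfandGraev

/-! ### Uniqueness of Whittaker vectors -/

section Whittaker

variable {k : Type*} [Field k] [Finite k] {n : ℕ} {R V : Type*} [Field R] [IsAlgClosed R]
  [CharP R 2] [AddCommGroup V] [Module R V] {ψ : AddChar k R}

/-- The Whittaker vectors of a representation of `GL_n(k)`. -/
abbrev whittaker (ρ : Representation R (GL (Fin n) k) V) (ψ : AddChar k R) : Submodule R V :=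
  eigenvectors ρ (unitri k n 0) (superdiagChar ψ 0)

/-- The projector onto the Whittaker vectors. -/
noncomputable abbrev whittakerProjector (ρ : Representation R (GL (Fin n) k) V)
    (ψ : AddChar k R) : V →ₗ[R] V :=
  eigenProjector ρ (unitri k n 0) (superdiagChar ψ 0)

variable (ρ : Representation R (GL (Fin n) k) V)

omit [IsAlgClosed R] [CharP R 2] in
lemma whittakerProjector_mem (v : V) : whittakerProjector ρ ψ v ∈ whittaker ρ ψ :=
  eigenProjector_mem (isCharOn_superdiagChar ψ 0 0) v

omit [IsAlgClosed R] in
lemma whittakerProjector_of_mem (hk : ringChar k ≠ 2) {v : V} (hv : v ∈ whittaker ρ ψ) :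
    whittakerProjector ρ ψ v = v :=
  eigenProjector_apply_of_mem (isCharOn_superdiagChar ψ 0 0) (odd_card_unitri hk 0) hv

omit [IsAlgClosed R] [CharP R 2] in
lemma superdiagChar_inv {u : GL (Fin n) k} (hu : u ∈ unitri k n 0) :
    superdiagChar ψ 0 (u⁻¹) * superdiagChar ψ 0 u = 1 := by
  have h := isCharOn_superdiagChar (m := n) ψ 0 0
  rw [← h.map_mul _ (inv_mem hu) _ hu, inv_mul_cancel, h.map_one]

/-- The Hecke operators on the Whittaker vectors. -/
noncomputable def whittakerHecke (ψ : AddChar k R) (g : GL (Fin n) k) : V →ₗ[R] V :=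
  whittakerProjector ρ ψ ∘ₗ ρ g ∘ₗ whittakerProjector ρ ψ

omit [IsAlgClosed R] [CharP R 2] in
-- This is the reason for allowing module-valued functions in `IsBiWhittaker`: the Hecke operators
-- form an operator-valued one.
lemma isBiWhittaker_whittakerHecke :
    IsBiWhittaker ψ (whittakerHecke ρ ψ) := by
  refine ⟨fun u hu g => ?_, fun u hu g => ?_⟩
  · ext v
    simp only [whittakerHecke, LinearMap.comp_apply, LinearMap.smul_apply, _root_.map_mul,
      Module.End.mul_apply]
    rw [whittakerProjector, eigenProjector_apply_group (isCharOn_superdiagChar ψ 0 0) hu]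
  · ext v
    simp only [whittakerHecke, LinearMap.comp_apply, LinearMap.smul_apply, _root_.map_mul,
      Module.End.mul_apply]
    rw [whittakerProjector_mem ρ v u hu, map_smul, map_smul]

omit [IsAlgClosed R] in
lemma whittakerHecke_comp (hk : ringChar k ≠ 2) (g h : GL (Fin n) k) :
    letI := Fintype.ofFinite (unitri k n 0)
    whittakerHecke ρ ψ g ∘ₗ whittakerHecke ρ ψ h
      = ∑ u : unitri k n 0, superdiagChar ψ 0 ((u : GL (Fin n) k)⁻¹) •
          whittakerHecke ρ ψ (g * u * h) := by
  ext v
  simp only [whittakerHecke, LinearMap.comp_apply, LinearMap.sum_apply, LinearMap.smul_apply]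
  rw [whittakerProjector_of_mem ρ hk (whittakerProjector_mem ρ _)]
  have hP : ∀ w, whittakerProjector ρ ψ w = (letI := Fintype.ofFinite (unitri k n 0)
      ∑ u : unitri k n 0, superdiagChar ψ 0 ((u : GL (Fin n) k)⁻¹) • ρ u) w := fun _ => rfl
  rw [hP (ρ h _)]
  simp only [LinearMap.sum_apply, LinearMap.smul_apply, map_sum, map_smul, _root_.map_mul,
    Module.End.mul_apply]

omit [IsAlgClosed R] in
-- Gelfand's trick: expand the product over the double products `g * u * h`, reflect each of them,
-- which reverses the order of the factors, and recombine.
lemma whittakerHecke_comm (hk : ringChar k ≠ 2) (hψ : ψ ≠ 1) (g h : GL (Fin n) k) :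
    whittakerHecke ρ ψ g ∘ₗ whittakerHecke ρ ψ h
      = whittakerHecke ρ ψ h ∘ₗ whittakerHecke ρ ψ g := by
  have key := (isBiWhittaker_whittakerHecke ρ (ψ := ψ)).apply_antiTransposeGL hψ
  let _ := Fintype.ofFinite (unitri k n 0)
  have hinv : ∀ u : GL (Fin n) k, antiTransposeGL u⁻¹ = (antiTransposeGL u)⁻¹ := fun u => rfl
  calc whittakerHecke ρ ψ g ∘ₗ whittakerHecke ρ ψ h
      = ∑ u : unitri k n 0, superdiagChar ψ 0 ((u : GL (Fin n) k)⁻¹) •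
          whittakerHecke ρ ψ (g * u * h) := whittakerHecke_comp ρ hk g h
    _ = ∑ u : unitri k n 0, superdiagChar ψ 0 ((u : GL (Fin n) k)⁻¹) •
          whittakerHecke ρ ψ (antiTransposeGL h * u * antiTransposeGL g) := by
        refine Fintype.sum_equiv ⟨fun u => ⟨antiTransposeGL u, antiTransposeGL_mem u.2⟩,
          fun u => ⟨antiTransposeGL u, antiTransposeGL_mem u.2⟩,
          fun u => Subtype.ext (antiTransposeGL_antiTransposeGL _),
          fun u => Subtype.ext (antiTransposeGL_antiTransposeGL _)⟩ _ _ fun u => ?_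
        rw [← key (g * u * h), antiTransposeGL_mul, antiTransposeGL_mul, mul_assoc]
        simp only [Equiv.coe_fn_mk]
        rw [← hinv]
        congr 1
        exact (congrArg ψ (superdiag_antiTranspose _)).symm
    _ = whittakerHecke ρ ψ (antiTransposeGL h) ∘ₗ whittakerHecke ρ ψ (antiTransposeGL g) :=
        (whittakerHecke_comp ρ hk _ _).symm
    _ = whittakerHecke ρ ψ h ∘ₗ whittakerHecke ρ ψ g := by rw [key, key]

/-- **Uniqueness of Whittaker models**: the Whittaker vectors of an irreducible representation
form a space of dimension at most one. -/
theorem exists_whittaker_le_span (hk : ringChar k ≠ 2) (hψ : ψ ≠ 1) (hρ : ρ.IsIrreducible) :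
    ∃ ω ∈ whittaker ρ ψ, ∀ v ∈ whittaker ρ ψ, ∃ c : R, v = c • ω := by
  have := finiteDimensional_of_irreducible hρ
  by_cases h0 : whittaker ρ ψ = ⊥
  · refine ⟨0, Submodule.zero_mem _, fun v hv => ⟨0, ?_⟩⟩
    rw [h0, Submodule.mem_bot] at hv
    rw [hv, smul_zero]
  have : Nontrivial (whittaker ρ ψ) := Submodule.nontrivial_iff_ne_bot.2 h0
  have hmaps : ∀ g, ∀ v ∈ whittaker ρ ψ, whittakerHecke ρ ψ g v ∈ whittaker ρ ψ :=
    fun g v _ => whittakerProjector_mem ρ _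
  -- A non-zero Whittaker vector generates the whole Whittaker space under the Hecke operators: its
  -- orbit spans `V`, and this span is projected.
  have hgen : ∀ v ∈ whittaker ρ ψ, v ≠ 0 → ∀ w ∈ whittaker ρ ψ,
      w ∈ Submodule.span R (Set.range fun g => whittakerHecke ρ ψ g v) := by
    intro v hv hv0 w hw
    have h1 : Submodule.span R (Set.range fun g => ρ g v) = ⊤ := by
      refine subrep_eq_top hρ _ (fun g w hw => ?_) (v := v) (Submodule.subset_span ⟨1, by simp⟩) hv0
      induction hw using Submodule.span_induction with
      | mem x hx =>
        obtain ⟨h, rfl⟩ := hx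
        exact Submodule.subset_span ⟨g * h, by simp⟩
      | zero => simp
      | add x y _ _ hx hy => rw [map_add]; exact Submodule.add_mem _ hx hy
      | smul c x _ hx => rw [map_smul]; exact Submodule.smul_mem _ _ hx
    have h2 : w ∈ Submodule.span R (Set.range fun g => ρ g v) := h1 ▸ Submodule.mem_top
    have h3 := Submodule.mem_map_of_mem (f := whittakerProjector ρ ψ) h2
    rw [whittakerProjector_of_mem ρ hk hw, Submodule.map_span, ← Set.range_comp] at h3
    convert h3 using 4 with g
    simp only [whittakerHecke, LinearMap.comp_apply, Function.comp_apply]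
    rw [whittakerProjector_of_mem ρ hk hv]
  -- An eigenvector exists over the algebraically closed `R` and generates; since the operators
  -- commute, each acts as a scalar.
  have hscalar : ∀ g, ∃ c : R, ∀ v ∈ whittaker ρ ψ, whittakerHecke ρ ψ g v = c • v := by
    intro g
    obtain ⟨c, hc⟩ := Module.End.exists_eigenvalue ((whittakerHecke ρ ψ g).restrict (hmaps g))
    obtain ⟨⟨v, hv⟩, hvc⟩ := hc.exists_hasEigenvector
    have hv0 : v ≠ 0 := fun h => hvc.2 (Subtype.ext h)
    have hvc' : whittakerHecke ρ ψ g v = c • v := congrArg Subtype.val hvc.apply_eq_smul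
    refine ⟨c, fun w hw => ?_⟩
    have h4 := hgen v hv hv0 w hw
    clear hw
    induction h4 using Submodule.span_induction with
    | mem x hx =>
      obtain ⟨h, rfl⟩ := hx
      have := LinearMap.congr_fun (whittakerHecke_comm ρ hk hψ g h) v
      simp only [LinearMap.comp_apply] at this
      rw [this, hvc', map_smul]
    | zero => simp
    | add x y _ _ hx hy => rw [map_add, hx, hy, smul_add]
    | smul d x _ hx => rw [map_smul, hx, smul_comm]
  obtain ⟨⟨ω, hω⟩, hω0⟩ := exists_ne (0 : whittaker ρ ψ)
  have hω0' : ω ≠ 0 := fun h => hω0 (Subtype.ext h)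
  refine ⟨ω, hω, fun w hw => ?_⟩
  have h5 := hgen ω hω hω0' w hw
  have h6 : Submodule.span R (Set.range fun g => whittakerHecke ρ ψ g ω)
      ≤ Submodule.span R {ω} := by
    rw [Submodule.span_le]
    rintro _ ⟨g, rfl⟩
    obtain ⟨c, hc⟩ := hscalar g
    exact Submodule.mem_span_singleton.2 ⟨c, (hc ω hω).symm⟩
  obtain ⟨c, hc⟩ := Submodule.mem_span_singleton.1 (h6 h5)
  exact ⟨c, hc.symm⟩

end Whittaker

/-! ### Column-by-column reduction of invariant forms to derivatives -/

section Mirabolic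

variable {k : Type*} [Field k] {m : ℕ}

/-- The matrices which vanish outside the part of column `j` above the diagonal. -/
def columnAbove (k : Type*) [Field k] (m : ℕ) (j : Fin m) :
    NonUnitalSubalgebra k (Matrix (Fin m) (Fin m) k) where
  carrier := {x | ∀ a b : Fin m, (b ≠ j ∨ j ≤ a) → x a b = 0}
  add_mem' := fun {x y} hx hy i j h => by rw [Matrix.add_apply, hx i j h, hy i j h, add_zero]
  zero_mem' := fun i j _ => rfl
  smul_mem' := fun c x hx i j h => by rw [Matrix.smul_apply, hx i j h, smul_zero]
  mul_mem' := fun {x y} hx hy a b h => by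
    rw [Matrix.mul_apply]
    refine Finset.sum_eq_zero fun l _ => ?_
    by_cases hl : l = j
    · rw [hy l b (Or.inr hl.ge), mul_zero]
    · rw [hx a l (Or.inl hl), zero_mul]

lemma columnAbove_le {j : Fin m} {x : Matrix (Fin m) (Fin m) k} (hx : x ∈ columnAbove k m j) :
    x ∈ upperFrom k m j := by
  intro a b hab
  apply hx a b
  by_contra! h
  obtain ⟨rfl, h⟩ := h
  rcases hab with h' | h'
  · exact absurd h (not_lt.2 h')
  · exact lt_irrefl _ h'

lemma mul_apply_of_columnAbove {j : Fin m} {x y : Matrix (Fin m) (Fin m) k}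
    (hx : x ∈ columnAbove k m j) (hy : y ∈ columnAbove k m j) : x * y = 0 := by
  ext a b
  rw [Matrix.mul_apply]
  refine Finset.sum_eq_zero fun l _ => ?_
  by_cases hl : l = j
  · rw [hy l b (Or.inr hl.ge), mul_zero]
  · rw [hx a l (Or.inl hl), zero_mul]

variable {R : Type*} [Field R]

/-- The function on `GL_m(k)` which sends `g` to the value of `ψ` at `r ⬝ᵥ c`, where `c` is the
`j`-th column of `g - 1`. -/
def columnChar (ψ : AddChar k R) (j : Fin m) (r : Fin m → k) (g : GL (Fin m) k) : R :=
  ψ (r ⬝ᵥ (g.val - 1).col j)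

variable [Finite k]

/-- The subgroup of upper unitriangular matrices which differ from the identity only in
column `j`. -/
abbrev columnUnipotent (k : Type*) [Field k] [Finite k] (m : ℕ) (j : Fin m) :
    Subgroup (GL (Fin m) k) :=
  unipotent (columnAbove k m j)

lemma columnUnipotent_le {j : Fin m} : columnUnipotent k m j ≤ unitri k m j :=
  fun _ hx => columnAbove_le hx

lemma isCharOn_columnChar (ψ : AddChar k R) (j : Fin m) (r : Fin m → k) :
    IsCharOn (columnUnipotent k m j) (columnChar ψ j r) := by
  refine ⟨?_, fun u hu v hv => ?_⟩
  · have : ((1 : GL (Fin m) k).val - 1).col j = 0 := by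
      rw [Units.val_one, sub_self]; rfl
    rw [columnChar, this, dotProduct_zero, AddChar.map_zero_eq_one]
  · have h : (u * v).val - 1 = (u.val - 1) + (v.val - 1) + (u.val - 1) * (v.val - 1) := by
      rw [Units.val_mul]; noncomm_ring
    have h2 : ((u * v).val - 1).col j = (u.val - 1).col j + (v.val - 1).col j := by
      rw [h, mul_apply_of_columnAbove hu hv, add_zero]; rfl
    rw [columnChar, h2, dotProduct_add, AddChar.map_add_eq_mul]; rfl

lemma exists_columnUnipotent (j : Fin m) (c : Fin m → k) (hc : ∀ a, j ≤ a → c a = 0) :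
    ∃ u ∈ columnUnipotent k m j, u.val = 1 + Matrix.vecMulVec c (Pi.single j 1) := by
  obtain ⟨u, hu⟩ := exists_transvection c (Pi.single j 1) (by
    rw [single_dotProduct, hc j le_rfl, mul_zero])
  refine ⟨u, fun a b hab => ?_, hu⟩
  rw [hu, add_sub_cancel_left, Matrix.vecMulVec_apply]
  rcases hab with h | h
  · rw [Pi.single_eq_of_ne h, mul_zero]
  · rw [hc a h, zero_mul]

omit [Finite k] in
lemma col_vecMulVec_single (j : Fin m) (c : Fin m → k) :
    (Matrix.vecMulVec c (Pi.single j 1)).col j = c := by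
  ext a
  rw [Matrix.col_apply, Matrix.vecMulVec_apply, Pi.single_eq_same, mul_one]

/-- Every element of `unitri k m j` is the product of an element of the `j`-th column subgroup and
an element of `unitri k m (j + 1)`. -/
lemma exists_column_factorization (j : Fin m) {u : GL (Fin m) k} (hu : u ∈ unitri k m j) :
    ∃ x ∈ columnUnipotent k m j, ∃ u' ∈ unitri k m (j + 1), u = x * u' := by
  classical
  obtain ⟨y, hy, hyv⟩ := exists_columnUnipotent j (fun a => -(u.val - 1) a j)
    (fun a ha => by rw [hu a j (Or.inl ha), neg_zero])
  refine ⟨y⁻¹, inv_mem hy, y * u, fun a b hab => ?_, by rw [inv_mul_cancel_left]⟩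
  have h0 := mul_mem (columnUnipotent_le hy) hu
  by_cases hb : b = j
  · subst hb
    rw [Units.val_mul, hyv, add_mul, one_mul, Matrix.vecMulVec_mul, Matrix.single_one_vecMul,
      Matrix.sub_apply, Matrix.add_apply, Matrix.vecMulVec_apply, Matrix.row_apply,
      unitri_apply hu b b (Or.inl le_rfl), Matrix.one_apply_eq, mul_one, Matrix.sub_apply]
    ring
  · apply h0 a b
    rcases hab with h | h
    · exact Or.inl h
    · right
      have : b.val ≠ j.val := fun h => hb (Fin.ext h)
      omega

variable {V : Type*} [AddCommGroup V] [Module R V] {ρ : Representation R (GL (Fin m) k) V}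

lemma superdiagChar_conj (ψ : AddChar k R) {x u : GL (Fin m) k} (hx : x ∈ unitri k m 0)
    (hu : u ∈ unitri k m 0) : superdiagChar ψ 0 (x⁻¹ * u * x) = superdiagChar ψ 0 u := by
  have h := isCharOn_superdiagChar (m := m) ψ 0 0
  rw [h.map_mul _ (mul_mem (inv_mem hx) hu) _ hx, h.map_mul _ (inv_mem hx) _ hu, mul_right_comm,
    superdiagChar_inv hx, one_mul]

/-- The group of the `j`-th column stabilizes the vectors which transform under
`unitri k m (j + 1)` according to the generic character. -/
lemma columnUnipotent_stable (ψ : AddChar k R) (j : Fin m) {x : GL (Fin m) k}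
    (hx : x ∈ columnUnipotent k m j) {v : V}
    (hv : v ∈ eigenvectors ρ (unitri k m (j + 1)) (superdiagChar ψ 0)) :
    ρ x v ∈ eigenvectors ρ (unitri k m (j + 1)) (superdiagChar ψ 0) := by
  intro u hu
  have hx0 : x ∈ unitri k m 0 := unitri_le (Nat.zero_le _) (columnUnipotent_le hx)
  have hu0 : u ∈ unitri k m 0 := unitri_le (Nat.zero_le _) hu
  have hmem : x⁻¹ * u * x ∈ unitri k m (j + 1) := by
    intro a b hab
    by_cases hba : b ≤ a
    · exact mul_mem (mul_mem (inv_mem hx0) hu0) hx0 a b (Or.inl hba)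
    · have hbj := hab.resolve_left hba
      have h1 : (x⁻¹ * u * x).val - 1 = (x⁻¹).val * ((u.val - 1) * x.val) := by
        rw [sub_mul, mul_sub, one_mul, Units.inv_mul, Units.val_mul, Units.val_mul, mul_assoc]
      rw [h1, Matrix.mul_apply]
      refine Finset.sum_eq_zero fun c _ => ?_
      rw [Matrix.mul_apply, Finset.sum_eq_zero, mul_zero]
      intro l _
      by_cases hl : l.val < j + 1
      · rw [hu c l (Or.inr hl), zero_mul]
      · rw [unitri_apply hx0 l b (Or.inl (Fin.le_def.2 (by omega))), Matrix.one_apply_ne, mul_zero]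
        rintro rfl
        exact hl hbj
  have h2 := hv _ hmem
  rw [superdiagChar_conj ψ hx0 hu0] at h2
  rw [← map_smul, ← h2, ← Module.End.mul_apply, ← Module.End.mul_apply, ← _root_.map_mul,
    ← _root_.map_mul]
  congr 2
  group

/-- Decomposition of a vector under the characters of the group of the `j`-th column. -/
lemma sum_columnProjector [CharP R 2] (hk : ringChar k ≠ 2) {ψ : AddChar k R} (hψ : ψ ≠ 1)
    (j : Fin m) [Fintype k] (v : V) :
    ∑ r : Fin m → k, eigenProjector ρ (columnUnipotent k m j) (columnChar ψ j r) v = v := by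
  classical
  let _ := Fintype.ofFinite (columnUnipotent k m j)
  -- Orthogonality of characters. The row `r` runs over all of `k^m` although only its entries
  -- before `j` matter; the total number of rows is odd, hence `1` in `R`.
  have hs : ∀ u : columnUnipotent k m j,
      ∑ r : Fin m → k, columnChar ψ j r (u : GL (Fin m) k)⁻¹ = if u = 1 then 1 else 0 := by
    intro u
    split_ifs with hu
    · subst hu
      have h1 : ∀ r, columnChar ψ j r ((1 : columnUnipotent k m j) : GL (Fin m) k)⁻¹ = 1 := by
        intro r
        rw [OneMemClass.coe_one, inv_one, (isCharOn_columnChar ψ j r).map_one]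
      simp only [h1, Finset.sum_const, nsmul_eq_mul, mul_one]
      obtain ⟨p, hp⟩ := odd_card_module hk (Fin m → k)
      rw [Finset.card_univ, ← Nat.card_eq_fintype_card, hp]
      push_cast
      rw [CharTwo.two_eq_zero, zero_mul, zero_add]
    · let c := ((u : GL (Fin m) k)⁻¹.val - 1).col j
      let Ψ : AddChar (Fin m → k) R := ψ.compAddMonoidHom
        { toFun := fun r => r ⬝ᵥ c
          map_zero' := zero_dotProduct c
          map_add' := fun r s => add_dotProduct r s c }
      have hΨ : Ψ ≠ 1 := by
        have hc : ∃ a, c a ≠ 0 := by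
          by_contra! hc
          apply hu
          rw [← inv_eq_one]
          ext a b
          rw [InvMemClass.coe_inv, OneMemClass.coe_one, Units.val_one, ← sub_eq_zero,
            ← Matrix.sub_apply]
          by_cases hb : b = j
          · rw [hb]; exact hc a
          · exact inv_mem u.2 a b (Or.inl hb)
        obtain ⟨a, ha⟩ := hc
        intro h
        apply hψ
        ext s
        have := DFunLike.congr_fun h (Pi.single a (s / c a))
        simp only [Ψ, AddChar.compAddMonoidHom_apply, AddMonoidHom.coe_mk, ZeroHom.coe_mk,
          single_dotProduct, div_mul_cancel₀ _ ha] at this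
        exact this
      exact AddChar.sum_eq_zero_of_ne_one hΨ
  have h : ∀ χ : GL (Fin m) k → R, eigenProjector ρ (columnUnipotent k m j) χ v
      = ∑ u : columnUnipotent k m j, χ ((u : GL (Fin m) k)⁻¹) • ρ u v := fun χ => by
    simp only [eigenProjector, LinearMap.sum_apply, LinearMap.smul_apply]
  simp only [h]
  rw [Finset.sum_comm]
  simp only [← Finset.sum_smul, hs, ite_smul, one_smul, zero_smul, Finset.sum_ite_eq',
    Finset.mem_univ, if_true]
  rw [OneMemClass.coe_one, map_one, Module.End.one_apply]

/-- The condition on a subgroup `H` of `GL_m(k)` under which linear forms invariant under `H` are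
determined by their restrictions to the derivatives. -/
def IsMirabolicPair (H : Subgroup (GL (Fin m) k)) (ψ : AddChar k R) : Prop :=
  ∀ (j : Fin m) (r : Fin m → k),
    (∃ c : Fin m → k, (∀ a, j ≤ a → c a = 0) ∧ ψ (r ⬝ᵥ c) ≠ 1 ∧
      ∃ u ∈ H, u.val = 1 + Matrix.vecMulVec c (Pi.single j 1)) ∨
    (∀ a < j, r a = 0) ∨
    ∃ i : Fin m, i.val + 1 = j.val ∧ ∃ h ∈ H, (∀ a b, j ≤ a → h.val a b = (1 : Matrix _ _ k) a b) ∧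
      (∀ a b, j ≤ b → h.val a b = (1 : Matrix _ _ k) a b) ∧ ∀ a < j, h.val i a = r a

/-- If the column group acts trivially, only later columns contribute to the character. Their
superdiagonal places have row index at least `j`, exactly those kept by `superdiagChar ψ j`. -/
lemma mem_derivative_of_forall_eq_zero {ψ : AddChar k R} {j : Fin m} {r : Fin m → k}
    (hr : ∀ a < j, r a = 0) {v : V}
    (hv : v ∈ eigenvectors ρ (unitri k m (j + 1)) (superdiagChar ψ 0))
    (hvr : v ∈ eigenvectors ρ (columnUnipotent k m j) (columnChar ψ j r)) :
    v ∈ eigenvectors ρ (unitri k m j) (superdiagChar ψ j) := by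
  intro u hu
  obtain ⟨x, hx, u', hu', rfl⟩ := exists_column_factorization j hu
  have hxj := columnUnipotent_le hx
  have hu'j := unitri_le (Nat.le_succ _) hu'
  have h1 : superdiagChar ψ j x = 1 := by
    rw [superdiagChar, superdiag_eq_zero, AddChar.map_zero_eq_one]
    intro a b hab ha
    have hb : b ≠ j := by rintro rfl; omega
    have := hx a b (Or.inl hb)
    rw [Matrix.sub_apply, sub_eq_zero] at this
    rw [this, Matrix.one_apply_ne]
    rintro rfl; omega
  have h2 : superdiagChar ψ j u' = superdiagChar ψ 0 u' := by
    have h3 : u'.val = 1 + (u'.val - 1) := (add_sub_cancel _ _).symm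
    rw [superdiagChar, superdiagChar, h3, superdiag_one_add, superdiag_one_add]
    congr 1
    refine Finset.sum_congr rfl fun a _ => Finset.sum_congr rfl fun b _ => ?_
    by_cases hab : a.val + 1 = b.val
    · by_cases ha : j.val ≤ a.val
      · rw [if_pos ⟨hab, ha⟩, if_pos ⟨hab, Nat.zero_le _⟩]
      · rw [if_neg (fun h => ha h.2), if_pos ⟨hab, Nat.zero_le _⟩, hu' a b (Or.inr (by omega))]
    · rw [if_neg (fun h => hab h.1), if_neg (fun h => hab h.1)]
  have h4 : columnChar ψ j r x = 1 := by
    rw [columnChar, dotProduct, Finset.sum_eq_zero, AddChar.map_zero_eq_one]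
    intro a _
    by_cases ha : a < j
    · rw [hr a ha, zero_mul]
    · rw [Matrix.col_apply, hx a j (Or.inr (not_lt.1 ha)), mul_zero]
  rw [(isCharOn_superdiagChar ψ j j).map_mul _ hxj _ hu'j, h1, h2, one_mul, _root_.map_mul,
    Module.End.mul_apply, hv u' hu', map_smul, hvr x hx, h4, one_smul]

/-- The element `h` lies in the upper left `GL_j`. Conjugating by it replaces a column `x` by `h⁻¹
x`, and `r ⬝ᵥ (h⁻¹ x) = x i` because row `i` of `h` is `r`; so the character of the column becomes
the generic one, while the characters on later columns are unchanged. -/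
lemma apply_mem_of_row_eq {ψ : AddChar k R} {i j : Fin m} (hij : i.val + 1 = j.val)
    {r : Fin m → k} {h : GL (Fin m) k} (hrow : ∀ a b, j ≤ a → h.val a b = (1 : Matrix _ _ k) a b)
    (hcol : ∀ a b, j ≤ b → h.val a b = (1 : Matrix _ _ k) a b) (hr : ∀ a < j, h.val i a = r a)
    {v : V} (hv : v ∈ eigenvectors ρ (unitri k m (j + 1)) (superdiagChar ψ 0))
    (hvr : v ∈ eigenvectors ρ (columnUnipotent k m j) (columnChar ψ j r)) :
    ρ h v ∈ eigenvectors ρ (unitri k m j) (superdiagChar ψ 0) := by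
  have hleft : ∀ (z : Matrix (Fin m) (Fin m) k) a b, j ≤ a → ((h⁻¹).val * z) a b = z a b := by
    intro z a b ha
    have h1 : (h.val * ((h⁻¹).val * z)) a b = z a b := by
      rw [← mul_assoc, Units.mul_inv, one_mul]
    rw [Matrix.mul_apply, Finset.sum_eq_single a, hrow a a ha, Matrix.one_apply_eq, one_mul] at h1
    · exact h1
    · intro l _ hl
      rw [hrow a l ha, Matrix.one_apply_ne hl.symm, zero_mul]
    · simp
  have hright : ∀ (z : Matrix (Fin m) (Fin m) k) a b, j ≤ b → (z * h.val) a b = z a b := by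
    intro z a b hb
    rw [Matrix.mul_apply, Finset.sum_eq_single b, hcol b b hb, Matrix.one_apply_eq, mul_one]
    · intro l _ hl
      rw [hcol l b hb, Matrix.one_apply_ne hl, mul_zero]
    · simp
  intro u hu
  obtain ⟨x, hx, u', hu', rfl⟩ := exists_column_factorization j hu
  have hx0 := unitri_le (Nat.zero_le _) (columnUnipotent_le hx)
  have hu'0 := unitri_le (Nat.zero_le _) hu'
  have key : ∀ y : GL (Fin m) k, ρ y (ρ h v) = ρ h (ρ (h⁻¹ * y * h) v) := by
    intro y
    rw [← Module.End.mul_apply, ← Module.End.mul_apply, ← _root_.map_mul, ← _root_.map_mul]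
    congr 2
    group
  have hconj : ∀ y : GL (Fin m) k,
      (h⁻¹ * y * h).val - 1 = (h⁻¹).val * (y.val - 1) * h.val := by
    intro y
    rw [mul_sub, sub_mul, mul_one, Units.inv_mul, Units.val_mul, Units.val_mul]
  have hyh : (x.val - 1) * h.val = x.val - 1 := by
    ext a b
    rw [Matrix.mul_apply, Finset.sum_eq_single j, hrow j b le_rfl]
    · by_cases hb : b = j
      · rw [hb, Matrix.one_apply_eq, mul_one]
      · rw [Matrix.one_apply_ne (Ne.symm hb), mul_zero, hx a b (Or.inl hb)]
    · intro l _ hl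
      rw [hx a l (Or.inl hl), zero_mul]
    · simp
  have hxmem : h⁻¹ * x * h ∈ columnUnipotent k m j := by
    intro a b hab
    rw [hconj, mul_assoc, hyh]
    by_cases ha : j ≤ a
    · rw [hleft _ a b ha, hx a b hab]
    · rw [Matrix.mul_apply]
      exact Finset.sum_eq_zero fun l _ => by rw [hx l b (Or.inl (hab.resolve_right ha)), mul_zero]
  have hxchar : columnChar ψ j r (h⁻¹ * x * h) = superdiagChar ψ 0 x := by
    have h1 : superdiag 0 x.val = (x.val - 1) i j := by
      have h2 : x.val = 1 + (x.val - 1) := (add_sub_cancel _ _).symm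
      rw [h2, superdiag_one_add, superdiag_eq_single 0 i j hij (Nat.zero_le _), ← h2]
      intro a b hab ha
      apply hx a b (Or.inl _)
      rintro rfl
      exact ha (Fin.ext (by omega))
    rw [columnChar, superdiagChar, h1]
    congr 1
    have h3 : (x.val - 1) i j = (h.val * ((h⁻¹ * x * h).val - 1)) i j := by
      rw [hconj, mul_assoc, hyh, ← mul_assoc, Units.mul_inv, one_mul]
    rw [h3, dotProduct, Matrix.mul_apply]
    refine Finset.sum_congr rfl fun a _ => ?_
    by_cases ha : a < j
    · rw [hr a ha, Matrix.col_apply]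
    · rw [Matrix.col_apply, hxmem a j (Or.inr (not_lt.1 ha)), mul_zero, mul_zero]
  have humem : h⁻¹ * u' * h ∈ unitri k m (j + 1) := by
    intro a b hab
    rw [hconj]
    by_cases hb : b.val < j + 1
    · rw [mul_assoc, Matrix.mul_apply]
      refine Finset.sum_eq_zero fun c _ => ?_
      rw [Matrix.mul_apply, Finset.sum_eq_zero, mul_zero]
      intro l _
      by_cases hl : l.val < j + 1
      · rw [hu' c l (Or.inr hl), zero_mul]
      · rw [hrow l b (Fin.le_def.2 (by omega)), Matrix.one_apply_ne, mul_zero]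
        rintro rfl
        exact hl hb
    · have hba := Fin.le_def.1 (hab.resolve_right hb)
      rw [hright _ a b (Fin.le_def.2 (by omega)), hleft _ a b (Fin.le_def.2 (by omega)), hu' a b hab]
  have huchar : superdiagChar ψ 0 (h⁻¹ * u' * h) = superdiagChar ψ 0 u' := by
    have h1 : ∀ z : GL (Fin m) k, z.val = 1 + (z.val - 1) := fun z => (add_sub_cancel _ _).symm
    rw [superdiagChar, superdiagChar, h1 (h⁻¹ * u' * h), h1 u', superdiag_one_add,
      superdiag_one_add]
    congr 1
    refine superdiag_congr 0 fun a b hab _ => ?_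
    by_cases hb : b.val < j + 1
    · rw [humem a b (Or.inr hb), hu' a b (Or.inr hb)]
    · rw [hconj, hright _ a b (Fin.le_def.2 (by omega)), hleft _ a b (Fin.le_def.2 (by omega))]
  rw [_root_.map_mul, Module.End.mul_apply, key u', hv _ humem, huchar, map_smul, map_smul, key x,
    hvr _ hxmem, hxchar, map_smul, (isCharOn_superdiagChar ψ 0 0).map_mul _ hx0 _ hu'0,
    mul_comm, mul_smul]

/-- A linear form invariant under `H` is determined by its restrictions to the derivatives. -/
theorem eq_zero_of_forall_derivative [CharP R 2] (hk : ringChar k ≠ 2) {ψ : AddChar k R}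
    (hψ : ψ ≠ 1) (hm : 0 < m) {H : Subgroup (GL (Fin m) k)} (hH : IsMirabolicPair H ψ)
    (l : V →ₗ[R] R) (hl : ∀ h ∈ H, ∀ v, l (ρ h v) = l v)
    (hd : ∀ d < m, ∀ v ∈ eigenvectors ρ (unitri k m d) (superdiagChar ψ d), l v = 0) : l = 0 := by
  have := Fintype.ofFinite k
  -- Induction on the number `d` of columns on which nothing is imposed: `d = 0` is the Whittaker
  -- case and `d = m` allows every vector.
  have key : ∀ d ≤ m, ∀ v ∈ eigenvectors ρ (unitri k m d) (superdiagChar ψ 0), l v = 0 := by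
    intro d
    induction d with
    | zero => exact fun _ => hd 0 hm
    | succ d ih =>
      intro hdm v hv
      let j : Fin m := ⟨d, hdm⟩
      rw [← sum_columnProjector (ρ := ρ) hk hψ j v, map_sum]
      refine Finset.sum_eq_zero fun r _ => ?_
      set w := eigenProjector ρ (columnUnipotent k m j) (columnChar ψ j r) v with hw
      have hwr : w ∈ eigenvectors ρ (columnUnipotent k m j) (columnChar ψ j r) :=
        eigenProjector_mem (isCharOn_columnChar ψ j r) v
      have hwd : w ∈ eigenvectors ρ (unitri k m (j + 1)) (superdiagChar ψ 0) := by
        rw [hw, eigenProjector, LinearMap.sum_apply]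
        exact Submodule.sum_mem _ fun u _ =>
          Submodule.smul_mem _ _ (columnUnipotent_stable ψ j u.2 hv)
      -- Either the character is non-trivial on `H`, so invariance kills the component; or it is
      -- trivial and the component lies in the derivative of level `d`; or `H` moves it to the
      -- generic character, which fixes one more column.
      rcases hH j r with ⟨c, hc, hψc, u, huH, huv⟩ | hr | ⟨i, hij, h, hhH, h1, h2, h3⟩
      · obtain ⟨u', hu', hu'v⟩ := exists_columnUnipotent j c hc
        obtain rfl : u = u' := Units.ext (huv.trans hu'v.symm)
        have h4 := hl u huH w
        rw [hwr u hu', columnChar, huv, add_sub_cancel_left, col_vecMulVec_single, map_smul,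
          smul_eq_mul] at h4
        by_contra h5
        exact hψc (mul_right_cancel₀ h5 (h4.trans (one_mul _).symm))
      · exact hd d hdm w (mem_derivative_of_forall_eq_zero (j := j) hr hwd hwr)
      · rw [← hl h hhH w]
        exact ih (Nat.le_of_succ_le hdm) _ (apply_mem_of_row_eq (j := j) hij h1 h2 h3 hwd hwr)
  ext v
  refine key m le_rfl v fun u hu => ?_
  have hu1 : u = 1 := by
    ext a b
    exact unitri_apply hu a b (Or.inr b.2)
  rw [hu1, map_one, Module.End.one_apply, (isCharOn_superdiagChar ψ 0 0).map_one, one_smul]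

end Mirabolic

/-! ### The symmetric subgroups satisfy the mirabolic condition -/

section Symmetric

variable {k : Type*} [Field k] {m : ℕ}

/-- An invertible matrix with prescribed `i`-th row `r`, the entry `r i₀` being non-zero. -/
lemma exists_row_eq (i i₀ : Fin m) (r : Fin m → k) (hr : r i₀ ≠ 0) :
    ∃ h : GL (Fin m) k, ∀ a b, h.val a b =
      Matrix.updateRow (1 : Matrix (Fin m) (Fin m) k) i₀ r (Equiv.swap i i₀ a) b := by
  have hdet : IsUnit ((Matrix.updateRow (1 : Matrix (Fin m) (Fin m) k) i₀ r).submatrix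
      (Equiv.swap i i₀) id).det := by
    -- The determinant is `r i₀` up to sign, by Cramer's rule for the identity matrix.
    rw [Matrix.det_permute, ← Matrix.cramer_transpose_apply, Matrix.transpose_one,
      Matrix.cramer_one]
    refine IsUnit.mul ?_ (isUnit_iff_ne_zero.2 hr)
    exact (Equiv.Perm.sign (Equiv.swap i i₀)).isUnit.map (Int.castRingHom k)
  exact ⟨Matrix.GeneralLinearGroup.mkOfDetNeZero _ hdet.ne_zero, fun a b => rfl⟩

lemma mem_symmetricSubgroup_levi {g : GL (Fin m) k}
    (h : ∀ a b : Fin m, g.val a b ≠ 0 → a.val % 2 = b.val % 2) :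
    g ∈ symmetricSubgroup (SymmetricCase.levi : SymmetricCase k) m := by
  rw [symmetricSubgroup, Subgroup.mem_centralizer_singleton_iff]
  ext a b
  have hv : (alternatingSigns k m).val = Matrix.diagonal fun i : Fin m => (-1 : k) ^ (i.val + 1) :=
    rfl
  rw [Units.val_mul, Units.val_mul, hv, Matrix.mul_diagonal, Matrix.diagonal_mul]
  by_cases hab : g.val a b = 0
  · rw [hab, zero_mul, mul_zero]
  · have h1 := h a b hab
    rw [mul_comm, neg_one_pow_eq_pow_mod_two (n := a.val + 1),
      neg_one_pow_eq_pow_mod_two (n := b.val + 1), Nat.add_mod, ← h1, ← Nat.add_mod]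

lemma mem_symmetricSubgroup_galois {k₀ : Subfield k} (hq : Module.finrank k₀ k = 2)
    (h : GL (Fin m) k₀) {g : GL (Fin m) k} (hg : ∀ a b, g.val a b = h.val a b) :
    g ∈ symmetricSubgroup (SymmetricCase.galois k₀ hq) m :=
  ⟨h, by ext a b; exact (hg a b).symm⟩

variable [Finite k] {R : Type*} [Field R]

/-- The quotient `k / S` is a non-trivial group of odd order, and an algebraically closed field of
characteristic two contains enough roots of unity of odd order to separate its points. -/
lemma exists_addChar [IsAlgClosed R] [CharP R 2] (hk : ringChar k ≠ 2) (S : AddSubgroup k)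
    (hS : S ≠ ⊤) : ∃ ψ : AddChar k R, ψ ≠ 1 ∧ ∀ s ∈ S, ψ s = 1 := by
  obtain ⟨x, hx⟩ : ∃ x, x ∉ S := by
    by_contra! h
    exact hS (eq_top_iff.2 fun x _ => h x)
  let G := Multiplicative (k ⧸ S)
  have hodd : Odd (Monoid.exponent G) := by
    refine Odd.of_dvd_nat (odd_card_field hk) ((Group.exponent_dvd_nat_card (G := G)).trans ?_)
    exact S.card_quotient_dvd_card
  have : NeZero ((Monoid.exponent G : ℕ) : R) := by
    obtain ⟨p, hp⟩ := hodd
    constructor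
    rw [hp]
    push_cast
    rw [CharTwo.two_eq_zero, zero_mul, zero_add]
    exact one_ne_zero
  obtain ⟨φ, hφ⟩ := CommGroup.exists_apply_ne_one_of_hasEnoughRootsOfUnity G R
    (a := Multiplicative.ofAdd (x : k ⧸ S)) (fun h => hx ((QuotientAddGroup.eq_zero_iff x).1 h))
  let ψ : AddChar k R :=
    { toFun := fun y => (φ (Multiplicative.ofAdd (y : k ⧸ S)) : Rˣ)
      map_zero_eq_one' := by
        rw [QuotientAddGroup.mk_zero, ofAdd_zero, map_one, Units.val_one]
      map_add_eq_mul' := fun y z => by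
        rw [QuotientAddGroup.mk_add, ofAdd_add, map_mul, Units.val_mul] }
  refine ⟨ψ, fun h => hφ (Units.ext (DFunLike.congr_fun h x)), fun s hs => ?_⟩
  change ((φ (Multiplicative.ofAdd (s : k ⧸ S)) : Rˣ) : R) = 1
  rw [(QuotientAddGroup.eq_zero_iff s).2 hs, ofAdd_zero, map_one, Units.val_one]

omit [Finite k] in
/-- In the matrix `h` of `exists_row_eq`, rows and columns from `j` on are those of the identity. -/
lemma updateRow_swap_apply {i i₀ j : Fin m} (hij : i.val + 1 = j.val) (hi₀ : i₀ < j)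
    {r : Fin m → k} (hr : ∀ a, j ≤ a → r a = 0) :
    (∀ a b, j ≤ a → Matrix.updateRow (1 : Matrix (Fin m) (Fin m) k) i₀ r (Equiv.swap i i₀ a) b
      = (1 : Matrix _ _ k) a b) ∧
    (∀ a b, j ≤ b → Matrix.updateRow (1 : Matrix (Fin m) (Fin m) k) i₀ r (Equiv.swap i i₀ a) b
      = (1 : Matrix _ _ k) a b) ∧
    ∀ b, Matrix.updateRow (1 : Matrix (Fin m) (Fin m) k) i₀ r (Equiv.swap i i₀ i) b = r b := by
  have hi : i < j := Fin.lt_def.2 (by omega)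
  have hsw : ∀ a, j ≤ a → Equiv.swap i i₀ a = a := fun a ha =>
    Equiv.swap_apply_of_ne_of_ne (by rintro rfl; exact absurd hi (not_lt.2 ha))
      (by rintro rfl; exact absurd hi₀ (not_lt.2 ha))
  refine ⟨fun a b ha => ?_, fun a b hb => ?_, fun b => ?_⟩
  · rw [hsw a ha, Matrix.updateRow_ne (by rintro rfl; exact absurd hi₀ (not_lt.2 ha))]
  · rw [Matrix.updateRow_apply]
    split_ifs with h
    · rw [hr b hb, Matrix.one_apply_ne]
      rintro rfl
      rw [hsw a hb] at h
      exact absurd hi₀ (not_lt.2 (h ▸ hb))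
    · rw [Matrix.one_apply, Matrix.one_apply]
      congr 1
      rw [eq_iff_iff]
      constructor
      · intro h'
        rw [Equiv.swap_apply_eq_iff, hsw b hb] at h'
        exact h'
      · rintro rfl
        exact hsw a hb
  · rw [Equiv.swap_apply_left, Matrix.updateRow_self]

/-- A root subgroup at the place `(a, j)` lies in `H` when `a` and `j` have the same parity. If `r`
is non-zero at such an `a`, its character is non-trivial on `H`. Otherwise `r` is supported on
indices of the parity of `j - 1`, so it can be row `j - 1` of an element of `H`. -/
lemma isMirabolicPair_levi {ψ : AddChar k R} (hψ : ψ ≠ 1) :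
    IsMirabolicPair (symmetricSubgroup (SymmetricCase.levi : SymmetricCase k) m) ψ := by
  classical
  intro j r
  by_cases h1 : ∃ a < j, a.val % 2 = j.val % 2 ∧ r a ≠ 0
  · left
    obtain ⟨a, haj, hpar, ha⟩ := h1
    obtain ⟨s, hs⟩ : ∃ s, ψ s ≠ 1 := by
      by_contra! h
      exact hψ (by ext s; exact h s)
    have hc : ∀ b, j ≤ b → (Pi.single a (s / r a) : Fin m → k) b = 0 := fun b hb =>
      Pi.single_eq_of_ne (by rintro rfl; exact absurd haj (not_lt.2 hb)) _
    refine ⟨Pi.single a (s / r a), hc, ?_, ?_⟩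
    · rwa [dotProduct_single, mul_div_cancel₀ _ ha]
    · obtain ⟨u, -, hu⟩ := exists_columnUnipotent j _ hc
      refine ⟨u, mem_symmetricSubgroup_levi fun b c hbc => ?_, hu⟩
      rw [hu, Matrix.add_apply, Matrix.vecMulVec_apply] at hbc
      by_cases hbc' : b = c
      · rw [hbc']
      · rw [Matrix.one_apply_ne hbc', zero_add] at hbc
        have hb : b = a := by
          by_contra h
          rw [Pi.single_eq_of_ne h, zero_mul] at hbc
          exact hbc rfl
        have hc : c = j := by
          by_contra h
          rw [Pi.single_eq_of_ne h, mul_zero] at hbc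
          exact hbc rfl
        rw [hb, hc, hpar]
  · right
    by_cases h2 : ∀ a < j, r a = 0
    · exact Or.inl h2
    right
    push Not at h1 h2
    obtain ⟨i₀, hi₀, hri₀⟩ := h2
    have hi₀' := Fin.lt_def.1 hi₀
    let i : Fin m := ⟨j.val - 1, by omega⟩
    have hij : i.val + 1 = j.val := by simp only [i]; omega
    clear_value i
    let r' : Fin m → k := fun a => if a < j then r a else 0
    have hr' : ∀ a, j ≤ a → r' a = 0 := fun a ha => if_neg (not_lt.2 ha)
    obtain ⟨h, hh⟩ := exists_row_eq i i₀ r' (by simpa [r', hi₀] using hri₀)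
    obtain ⟨h3, h4, h5⟩ := updateRow_swap_apply hij hi₀ hr'
    refine ⟨i, hij, h, mem_symmetricSubgroup_levi fun a b hab => ?_, fun a b ha => by rw [hh, h3 a b ha],
      fun a b hb => by rw [hh, h4 a b hb], fun a ha => by rw [hh, h5]; exact if_pos ha⟩
    have hpar : ∀ a < j, r a ≠ 0 → a.val % 2 = i.val % 2 := by
      intro a ha har
      have h7 : a.val % 2 ≠ j.val % 2 := fun h => har (h1 a ha h)
      omega
    have hpi₀ := hpar i₀ hi₀ hri₀
    have hsw : (Equiv.swap i i₀ a).val % 2 = a.val % 2 := by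
      rw [Equiv.swap_apply_def]
      split_ifs with h6 h7
      · rw [hpi₀, h6]
      · rw [h7, hpi₀]
      · rfl
    rw [hh] at hab
    rw [← hsw]
    by_cases h6 : Equiv.swap i i₀ a = i₀
    · rw [h6, Matrix.updateRow_self] at hab
      rw [h6, hpi₀]
      have hbj : b < j := by
        by_contra h
        exact hab (hr' b (not_lt.1 h))
      exact (hpar b hbj (by simpa [r', hbj] using hab)).symm
    · rw [Matrix.updateRow_ne h6] at hab
      by_contra h7
      exact hab (Matrix.one_apply_ne (fun h => h7 (by rw [h])))

/-- If an entry `r a` is outside `k₀`, then `k = k₀ + k₀ (r a)`; as `ψ` is trivial on `k₀` but not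
on `k`, some `s` in `k₀` has `ψ (r a * s) ≠ 1`. If all relevant entries are in `k₀`, then `r` can be
a row of a matrix over `k₀`. -/
lemma isMirabolicPair_galois {k₀ : Subfield k} (hq : Module.finrank k₀ k = 2)
    {ψ : AddChar k R} (hψ : ψ ≠ 1) (hψ₀ : ∀ s ∈ k₀, ψ s = 1) :
    IsMirabolicPair (symmetricSubgroup (SymmetricCase.galois k₀ hq) m) ψ := by
  classical
  intro j r
  by_cases h1 : ∃ a < j, r a ∉ k₀
  · left
    obtain ⟨a, haj, ha⟩ := h1
    obtain ⟨s, hs⟩ : ∃ s : k₀, ψ (r a * s) ≠ 1 := by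
      by_contra! h
      apply hψ
      have hli : LinearIndependent k₀ ![(1 : k), r a] := by
        rw [LinearIndependent.pair_iff]
        intro x y hxy
        have hy : y = 0 := by
          by_contra hy
          apply ha
          have : r a = ((-(y⁻¹ * x) : k₀) : k) := by
            have hy' : (y : k) ≠ 0 := fun h => hy (Subtype.ext h)
            rw [Subfield.smul_def, Subfield.smul_def, smul_eq_mul, smul_eq_mul, mul_one] at hxy
            push_cast
            field_simp
            linear_combination hxy
          rw [this]
          exact SetLike.coe_mem _
        rw [hy, zero_smul, add_zero, Subfield.smul_def, smul_eq_mul, mul_one] at hxy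
        exact ⟨Subtype.ext hxy, hy⟩
      have hspan := hli.span_eq_top_of_card_eq_finrank (by rw [hq]; rfl)
      ext x
      have hx : x ∈ Submodule.span k₀ (Set.range ![(1 : k), r a]) := hspan ▸ Submodule.mem_top
      rw [Matrix.range_cons, Matrix.range_cons, Matrix.range_empty, Set.union_empty,
        Set.singleton_union, Submodule.mem_span_pair] at hx
      obtain ⟨y, z, rfl⟩ := hx
      rw [AddChar.map_add_eq_mul, Subfield.smul_def, Subfield.smul_def, smul_eq_mul, smul_eq_mul,
        mul_one, hψ₀ y y.2, mul_comm _ (r a), h z, mul_one]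
      rfl
    have hc : ∀ b, j ≤ b → (Pi.single a (s : k) : Fin m → k) b = 0 := fun b hb =>
      Pi.single_eq_of_ne (by rintro rfl; exact absurd haj (not_lt.2 hb)) _
    have hc₀ : ∀ b, j ≤ b → (Pi.single a s : Fin m → k₀) b = 0 := fun b hb =>
      Pi.single_eq_of_ne (by rintro rfl; exact absurd haj (not_lt.2 hb)) _
    refine ⟨Pi.single a (s : k), hc, ?_, ?_⟩
    · rwa [dotProduct_single]
    · obtain ⟨u, -, hu⟩ := exists_columnUnipotent j _ hc
      obtain ⟨u₀, -, hu₀⟩ := exists_columnUnipotent j _ hc₀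
      refine ⟨u, mem_symmetricSubgroup_galois hq u₀ fun b c => ?_, hu⟩
      rw [hu, hu₀]
      simp only [Matrix.add_apply, Matrix.vecMulVec_apply, Matrix.one_apply, Pi.single_apply]
      split_ifs <;> simp
  · right
    by_cases h2 : ∀ a < j, r a = 0
    · exact Or.inl h2
    right
    push Not at h1 h2
    obtain ⟨i₀, hi₀, hri₀⟩ := h2
    have hi₀' := Fin.lt_def.1 hi₀
    let i : Fin m := ⟨j.val - 1, by omega⟩
    have hij : i.val + 1 = j.val := by simp only [i]; omega
    clear_value i
    let r₀ : Fin m → k₀ := fun a => if h : a < j then ⟨r a, h1 a h⟩ else 0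
    let r' : Fin m → k := fun a => r₀ a
    have hr' : ∀ a, j ≤ a → r' a = 0 := fun a ha => by simp [r', r₀, not_lt.2 ha]
    have hr'' : ∀ a < j, r' a = r a := fun a ha => by simp [r', r₀, ha]
    have hne : r' i₀ ≠ 0 := by rwa [hr'' i₀ hi₀]
    obtain ⟨h, hh⟩ := exists_row_eq i i₀ r' hne
    obtain ⟨h₀, hh₀⟩ := exists_row_eq i i₀ r₀ (fun h => hne (by simp only [r', h]; rfl))
    obtain ⟨h3, h4, h5⟩ := updateRow_swap_apply hij hi₀ hr'
    refine ⟨i, hij, h, mem_symmetricSubgroup_galois hq h₀ fun a b => ?_,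
      fun a b ha => by rw [hh, h3 a b ha], fun a b hb => by rw [hh, h4 a b hb],
      fun a ha => by rw [hh, h5, hr'' a ha]⟩
    rw [hh, hh₀, Matrix.updateRow_apply, Matrix.updateRow_apply]
    split_ifs
    · rfl
    · simp only [Matrix.one_apply]
      split_ifs <;> simp

/-- A non-trivial additive character adapted to the symmetric subgroups. -/
theorem exists_addChar_isMirabolicPair [IsAlgClosed R] [CharP R 2] (hk : ringChar k ≠ 2)
    (c : SymmetricCase k) : ∃ ψ : AddChar k R, ψ ≠ 1 ∧
      ∀ m, IsMirabolicPair (symmetricSubgroup c m) ψ := by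
  cases c with
  | galois k₀ hq =>
    obtain ⟨ψ, hψ, h⟩ := exists_addChar (R := R) hk k₀.toAddSubgroup (by
      intro h
      have h1 : Module.finrank k₀ k = 1 := finrank_eq_one (1 : k) one_ne_zero fun x =>
        ⟨⟨x, by
          have : x ∈ k₀.toAddSubgroup := h ▸ AddSubgroup.mem_top x
          exact this⟩, by rw [Subfield.smul_def, smul_eq_mul, mul_one]⟩
      omega)
    exact ⟨ψ, hψ, fun m => isMirabolicPair_galois hq hψ h⟩
  | levi =>
    obtain ⟨ψ, hψ, -⟩ := exists_addChar (R := R) hk (⊥ : AddSubgroup k) bot_ne_top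
    exact ⟨ψ, hψ, fun m => isMirabolicPair_levi hψ⟩

end Symmetric

/-! ### Unipotent radicals of stabilizers of subspaces -/

section Radical

variable {k : Type*} [Field k] {n : ℕ}

/-- The matrices with image in the subspace `S` which vanish on `S`. -/
def radical (S : Submodule k (Fin n → k)) : NonUnitalSubalgebra k (Matrix (Fin n) (Fin n) k) where
  carrier := {x | (∀ v, x.mulVec v ∈ S) ∧ ∀ v ∈ S, x.mulVec v = 0}
  add_mem' := fun {x y} hx hy =>
    ⟨fun v => by rw [Matrix.add_mulVec]; exact S.add_mem (hx.1 v) (hy.1 v),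
      fun v hv => by rw [Matrix.add_mulVec, hx.2 v hv, hy.2 v hv, add_zero]⟩
  zero_mem' := ⟨fun v => by rw [Matrix.zero_mulVec]; exact S.zero_mem,
    fun v _ => Matrix.zero_mulVec v⟩
  smul_mem' := fun c x hx =>
    ⟨fun v => by rw [Matrix.smul_mulVec]; exact S.smul_mem c (hx.1 v),
      fun v hv => by rw [Matrix.smul_mulVec, hx.2 v hv, smul_zero]⟩
  mul_mem' := fun {x y} hx hy =>
    ⟨fun v => by rw [← Matrix.mulVec_mulVec]; exact hx.1 _,
      fun v hv => by rw [← Matrix.mulVec_mulVec, hy.2 v hv, Matrix.mulVec_zero]⟩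

lemma mul_self_of_mem_radical {S : Submodule k (Fin n → k)} {x : Matrix (Fin n) (Fin n) k}
    (hx : x ∈ radical S) : x * x = 0 := by
  refine Matrix.ext_of_mulVec_single fun i => ?_
  rw [← Matrix.mulVec_mulVec, hx.2 _ (hx.1 _), Matrix.zero_mulVec]

lemma isNilpotent_of_mem_radical {S : Submodule k (Fin n → k)} {x : Matrix (Fin n) (Fin n) k}
    (hx : x ∈ radical S) : IsNilpotent x :=
  ⟨2, by rw [pow_two, mul_self_of_mem_radical hx]⟩

/-- The subspace spanned by the first `a` vectors of the standard basis. -/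
def initial (k : Type*) [Field k] (n a : ℕ) : Submodule k (Fin n → k) where
  carrier := {v | ∀ i : Fin n, a ≤ i.val → v i = 0}
  add_mem' := fun {v w} hv hw i hi => by rw [Pi.add_apply, hv i hi, hw i hi, add_zero]
  zero_mem' := fun _ _ => rfl
  smul_mem' := fun c v hv i hi => by rw [Pi.smul_apply, hv i hi, smul_zero]

lemma finrank_initial {a : ℕ} (ha : a ≤ n) : Module.finrank k (initial k n a) = a := by
  let e : initial k n a ≃ₗ[k] (Fin a → k) :=
    { toFun := fun v i => v.1 (Fin.castLE ha i)
      map_add' := fun v w => rfl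
      map_smul' := fun c v => rfl
      invFun := fun v => ⟨fun i => if h : i.val < a then v ⟨i, h⟩ else 0,
        fun i hi => dif_neg (not_lt.2 hi)⟩
      left_inv := fun v => by
        ext i
        by_cases h : i.val < a
        · simp [h]
        · simp only [h, dif_neg, not_false_eq_true]
          exact (v.2 i (not_lt.1 h)).symm
      right_inv := fun v => by
        ext i
        simp }
  rw [e.finrank_eq, Module.finrank_fin_fun]

lemma mem_radical_initial {a : ℕ} {x : Matrix (Fin n) (Fin n) k} :
    x ∈ radical (initial k n a) ↔ ∀ i j : Fin n, (a ≤ i.val ∨ j.val < a) → x i j = 0 := by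
  classical
  constructor
  · rintro ⟨h1, h2⟩ i j (hi | hj)
    · have := h1 (Pi.single j 1) i hi
      rwa [Matrix.mulVec_single_one, Matrix.col_apply] at this
    · have := congrFun (h2 (Pi.single j 1) fun l hl => Pi.single_eq_of_ne (by
        rintro rfl; omega) _) i
      rwa [Matrix.mulVec_single_one, Matrix.col_apply] at this
  · intro h
    refine ⟨fun v i hi => ?_, fun v hv => funext fun i => ?_⟩
    · rw [Matrix.mulVec, dotProduct]
      exact Finset.sum_eq_zero fun j _ => by rw [h i j (Or.inl hi), zero_mul]
    · rw [Matrix.mulVec, dotProduct]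
      refine Finset.sum_eq_zero fun j _ => ?_
      by_cases hj : j.val < a
      · rw [h i j (Or.inr hj), zero_mul]
      · rw [hv j (not_lt.1 hj), mul_zero]

/-- Any subspace is the image of the span of the first vectors of the standard basis. -/
lemma exists_map_initial_eq (S : Submodule k (Fin n → k)) :
    ∃ g : GL (Fin n) k, (∀ v ∈ initial k n (Module.finrank k S), g.val.mulVec v ∈ S) ∧
      ∀ v ∈ S, (g⁻¹).val.mulVec v ∈ initial k n (Module.finrank k S) := by
  set a := Module.finrank k S with ha
  have han : a ≤ n := by
    have := S.finrank_le
    rwa [Module.finrank_fin_fun] at this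
  obtain ⟨S', hS'⟩ := S.exists_isCompl
  obtain ⟨I', hI'⟩ := (initial k n a).exists_isCompl
  have h1 : Module.finrank k (initial k n a) = Module.finrank k S := by rw [finrank_initial han]
  have h2 : Module.finrank k I' = Module.finrank k S' := by
    have := Submodule.finrank_add_eq_of_isCompl hS'
    have := Submodule.finrank_add_eq_of_isCompl hI'
    omega
  let e : (Fin n → k) ≃ₗ[k] (Fin n → k) :=
    (Submodule.prodEquivOfIsCompl _ _ hI').symm ≪≫ₗ
      ((LinearEquiv.ofFinrankEq _ _ h1).prodCongr (LinearEquiv.ofFinrankEq _ _ h2)) ≪≫ₗ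
        Submodule.prodEquivOfIsCompl _ _ hS'
  have hg1 : LinearMap.toMatrix' e.toLinearMap * LinearMap.toMatrix' e.symm.toLinearMap = 1 := by
    rw [← LinearMap.toMatrix'_comp, LinearEquiv.comp_symm, LinearMap.toMatrix'_id]
  have hg2 : LinearMap.toMatrix' e.symm.toLinearMap * LinearMap.toMatrix' e.toLinearMap = 1 := by
    rw [← LinearMap.toMatrix'_comp, LinearEquiv.symm_comp, LinearMap.toMatrix'_id]
  refine ⟨⟨_, _, hg1, hg2⟩, fun v hv => ?_, fun v hv => ?_⟩
  · rw [LinearMap.toMatrix'_mulVec]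
    have : e v = (LinearEquiv.ofFinrankEq _ _ h1 ⟨v, hv⟩ : S) := by
      simp only [e, LinearEquiv.trans_apply]
      have h3 : (Submodule.prodEquivOfIsCompl _ _ hI').symm v = (⟨v, hv⟩, 0) :=
        Submodule.prodEquivOfIsCompl_symm_apply_left _ _ hI' ⟨v, hv⟩
      rw [h3]
      simp
    change e v ∈ S
    rw [this]
    exact Subtype.mem _
  · change (LinearMap.toMatrix' e.symm.toLinearMap).mulVec v ∈ _
    rw [LinearMap.toMatrix'_mulVec]
    have : e.symm v = ((LinearEquiv.ofFinrankEq _ _ h1).symm ⟨v, hv⟩ : initial k n a) := by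
      rw [LinearEquiv.symm_apply_eq]
      simp only [e, LinearEquiv.trans_apply]
      rw [Submodule.prodEquivOfIsCompl_symm_apply_left]
      simp
    change e.symm v ∈ _
    rw [this]
    exact Subtype.mem _

variable [Finite k]

/-- The unipotent radical of the stabilizer of a subspace. -/
abbrev unipotentRadical (S : Submodule k (Fin n → k)) : Subgroup (GL (Fin n) k) :=
  unipotent (radical S)

lemma odd_card_unipotentRadical (hk : ringChar k ≠ 2) (S : Submodule k (Fin n → k)) :
    Odd (Nat.card (unipotentRadical S)) :=
  odd_card_unipotent hk fun _ hx => isNilpotent_of_mem_radical hx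

/-- The invertible matrix `1 + x`, for `x` in the radical attached to a subspace. -/
lemma exists_one_add_radical {S : Submodule k (Fin n → k)}
    {x : Matrix (Fin n) (Fin n) k} (hx : x ∈ radical S) :
    ∃ u ∈ unipotentRadical S, u.val = 1 + x := by
  have h0 := mul_self_of_mem_radical hx
  refine ⟨⟨1 + x, 1 - x, ?_, ?_⟩, ?_, rfl⟩
  · rw [add_mul, mul_sub, mul_sub, h0]; simp
  · rw [sub_mul, mul_add, mul_add, h0]; simp
  · rw [mem_unipotent, add_sub_cancel_left]; exact hx

end Radical

/-! ### Matrices in block form -/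

section Blocks

variable {a b n : ℕ} {k : Type*} [Field k]

lemma blocks_apply_inl_inl (h : a + b = n) (x : Matrix (Fin n) (Fin n) k) (i j : Fin a) :
    (blocks k h x).toBlocks₁₁ i j = x ⟨i, by omega⟩ ⟨j, by omega⟩ := rfl

lemma blocks_apply_inr_inl (h : a + b = n) (x : Matrix (Fin n) (Fin n) k) (i : Fin b) (j : Fin a) :
    (blocks k h x).toBlocks₂₁ i j = x ⟨a + i, by omega⟩ ⟨j, by omega⟩ := rfl

lemma blocks_apply_inr_inr (h : a + b = n) (x : Matrix (Fin n) (Fin n) k) (i j : Fin b) :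
    (blocks k h x).toBlocks₂₂ i j = x ⟨a + i, by omega⟩ ⟨a + j, by omega⟩ := rfl

/-- The invertible matrix with given blocks, its inverse being given by blocks as well. -/
noncomputable def ofBlocks (h : a + b = n) (x y : Matrix (Fin a ⊕ Fin b) (Fin a ⊕ Fin b) k)
    (hxy : x * y = 1) : GL (Fin n) k :=
  ⟨(blocks k h).symm x, (blocks k h).symm y, by rw [← map_mul, hxy, map_one],
    by rw [← map_mul, mul_eq_one_comm.1 hxy, map_one]⟩

lemma blocks_ofBlocks (h : a + b = n) (x y : Matrix (Fin a ⊕ Fin b) (Fin a ⊕ Fin b) k)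
    (hxy : x * y = 1) : blocks k h (ofBlocks h x y hxy).val = x :=
  (blocks k h).apply_symm_apply x

lemma ext_blocks (h : a + b = n) {g g' : GL (Fin n) k}
    (hg : blocks k h g.val = blocks k h g'.val) : g = g' :=
  Units.ext ((blocks k h).injective hg)

/-- The block diagonal matrix with blocks `x` and `y`. -/
noncomputable def blockDiag (h : a + b = n) (x : GL (Fin a) k) (y : GL (Fin b) k) : GL (Fin n) k :=
  ofBlocks h (Matrix.fromBlocks x.val 0 0 y.val) (Matrix.fromBlocks (x⁻¹).val 0 0 (y⁻¹).val)
    (by simp [Matrix.fromBlocks_multiply])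

lemma blocks_blockDiag (h : a + b = n) (x : GL (Fin a) k) (y : GL (Fin b) k) :
    blocks k h (blockDiag h x y).val = Matrix.fromBlocks x.val 0 0 y.val :=
  blocks_ofBlocks _ _ _ _

lemma blockDiag_mul (h : a + b = n) (x x' : GL (Fin a) k) (y y' : GL (Fin b) k) :
    blockDiag h (x * x') (y * y') = blockDiag h x y * blockDiag h x' y' := by
  apply ext_blocks h
  rw [Units.val_mul, map_mul, blocks_blockDiag, blocks_blockDiag, blocks_blockDiag,
    Matrix.fromBlocks_multiply]
  simp

lemma blockDiag_one (h : a + b = n) :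
    blockDiag h (1 : GL (Fin a) k) (1 : GL (Fin b) k) = 1 := by
  apply ext_blocks h
  rw [blocks_blockDiag, Units.val_one, Units.val_one, Units.val_one, map_one,
    Matrix.fromBlocks_one]

lemma blockDiag_inv (h : a + b = n) (x : GL (Fin a) k) (y : GL (Fin b) k) :
    (blockDiag h x y)⁻¹ = blockDiag h x⁻¹ y⁻¹ := by
  rw [inv_eq_iff_mul_eq_one, ← blockDiag_mul, mul_inv_cancel, mul_inv_cancel, blockDiag_one]

lemma mem_radical_of_blocks (h : a + b = n) {x : Matrix (Fin n) (Fin n) k}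
    {y : Matrix (Fin a) (Fin b) k} (hx : blocks k h x = Matrix.fromBlocks 0 y 0 0) :
    x ∈ radical (initial k n a) := by
  subst h
  rw [mem_radical_initial]
  intro i j hij
  have hx' : ∀ i j : Fin a ⊕ Fin b, x (finSumFinEquiv i) (finSumFinEquiv j)
      = Matrix.fromBlocks 0 y 0 0 i j := fun i j => by rw [← hx]; rfl
  obtain ⟨i, rfl⟩ := finSumFinEquiv.surjective i
  obtain ⟨j, rfl⟩ := finSumFinEquiv.surjective j
  rw [hx']
  rcases i with i | i <;> rcases j with j | j
  · rfl
  · exfalso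
    have := i.2
    simp at hij
    omega
  · rfl
  · rfl

end Blocks

/-! ### Cuspidality as vanishing of vectors fixed by unipotent radicals -/

section Cuspidal

variable {k : Type*} [Field k] [Finite k] {n : ℕ} {R : Type u} [Field R] [CharP R 2]
  {V : Type*} [AddCommGroup V] [Module R V] {π : Representation R (GL (Fin n) k) V}

/-- The representation of a finite group on its functions by right translation, realised on
functions on `Fin (Nat.card G)`. -/
noncomputable def regular (R : Type u) [Field R] (G : Type*) [Group G] [Finite G] :
    Representation R G (Fin (Nat.card G) → R) where
  toFun x := LinearMap.funLeft R R fun i => Finite.equivFin G ((Finite.equivFin G).symm i * x)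
  map_one' := by ext; simp [LinearMap.funLeft]
  map_mul' x y := by ext; simp [LinearMap.funLeft, mul_assoc]

omit [CharP R 2] in
lemma regular_single (G : Type*) [Group G] [Finite G] (x y : G) :
    regular R G x (Pi.single (Finite.equivFin G y) 1) = Pi.single (Finite.equivFin G (y * x⁻¹)) 1 := by
  ext i
  obtain ⟨z, rfl⟩ := (Finite.equivFin G).surjective i
  simp only [regular, MonoidHom.coe_mk, OneHom.coe_mk, LinearMap.funLeft_apply,
    Equiv.symm_apply_apply, Pi.single_apply]
  refine if_congr ?_ rfl rfl
  rw [EmbeddingLike.apply_eq_iff_eq, EmbeddingLike.apply_eq_iff_eq, eq_mul_inv_iff_mul_eq]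

omit [CharP R 2] in
-- Modulo the unipotent radical on the left, an element of the parabolic acts through its diagonal
-- blocks; the projector onto fixed vectors absorbs the difference.
lemma blockDiag_mul_mem {a b : ℕ} (h : a + b = n) (x : GL (Fin a) k) (y : GL (Fin b) k)
    (q : parabolic k h) :
    blockDiag h x y * q * (blockDiag h (x * leviFst k h q) (y * leviSnd k h q))⁻¹
      ∈ unipotentRadical (initial k n a) := by
  have hq : blocks k h q.1.val = Matrix.fromBlocks (leviFst k h q).val
      (blocks k h q.1.val).toBlocks₁₂ 0 (leviSnd k h q).val := by
    conv_lhs => rw [← Matrix.fromBlocks_toBlocks (blocks k h q.1.val)]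
    congr 1
    exact q.2
  rw [mem_unipotent]
  apply mem_radical_of_blocks h (y := x.val * (blocks k h q.1.val).toBlocks₁₂ *
    ((y * leviSnd k h q)⁻¹).val)
  rw [map_sub, map_one, blockDiag_inv, Units.val_mul, Units.val_mul, map_mul, map_mul,
    blocks_blockDiag, blocks_blockDiag, hq, Matrix.fromBlocks_multiply, Matrix.fromBlocks_multiply,
    ← Matrix.fromBlocks_one, sub_eq_iff_eq_add, Matrix.fromBlocks_add]
  simp only [Matrix.mul_zero, Matrix.zero_mul, add_zero, zero_add, Matrix.toBlocks_fromBlocks₁₂,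
    ← Units.val_mul, mul_inv_cancel, Units.val_one]

/-- Frobenius reciprocity made explicit: a non-zero fixed vector and a linear form non-zero on it
yield matrix coefficients along the Levi subgroup, which embed `π` in the representation induced
from two regular representations. These are modelled on `Fin _ → R` so as to lie in the universe of
`R`. -/
lemma IsCuspidal.eq_zero_of_initial (hπ : IsCuspidal π) (hk : ringChar k ≠ 2) {a b : ℕ}
    (h : a + b = n) (ha : 0 < a) (hb : 0 < b) {v : V}
    (hv : v ∈ eigenvectors π (unipotentRadical (initial k n a)) (fun _ => 1)) : v = 0 := by
  classical
  by_contra hv0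
  let _ := Fintype.ofFinite (GL (Fin a) k)
  let _ := Fintype.ofFinite (GL (Fin b) k)
  obtain ⟨lam, hlam⟩ : ∃ lam : Module.Dual R V, lam v ≠ 0 := by
    by_contra! h
    exact hv0 ((Module.forall_dual_apply_eq_zero_iff R v).1 h)
  set U := unipotentRadical (initial k n a)
  let e := eigenProjector π U (fun _ => 1)
  have hev : e v = v := eigenProjector_apply_of_mem (IsCharOn.const_one U)
    (odd_card_unipotentRadical hk _) hv
  have he : ∀ (x : GL (Fin a) k) (y : GL (Fin b) k) (q : parabolic k h) (w : V),
      e (π (blockDiag h x y) (π q w))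
        = e (π (blockDiag h (x * leviFst k h q) (y * leviSnd k h q)) w) := by
    intro x y q w
    have hz := blockDiag_mul_mem h x y q
    have h1 := eigenProjector_apply_group (ρ := π) (IsCharOn.const_one U) hz
      (π (blockDiag h (x * leviFst k h q) (y * leviSnd k h q)) w)
    rw [one_smul] at h1
    rw [← rep_mul_apply, inv_mul_cancel_right, rep_mul_apply] at h1
    exact h1
  let δ₁ : GL (Fin a) k → Fin (Nat.card (GL (Fin a) k)) → R := fun x =>
    Pi.single (Finite.equivFin _ x) 1
  let δ₂ : GL (Fin b) k → Fin (Nat.card (GL (Fin b) k)) → R := fun x =>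
    Pi.single (Finite.equivFin _ x) 1
  let ρ₁ := regular R (GL (Fin a) k)
  let ρ₂ := regular R (GL (Fin b) k)
  let T : V →ₗ[R] GL (Fin n) k → (Fin (Nat.card (GL (Fin a) k)) → R) ⊗[R]
      (Fin (Nat.card (GL (Fin b) k)) → R) :=
    LinearMap.pi fun g => ∑ x : GL (Fin a) k, ∑ y : GL (Fin b) k,
      (lam ∘ₗ e ∘ₗ π (blockDiag h x y) ∘ₗ π g).smulRight (δ₁ x ⊗ₜ[R] δ₂ y)
  have hT : ∀ w g, T w g = ∑ x : GL (Fin a) k, ∑ y : GL (Fin b) k,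
      lam (e (π (blockDiag h x y) (π g w))) • (δ₁ x ⊗ₜ[R] δ₂ y) := fun w g => by
    simp only [T, LinearMap.pi_apply, LinearMap.sum_apply, LinearMap.smulRight_apply,
      LinearMap.comp_apply]
  have hmem : ∀ w, T w ∈ Representation.coindV (parabolic k h).subtype (inflation h ρ₁ ρ₂) := by
    intro w q g
    rw [hT, hT, map_sum]
    simp only [map_sum, map_smul]
    refine Fintype.sum_equiv (Equiv.mulRight (leviFst k h q)) _ _ fun x => ?_
    refine Fintype.sum_equiv (Equiv.mulRight (leviSnd k h q)) _ _ fun y => ?_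
    have h1 : inflation h ρ₁ ρ₂ q (δ₁ (x * leviFst k h q) ⊗ₜ[R] δ₂ (y * leviSnd k h q))
        = δ₁ x ⊗ₜ[R] δ₂ y := by
      simp only [inflation, Representation.tprod_apply, TensorProduct.map_tmul, MonoidHom.comp_apply,
        ρ₁, ρ₂, δ₁, δ₂]
      rw [regular_single, regular_single, mul_inv_cancel_right, mul_inv_cancel_right]
    simp only [Equiv.coe_mulRight]
    rw [h1, Subgroup.coe_subtype, _root_.map_mul, Module.End.mul_apply, he]
  let F : π.IntertwiningMap (parabolicInduction h ρ₁ ρ₂) :=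
    { toLinearMap := T.codRestrict _ hmem
      isIntertwining' := fun g => by
        ext w x
        change T (π g w) x = T w (x * g)
        rw [hT, hT]
        simp only [_root_.map_mul, Module.End.mul_apply] }
  have hinj : Function.Injective T := by
    refine injective_of_irreducible hπ.1 T (fun g w hw => ?_) (v := v) fun hFv => ?_
    · ext x
      have h1 : T (π g w) x = T w (x * g) := by
        rw [hT, hT]
        simp only [_root_.map_mul, Module.End.mul_apply]
      rw [h1, hw]
      rfl
    · have h0 : T v 1 = 0 := congrFun hFv 1
      apply hlam
      let ev : (Fin (Nat.card (GL (Fin a) k)) → R) ⊗[R] (Fin (Nat.card (GL (Fin b) k)) → R) →ₗ[R]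
          R := (TensorProduct.lid R R).toLinearMap ∘ₗ TensorProduct.map
            (LinearMap.proj (Finite.equivFin _ 1)) (LinearMap.proj (Finite.equivFin _ 1))
      have h1 := congrArg ev h0
      rw [hT, map_zero] at h1
      simp only [map_sum, map_smul] at h1
      have h2 : ∀ x y, ev (δ₁ x ⊗ₜ δ₂ y) = (if x = 1 then 1 else 0) * (if y = 1 then 1 else 0) := by
        intro x y
        simp only [ev, δ₁, δ₂, LinearMap.comp_apply, TensorProduct.map_tmul, LinearMap.proj_apply,
          LinearEquiv.coe_coe, TensorProduct.lid_tmul, smul_eq_mul, Pi.single_apply,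
          (Finite.equivFin _).injective.eq_iff, eq_comm]
      simp only [h2, smul_eq_mul, mul_ite, mul_one, mul_zero,
        Finset.sum_ite_eq', Finset.mem_univ, if_true] at h1
      rw [blockDiag_one, map_one, Module.End.one_apply, Module.End.one_apply, hev] at h1
      exact h1
  exact hπ.2 a b h ha hb _ _ ρ₁ ρ₂
    ⟨F, fun x y hxy => hinj (congrArg Subtype.val hxy)⟩

/-- Some group element carries `initial` to `S`, and conjugation by it carries one unipotent radical
into the other. -/
theorem IsCuspidal.eq_zero (hπ : IsCuspidal π) (hk : ringChar k ≠ 2) {S : Submodule k (Fin n → k)}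
    (hS : S ≠ ⊥) (hS' : S ≠ ⊤) {v : V}
    (hv : v ∈ eigenvectors π (unipotentRadical S) (fun _ => 1)) : v = 0 := by
  obtain ⟨g, hg, hg'⟩ := exists_map_initial_eq S
  have h1 : 0 < Module.finrank k S := by
    rw [Nat.pos_iff_ne_zero, Ne, Submodule.finrank_eq_zero]
    exact hS
  have h2 : Module.finrank k S < n := by
    have := Submodule.finrank_lt hS'
    rwa [Module.finrank_fin_fun] at this
  have h3 : π g⁻¹ v = 0 := by
    refine hπ.eq_zero_of_initial hk (Nat.add_sub_cancel' h2.le) h1 (Nat.sub_pos_of_lt h2) ?_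
    intro u hu
    have hmem : g * u * g⁻¹ ∈ unipotentRadical S := by
      have h4 : (g * u * g⁻¹).val - 1 = g.val * (u.val - 1) * (g⁻¹).val := by
        rw [mul_sub, sub_mul, mul_one, Units.mul_inv, Units.val_mul, Units.val_mul]
      rw [mem_unipotent, h4]
      refine ⟨fun w => ?_, fun w hw => ?_⟩
      · rw [← Matrix.mulVec_mulVec, ← Matrix.mulVec_mulVec]
        exact hg _ (hu.1 _)
      · rw [← Matrix.mulVec_mulVec, ← Matrix.mulVec_mulVec, hu.2 _ (hg' w hw), Matrix.mulVec_zero]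
    have h5 := hv _ hmem
    rw [one_smul] at h5
    rw [one_smul]
    conv_rhs => rw [← h5]
    rw [← Module.End.mul_apply, ← Module.End.mul_apply, ← _root_.map_mul, ← _root_.map_mul]
    congr 2
    group
  rw [← rep_inv_apply π g v, h3, map_zero]

/-- The sum of the operators attached to a proper unipotent radical is zero. -/
lemma IsCuspidal.eigenProjector_eq_zero (hπ : IsCuspidal π) (hk : ringChar k ≠ 2)
    {S : Submodule k (Fin n → k)} (hS : S ≠ ⊥) (hS' : S ≠ ⊤) :
    eigenProjector π (unipotentRadical S) (fun _ => 1) = 0 := by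
  ext v
  exact hπ.eq_zero hk hS hS' (eigenProjector_mem (IsCharOn.const_one _) v)

end Cuspidal

/-! ### Upper and lower halves of vectors -/

section Halves

variable {k : Type*} [Field k] {n N : ℕ}

/-- The first `n` coordinates of a vector of size `n + n`. -/
def upper (k : Type*) [Field k] (h : n + n = N) : (Fin N → k) →ₗ[k] (Fin n → k) :=
  LinearMap.funLeft k k fun i => ⟨i, by omega⟩

/-- The last `n` coordinates of a vector of size `n + n`. -/
def lower (k : Type*) [Field k] (h : n + n = N) : (Fin N → k) →ₗ[k] (Fin n → k) :=
  LinearMap.funLeft k k fun i => ⟨n + i, by omega⟩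

lemma upper_apply (h : n + n = N) (v : Fin N → k) (i : Fin n) :
    upper k h v i = v ⟨i, by omega⟩ := rfl

lemma lower_apply (h : n + n = N) (v : Fin N → k) (i : Fin n) :
    lower k h v i = v ⟨n + i, by omega⟩ := rfl

lemma eq_zero_of_halves (h : n + n = N) {v : Fin N → k} (h1 : upper k h v = 0)
    (h2 : lower k h v = 0) : v = 0 := by
  ext i
  by_cases hi : i.val < n
  · exact congrFun h1 ⟨i, hi⟩
  · have := congrFun h2 ⟨i.val - n, by omega⟩
    rw [lower_apply] at this
    have e : i = ⟨n + (i.val - n), by omega⟩ := Fin.ext (by simp only; omega)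
    rw [e]
    exact this

/-- The upper half of the image of a vector under `g`. -/
def upperRow (h : n + n = N) (g : Matrix (Fin N) (Fin N) k) : (Fin N → k) →ₗ[k] (Fin n → k) :=
  upper k h ∘ₗ g.mulVecLin

/-- The lower half of the image of a vector under `g`. -/
def lowerRow (h : n + n = N) (g : Matrix (Fin N) (Fin N) k) : (Fin N → k) →ₗ[k] (Fin n → k) :=
  lower k h ∘ₗ g.mulVecLin

lemma eq_zero_of_rows (h : n + n = N) {g : GL (Fin N) k} {v : Fin N → k}
    (h1 : upperRow h g.val v = 0) (h2 : lowerRow h g.val v = 0) : v = 0 := by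
  have := eq_zero_of_halves h (v := g.val.mulVec v) h1 h2
  rw [← Matrix.one_mulVec v, ← Units.val_one, ← inv_mul_cancel g, Units.val_mul,
    ← Matrix.mulVec_mulVec, this, Matrix.mulVec_zero]

lemma blocks_eq_of_halves (h : n + n = N) {z : Matrix (Fin N) (Fin N) k}
    {t₁ t₂ : Matrix (Fin n) (Fin n) k} {E : (Fin n → k) →ₗ[k] (Fin n → k)}
    (h1 : ∀ v, upper k h (z.mulVec v) = t₁.mulVec (upper k h v) + E (lower k h v))
    (h2 : ∀ v, lower k h (z.mulVec v) = t₂.mulVec (lower k h v)) :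
    (blocks k h z).toBlocks₁₁ = t₁ ∧ (blocks k h z).toBlocks₂₁ = 0 ∧
      (blocks k h z).toBlocks₂₂ = t₂ := by
  classical
  have hl : ∀ j : Fin n, upper k h (Pi.single ⟨j, by omega⟩ 1) = Pi.single j (1 : k) ∧
      lower k h (Pi.single ⟨j, by omega⟩ 1) = (0 : Fin n → k) := fun j => by
    constructor <;> ext i
    · rw [upper_apply]
      simp only [Pi.single_apply, Fin.ext_iff]
    · rw [lower_apply, Pi.single_eq_of_ne, Pi.zero_apply]
      rw [Ne, Fin.ext_iff]
      simp only
      omega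
  have hr : ∀ j : Fin n, lower k h (Pi.single ⟨n + j, by omega⟩ 1) = Pi.single j (1 : k) :=
    fun j => by
    ext i
    rw [lower_apply]
    simp only [Pi.single_apply, Fin.ext_iff]
    congr 1
    rw [eq_iff_iff]
    omega
  refine ⟨?_, ?_, ?_⟩
  · ext i j
    have := congrFun (h1 (Pi.single ⟨j, by omega⟩ 1)) i
    rw [(hl j).1, (hl j).2, map_zero, add_zero, Matrix.mulVec_single_one, Matrix.mulVec_single_one,
      upper_apply] at this
    exact this
  · ext i j
    have := congrFun (h2 (Pi.single ⟨j, by omega⟩ 1)) i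
    rw [(hl j).2, Matrix.mulVec_zero, Matrix.mulVec_single_one, lower_apply] at this
    exact this
  · ext i j
    have := congrFun (h2 (Pi.single ⟨n + j, by omega⟩ 1)) i
    rw [hr j, Matrix.mulVec_single_one, Matrix.mulVec_single_one, lower_apply] at this
    exact this

end Halves

/-! ### Lifting and factoring linear maps -/

section Lift

variable {k X Z M : Type*} [Field k] [AddCommGroup X] [Module k X] [AddCommGroup Z] [Module k Z]
  [AddCommGroup M] [Module k M]

/-- The lift is `D` followed by a section of `f`, so it vanishes wherever `D` does. This extra
property is what places the matrices built from it in a radical. -/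
lemma exists_lift (f : X →ₗ[k] Z) (D : M →ₗ[k] Z) (hD : ∀ v, D v ∈ LinearMap.range f) :
    ∃ Γ : M →ₗ[k] X, (∀ v, f (Γ v) = D v) ∧ ∀ v, D v = 0 → Γ v = 0 := by
  obtain ⟨s, hs⟩ := f.rangeRestrict.exists_rightInverse_of_surjective f.range_rangeRestrict
  refine ⟨s ∘ₗ D.codRestrict _ hD, fun v => ?_, fun v hv => ?_⟩
  · exact congrArg Subtype.val (LinearMap.congr_fun hs (D.codRestrict _ hD v))
  · have : D.codRestrict _ hD v = 0 := Subtype.ext hv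
    rw [LinearMap.comp_apply, this, map_zero]

lemma exists_factor (f : X →ₗ[k] Z) (G : X →ₗ[k] M) (hG : ∀ v, f v = 0 → G v = 0) :
    ∃ Q : Z →ₗ[k] M, ∀ v, Q (f v) = G v := by
  obtain ⟨s, hs⟩ := f.rangeRestrict.exists_rightInverse_of_surjective f.range_rangeRestrict
  obtain ⟨Q, hQ⟩ := (G ∘ₗ s).exists_extend
  refine ⟨Q, fun v => ?_⟩
  have h1 : Q (f v) = G (s (f.rangeRestrict v)) := LinearMap.congr_fun hQ (f.rangeRestrict v)
  rw [h1, ← sub_eq_zero, ← map_sub]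
  apply hG
  rw [map_sub, sub_eq_zero]
  exact congrArg Subtype.val (LinearMap.congr_fun hs (f.rangeRestrict v))

end Lift

/-! ### Projectors on one factor of a tensor product -/

section Tensor

variable {R G V W : Type*} [Field R] [CharP R 2] [Group G] [Finite G] [AddCommGroup V] [Module R V]
  [AddCommGroup W] [Module R W] {ρ : Representation R G V} {U : Subgroup G} {χ : G → R}

/-- The representation on `W ⊗ V` through the second factor. -/
noncomputable def lTensorRep (W : Type*) [AddCommGroup W] [Module R W] (ρ : Representation R G V) :
    Representation R G (W ⊗[R] V) where
  toFun g := (ρ g).lTensor W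
  map_one' := by rw [map_one]; exact LinearMap.lTensor_id W V
  map_mul' g h := by rw [_root_.map_mul]; exact LinearMap.lTensor_mul W _ _

/-- The representation on `V ⊗ W` through the first factor. -/
noncomputable def rTensorRep (W : Type*) [AddCommGroup W] [Module R W] (ρ : Representation R G V) :
    Representation R G (V ⊗[R] W) where
  toFun g := (ρ g).rTensor W
  map_one' := by rw [map_one]; exact LinearMap.rTensor_id W V
  map_mul' g h := by rw [_root_.map_mul]; exact LinearMap.rTensor_mul W _ _

omit [CharP R 2] in
lemma eigenProjector_lTensorRep :
    eigenProjector (lTensorRep W ρ) U χ = (eigenProjector ρ U χ).lTensor W := by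
  have h2 : ∀ f : V →ₗ[R] V, f.lTensor W = LinearMap.lTensorHom W f := fun f => rfl
  rw [eigenProjector, eigenProjector, h2, map_sum]
  simp only [map_smul]
  rfl

omit [CharP R 2] in
lemma eigenProjector_rTensorRep :
    eigenProjector (rTensorRep W ρ) U χ = (eigenProjector ρ U χ).rTensor W := by
  have h2 : ∀ f : V →ₗ[R] V, f.rTensor W = LinearMap.rTensorHom W f := fun f => rfl
  rw [eigenProjector, eigenProjector, h2, map_sum]
  simp only [map_smul]
  rfl

lemma lTensor_eigenProjector (hχ : IsCharOn U χ) (hU : Odd (Nat.card U)) {x : W ⊗[R] V}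
    (hx : ∀ u ∈ U, (ρ u).lTensor W x = χ u • x) :
    (eigenProjector ρ U χ).lTensor W x = x := by
  rw [← eigenProjector_lTensorRep]
  exact eigenProjector_apply_of_mem hχ hU hx

lemma rTensor_eigenProjector (hχ : IsCharOn U χ) (hU : Odd (Nat.card U)) {x : V ⊗[R] W}
    (hx : ∀ u ∈ U, (ρ u).rTensor W x = χ u • x) :
    (eigenProjector ρ U χ).rTensor W x = x := by
  rw [← eigenProjector_rTensorRep]
  exact eigenProjector_apply_of_mem hχ hU hx

end Tensor

/-! ### Which unipotent radicals have fixed vectors in `π × π` -/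

section Mackey

variable {k : Type*} [Field k] [Finite k] {n N : ℕ} {R : Type u} [Field R] [CharP R 2]
  {V : Type*} [AddCommGroup V] [Module R V] {π : Representation R (GL (Fin n) k) V}

/-- The space of the representation `π × π`. -/
noncomputable abbrev InducedSpace (h : n + n = N) (π : Representation R (GL (Fin n) k) V) :
    Submodule R (GL (Fin N) k → V ⊗[R] V) :=
  Representation.coindV (parabolic k h).subtype (inflation h π π)

omit [Finite k] [CharP R 2] in
lemma induced_apply_mul (h : n + n = N) {φ : GL (Fin N) k → V ⊗[R] V} (hφ : φ ∈ InducedSpace h π)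
    {q : GL (Fin N) k} {t₁ t₂ : GL (Fin n) k} (h21 : (blocks k h q.val).toBlocks₂₁ = 0)
    (h11 : (blocks k h q.val).toBlocks₁₁ = t₁.val) (h22 : (blocks k h q.val).toBlocks₂₂ = t₂.val)
    (g : GL (Fin N) k) : φ (q * g) = TensorProduct.map (π t₁) (π t₂) (φ g) := by
  have h1 : leviFst k h ⟨q, h21⟩ = t₁ := Units.ext h11
  have h2 : leviSnd k h ⟨q, h21⟩ = t₂ := Units.ext h22
  have := hφ ⟨q, h21⟩ g
  rw [Subgroup.coe_subtype] at this
  rw [this, inflation, Representation.tprod_apply, MonoidHom.comp_apply, MonoidHom.comp_apply,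
    h1, h2]

omit [Finite k] [CharP R 2] in
-- The hypotheses say that `g * u * g⁻¹` is block upper triangular with diagonal blocks `t₁` and
-- `t₂`; the map `E` is its upper right block.
lemma induced_apply_mul_right (h : n + n = N) {φ : GL (Fin N) k → V ⊗[R] V}
    (hφ : φ ∈ InducedSpace h π) {g u : GL (Fin N) k} {x : Matrix (Fin N) (Fin N) k}
    (hu : u.val = 1 + x) {t₁ t₂ : GL (Fin n) k} {E : (Fin n → k) →ₗ[k] (Fin n → k)}
    (h1 : ∀ v, upperRow h g.val (x.mulVec v)
      = (t₁.val - 1).mulVec (upperRow h g.val v) + E (lowerRow h g.val v))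
    (h2 : ∀ v, lowerRow h g.val (x.mulVec v) = (t₂.val - 1).mulVec (lowerRow h g.val v)) :
    φ (g * u) = TensorProduct.map (π t₁) (π t₂) (φ g) := by
  have hact : ∀ v, (g * u * g⁻¹).val.mulVec v = v + g.val.mulVec (x.mulVec ((g⁻¹).val.mulVec v)) := by
    intro v
    rw [Units.val_mul, Units.val_mul, hu, mul_add, mul_one, add_mul, Units.mul_inv,
      Matrix.add_mulVec, Matrix.one_mulVec, Matrix.mulVec_mulVec, Matrix.mulVec_mulVec]
  have hg : ∀ v, g.val.mulVec ((g⁻¹).val.mulVec v) = v := by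
    intro v
    rw [Matrix.mulVec_mulVec, Units.mul_inv, Matrix.one_mulVec]
  obtain ⟨h11, h21, h22⟩ := blocks_eq_of_halves (t₁ := t₁.val) (t₂ := t₂.val) (E := E) h
    (z := (g * u * g⁻¹).val)
    (fun v => by
      have := h1 ((g⁻¹).val.mulVec v)
      simp only [upperRow, lowerRow, LinearMap.comp_apply, Matrix.mulVecLin_apply, hg] at this
      rw [hact, map_add, this, Matrix.sub_mulVec, Matrix.one_mulVec]
      abel)
    (fun v => by
      have := h2 ((g⁻¹).val.mulVec v)
      simp only [lowerRow, LinearMap.comp_apply, Matrix.mulVecLin_apply, hg] at this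
      rw [hact, map_add, this, Matrix.sub_mulVec, Matrix.one_mulVec]
      abel)
  rw [← induced_apply_mul h hφ h21 h11 h22, inv_mul_cancel_right]

omit [CharP R 2] in
lemma induced_fixed (h : n + n = N) {φ : GL (Fin N) k → V ⊗[R] V} (hφ : φ ∈ InducedSpace h π)
    {Y : Submodule k (Fin N → k)} {g : GL (Fin N) k}
    (hY : ∀ u ∈ unipotentRadical Y, φ (g * u) = φ g)
    {x : Matrix (Fin N) (Fin N) k} (hx : x ∈ radical Y) {t₁ t₂ : GL (Fin n) k}
    {E : (Fin n → k) →ₗ[k] (Fin n → k)}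
    (h1 : ∀ v, upperRow h g.val (x.mulVec v)
      = (t₁.val - 1).mulVec (upperRow h g.val v) + E (lowerRow h g.val v))
    (h2 : ∀ v, lowerRow h g.val (x.mulVec v) = (t₂.val - 1).mulVec (lowerRow h g.val v)) :
    TensorProduct.map (π t₁) (π t₂) (φ g) = φ g := by
  obtain ⟨u, hu, huv⟩ := exists_one_add_radical hx
  rw [← induced_apply_mul_right h hφ huv h1 h2, hY u hu]

/-- Every `t` in the unipotent radical of the image `S` lifts to some `u` in that of `Y` such that
`g * u * g⁻¹` has diagonal blocks `1` and `t`. So `φ g` is fixed by this radical in the second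
tensor factor, and cuspidality kills it. -/
lemma apply_eq_zero_of_lowerRow (hπ : IsCuspidal π) (hk : ringChar k ≠ 2) (h : n + n = N)
    {φ : GL (Fin N) k → V ⊗[R] V} (hφ : φ ∈ InducedSpace h π)
    {Y : Submodule k (Fin N → k)} {g : GL (Fin N) k}
    (hY : ∀ u ∈ unipotentRadical Y, φ (g * u) = φ g)
    (h1 : Y.map (lowerRow h g.val) ≠ ⊥) (h2 : Y.map (lowerRow h g.val) ≠ ⊤) : φ g = 0 := by
  set S := Y.map (lowerRow h g.val) with hS
  rw [← lTensor_eigenProjector (ρ := π) (IsCharOn.const_one (unipotentRadical S))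
    (odd_card_unipotentRadical hk S) (x := φ g), hπ.eigenProjector_eq_zero hk h1 h2,
    LinearMap.lTensor_zero, LinearMap.zero_apply]
  intro t ht
  rw [one_smul]
  obtain ⟨Γ, hΓ, hΓ0⟩ := exists_lift (lowerRow h g.val ∘ₗ Y.subtype) (t.val - 1).mulVecLin
    (fun v => by
      rw [LinearMap.range_comp, Submodule.range_subtype]
      exact ht.1 v)
  have hx : LinearMap.toMatrix' (Y.subtype ∘ₗ Γ ∘ₗ lowerRow h g.val) ∈ radical Y := by
    refine ⟨fun v => ?_, fun v hv => ?_⟩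
    · rw [LinearMap.toMatrix'_mulVec]; exact Subtype.mem _
    · rw [LinearMap.toMatrix'_mulVec, LinearMap.comp_apply, LinearMap.comp_apply, hΓ0, map_zero]
      exact ht.2 _ (Submodule.mem_map_of_mem hv)
  have := induced_fixed h hφ hY hx (t₁ := 1) (t₂ := t)
    (E := upperRow h g.val ∘ₗ Y.subtype ∘ₗ Γ)
    (fun v => by
      rw [LinearMap.toMatrix'_mulVec, Units.val_one, sub_self, Matrix.zero_mulVec, zero_add]
      rfl)
    (fun v => by
      rw [LinearMap.toMatrix'_mulVec]
      exact hΓ _)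
  rw [map_one] at this
  exact this

/-- The counterpart for the first tensor factor, where only vectors of `Y` with zero lower half
after applying `g` are available. -/
lemma apply_eq_zero_of_upperRow (hπ : IsCuspidal π) (hk : ringChar k ≠ 2) (h : n + n = N)
    {φ : GL (Fin N) k → V ⊗[R] V} (hφ : φ ∈ InducedSpace h π)
    {Y : Submodule k (Fin N → k)} {g : GL (Fin N) k}
    (hY : ∀ u ∈ unipotentRadical Y, φ (g * u) = φ g)
    (h1 : (Y ⊓ LinearMap.ker (lowerRow h g.val)).map (upperRow h g.val) ≠ ⊥)
    (h2 : (Y ⊓ LinearMap.ker (lowerRow h g.val)).map (upperRow h g.val) ≠ ⊤) : φ g = 0 := by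
  set Z := Y ⊓ LinearMap.ker (lowerRow h g.val) with hZ
  set S := Z.map (upperRow h g.val) with hS
  rw [← rTensor_eigenProjector (ρ := π) (IsCharOn.const_one (unipotentRadical S))
    (odd_card_unipotentRadical hk S) (x := φ g), hπ.eigenProjector_eq_zero hk h1 h2,
    LinearMap.rTensor_zero, LinearMap.zero_apply]
  intro t ht
  rw [one_smul]
  obtain ⟨Γ, hΓ, hΓ0⟩ := exists_lift (upperRow h g.val ∘ₗ Z.subtype) (t.val - 1).mulVecLin
    (fun v => by
      rw [LinearMap.range_comp, Submodule.range_subtype]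
      exact ht.1 v)
  -- The lift alone need not vanish on `Y`. Subtracting a map which factors through the lower half
  -- corrects this and affects only the upper right block.
  obtain ⟨Q, hQ⟩ := exists_factor (lowerRow h g.val ∘ₗ Y.subtype)
    (Γ ∘ₗ upperRow h g.val ∘ₗ Y.subtype) (fun v hv => hΓ0 _ (ht.2 _
      (Submodule.mem_map_of_mem ⟨v.2, hv⟩)))
  have hlow : ∀ z : Z, lowerRow h g.val z = 0 := fun z => z.2.2
  have hx : LinearMap.toMatrix' (Z.subtype ∘ₗ (Γ ∘ₗ upperRow h g.val - Q ∘ₗ lowerRow h g.val))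
      ∈ radical Y := by
    refine ⟨fun v => ?_, fun v hv => ?_⟩
    · rw [LinearMap.toMatrix'_mulVec]
      exact ((Γ ∘ₗ upperRow h g.val - Q ∘ₗ lowerRow h g.val) v).2.1
    · rw [LinearMap.toMatrix'_mulVec, LinearMap.comp_apply, LinearMap.sub_apply]
      have := hQ ⟨v, hv⟩
      simp only [LinearMap.comp_apply, Submodule.subtype_apply] at this ⊢
      rw [this, sub_self]
      rfl
  have := induced_fixed h hφ hY hx (t₁ := t) (t₂ := 1)
    (E := -(upperRow h g.val ∘ₗ Z.subtype ∘ₗ Q))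
    (fun v => by
      rw [LinearMap.toMatrix'_mulVec, LinearMap.comp_apply, LinearMap.sub_apply, map_sub, map_sub,
        sub_eq_add_neg]
      congr 1
      exact hΓ _)
    (fun v => by
      rw [LinearMap.toMatrix'_mulVec, Units.val_one, sub_self, Matrix.zero_mulVec]
      exact hlow ((Γ ∘ₗ upperRow h g.val - Q ∘ₗ lowerRow h g.val) v))
  rw [map_one] at this
  exact this

/-- The vectors of `π × π` which are fixed by the unipotent radical of a maximal parabolic subgroup
of size different from `(n, n)` are zero. -/
theorem apply_eq_zero_of_initial (hπ : IsCuspidal π) (hk : ringChar k ≠ 2) (h : n + n = N)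
    {φ : GL (Fin N) k → V ⊗[R] V} (hφ : φ ∈ InducedSpace h π) {a : ℕ} (ha : 0 < a) (haN : a < N)
    (han : a ≠ n) {g : GL (Fin N) k}
    (hY : ∀ u ∈ unipotentRadical (initial k N a), φ (g * u) = φ g) : φ g = 0 := by
  set Y := initial k N a with hYdef
  by_contra hφg
  have h1 : Y.map (lowerRow h g.val) = ⊥ ∨ Y.map (lowerRow h g.val) = ⊤ := by
    by_contra! hc
    exact hφg (apply_eq_zero_of_lowerRow hπ hk h hφ hY hc.1 hc.2)
  have h2 : (Y ⊓ LinearMap.ker (lowerRow h g.val)).map (upperRow h g.val) = ⊥ ∨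
      (Y ⊓ LinearMap.ker (lowerRow h g.val)).map (upperRow h g.val) = ⊤ := by
    by_contra! hc
    exact hφg (apply_eq_zero_of_upperRow hπ hk h hφ hY hc.1 hc.2)
  have hd : ∀ S : Submodule k (Fin n → k), S = ⊥ ∨ S = ⊤ →
      Module.finrank k S = 0 ∨ Module.finrank k S = n := by
    rintro S (rfl | rfl)
    · exact Or.inl (finrank_bot _ _)
    · right; rw [finrank_top, Module.finrank_fin_fun]
  have h3 := hd _ h1
  have h4 := hd _ h2
  have h5 : Module.finrank k ((Y ⊓ LinearMap.ker (lowerRow h g.val)).map (upperRow h g.val))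
      = Module.finrank k (Y ⊓ LinearMap.ker (lowerRow h g.val) : Submodule k (Fin N → k)) := by
    rw [← LinearMap.range_domRestrict]
    refine LinearMap.finrank_range_of_inj ?_
    rw [injective_iff_map_eq_zero]
    exact fun v hv => Subtype.ext (eq_zero_of_rows h hv v.2.2)
  -- By rank-nullity `a` is the sum of two dimensions, each equal to `0` or `n`, so `a` would be
  -- `0`, `n` or `2 n`.
  have h6 := LinearMap.finrank_range_add_finrank_ker (lowerRow h g.val ∘ₗ Y.subtype)
  rw [LinearMap.range_comp, Submodule.range_subtype, LinearMap.ker_comp,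
    finrank_initial haN.le] at h6
  have h7 : Module.finrank k ((LinearMap.ker (lowerRow h g.val)).comap Y.subtype)
      = Module.finrank k (Y ⊓ LinearMap.ker (lowerRow h g.val) : Submodule k (Fin N → k)) := by
    rw [← Submodule.finrank_map_subtype_eq Y, Submodule.map_comap_subtype]
  omega

end Mackey

/-! ### Irreducible quotients of a representation with an involution -/

section Abstract

variable {R G I E W M : Type*} [Field R] [CharP R 2] [Group G] [Finite G] [AddCommGroup I]
  [Module R I] [AddCommGroup E] [Module R E] [AddCommGroup W] [Module R W]

omit [CharP R 2] in
/-- A subspace of `E × E` which contains a nonzero vector and is stable under the diagonal action of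
all endomorphisms contains either `E × 0`, or a line of `R × R` tensored with `E`. -/
lemma forall_mem_of_diagonal_stable {S : Submodule R (E × E)}
    (hS : ∀ A : Module.End R E, ∀ x ∈ S, (A x.1, A x.2) ∈ S) {x : E × E} (hx : x ∈ S)
    (hx0 : x ≠ 0) :
    (∀ v, (v, (0 : E)) ∈ S) ∨ ∃ α β : R, (α ≠ 0 ∨ β ≠ 0) ∧ ∀ v, (α • v, β • v) ∈ S := by
  obtain ⟨a, b⟩ := x
  have key : ∀ {y : E}, y ≠ 0 → ∀ v, ∃ A : Module.End R E, A y = v := fun {y} hy v => by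
    obtain ⟨lam, hlam⟩ := Module.Projective.exists_dual_ne_zero R hy
    exact ⟨lam.smulRight ((lam y)⁻¹ • v), by
      rw [LinearMap.smulRight_apply, smul_smul, mul_inv_cancel₀ hlam, one_smul]⟩
  -- If the components are independent, some endomorphism kills `b` and sends `a` to any given
  -- vector; otherwise the pair is a line of `R × R` tensored with one vector.
  by_cases hli : LinearIndependent R ![b, a]
  · left
    intro v
    have hb : b ≠ 0 := hli.ne_zero 0
    have ha : a ∉ Submodule.span R {b} := by
      have h1 := (LinearIndependent.pair_iff' hb).1 hli
      rw [Submodule.mem_span_singleton]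
      rintro ⟨c, hc⟩
      exact h1 c hc
    obtain ⟨lam, hlam, hlam'⟩ := Submodule.exists_le_ker_of_notMem ha
    have h2 := hS (lam.smulRight ((lam a)⁻¹ • v)) _ hx
    have h3 : lam b = 0 := hlam' (Submodule.mem_span_singleton_self b)
    simp only [LinearMap.smulRight_apply] at h2
    rw [smul_smul, mul_inv_cancel₀ hlam, one_smul, h3, zero_smul] at h2
    exact h2
  · right
    have h1 : ∃ (α β : R) (y : E), y ≠ 0 ∧ (α ≠ 0 ∨ β ≠ 0) ∧ a = α • y ∧ b = β • y := by
      by_cases hb : b = 0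
      · exact ⟨1, 0, a, fun ha => hx0 (by rw [ha, hb]; rfl), Or.inl one_ne_zero,
          (one_smul _ _).symm, by rw [zero_smul, hb]⟩
      · rw [LinearIndependent.pair_iff' hb] at hli
        push Not at hli
        obtain ⟨c, hc⟩ := hli
        exact ⟨c, 1, b, hb, Or.inr one_ne_zero, hc.symm, (one_smul _ _).symm⟩
    obtain ⟨α, β, y, hy, hαβ, rfl, rfl⟩ := h1
    refine ⟨α, β, hαβ, fun v => ?_⟩
    obtain ⟨A, rfl⟩ := key hy v
    have := hS A _ hx
    simp only [map_smul] at this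
    exact this

variable {ρ : Representation R G I} {τ : Representation R G W}

/-- An irreducible quotient of an induced representation carrying an involution `T` kills the
fixed vectors of `T`. -/
theorem map_eq_zero_of_involution {U : Subgroup G} (hU : Odd (Nat.card U))
    {T : Module.End R I} (hT : ∀ g φ, T (ρ g φ) = ρ g (T φ))
    {j : E →ₗ[R] I} (hjU : ∀ v, j v ∈ eigenvectors ρ U (fun _ => 1))
    (hTT : ∀ v, T (T (j v)) = j v)
    (hind : ∀ v w, j v = T (j w) → v = 0)
    (hgen : ∀ φ ∈ eigenvectors ρ U (fun _ => 1), ∃ a b, φ = j a + T (j b))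
    (hspan : ∀ S : Submodule R I, (∀ g, ∀ φ ∈ S, ρ g φ ∈ S) → (∀ v, j v ∈ S) → S = ⊤)
    {L : M → G} {σ : M → Module.End R E} (hL : ∀ m v, ρ (L m) (j v) = j (σ m v))
    (hσ : Submodule.span R (Set.range σ) = ⊤) (hτ : τ.IsIrreducible)
    (f : ρ.IntertwiningMap τ) {φ : I} (hφ : T φ = φ) : f φ = 0 := by
  by_contra hfφ
  have hχ : IsCharOn U (fun _ : G => (1 : R)) := IsCharOn.const_one U
  have hff : ∀ g φ, f (ρ g φ) = τ g (f φ) := fun g φ => f.isIntertwining _ _ g φ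
  let K : Submodule R I := LinearMap.ker f.toLinearMap
  have hK : ∀ x, x ∈ K ↔ f x = 0 := fun x => Iff.rfl
  have hKG : ∀ g, ∀ x ∈ K, ρ g x ∈ K := fun g x hx => by
    rw [hK] at hx ⊢
    rw [hff, hx, map_zero]
  have hKtop : K ≠ ⊤ := fun h => hfφ ((hK φ).1 (h ▸ Submodule.mem_top))
  have hTT' : ∀ x, T (T x) = x := by
    have := hspan (LinearMap.eqLocus (T * T) 1) (fun g x hx => by
      change T (T _) = _ at hx ⊢
      rw [hT, hT, hx]
      rfl) hTT
    intro x
    have hx : x ∈ LinearMap.eqLocus (T * T) 1 := this ▸ Submodule.mem_top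
    exact hx
  -- By irreducibility, a single surviving vector fixed by `T` makes the fixed vectors of `T`
  -- surject onto the quotient.
  have hfix : ((LinearMap.eqLocus T 1).map f.toLinearMap) = ⊤ := by
    refine subrep_eq_top hτ _ ?_ (v := f φ) ⟨φ, hφ, rfl⟩ hfφ
    rintro g _ ⟨x, hx, rfl⟩
    refine ⟨ρ g x, ?_, hff g x⟩
    change T (ρ g x) = ρ g x
    rw [hT]
    exact congrArg _ hx
  -- Lift `f (j v)` to a vector fixed by `T` and average it over `U`. It then has the form `j a + T
  -- (j b)`, and being fixed by `T` forces `a = b`.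
  have hrep : ∀ v, ∃ a, f (j v) = f (j a + T (j a)) := by
    intro v
    have h1 : f (j v) ∈ (LinearMap.eqLocus T 1).map f.toLinearMap := hfix ▸ Submodule.mem_top
    obtain ⟨y, hy, hyv⟩ := h1
    change T y = y at hy
    change f y = f (j v) at hyv
    have h2 : ∀ x, f (eigenProjector ρ U (fun _ => 1) x) = eigenProjector τ U (fun _ => 1) (f x) :=
      map_eigenProjector (U := U) (χ := fun _ => 1) (σ := τ) f.toLinearMap
        (fun u _ v => hff u v)
    have h3 : T (eigenProjector ρ U (fun _ => 1) y) = eigenProjector ρ U (fun _ => 1) y := by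
      rw [map_eigenProjector (U := U) (χ := fun _ => 1) (σ := ρ) T (fun u _ v => hT u v), hy]
    obtain ⟨a, b, hab⟩ := hgen _ (eigenProjector_mem hχ y)
    have h4 : f (j v) = f (j a + T (j b)) := by
      rw [← hab, h2, hyv, ← h2, eigenProjector_apply_of_mem hχ hU (hjU v)]
    have h5 : a = b := by
      rw [hab, map_add, hTT'] at h3
      rw [← sub_eq_zero]
      apply hind _ (a - b)
      rw [map_sub, map_sub, sub_eq_sub_iff_add_eq_add, h3]
    exact ⟨a, by rw [h4, h5]⟩
  -- The relations `f (j a + T (j b)) = 0` form a subspace stable under the diagonal action of all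
  -- of `End E`, because the image of `σ` spans it.
  let S : Submodule R (E × E) := K.comap (j.coprod (T ∘ₗ j))
  have hS : ∀ x, x ∈ S ↔ f (j x.1 + T (j x.2)) = 0 := fun x => Iff.rfl
  have hSst : ∀ A : Module.End R E, ∀ x ∈ S, (A x.1, A x.2) ∈ S := by
    let 𝒮 : Submodule R (Module.End R E) :=
      { carrier := {A | ∀ x ∈ S, (A x.1, A x.2) ∈ S}
        add_mem' := fun {A B} hA hB x hx => S.add_mem (hA x hx) (hB x hx)
        zero_mem' := fun x _ => S.zero_mem
        smul_mem' := fun c A hA x hx => S.smul_mem c (hA x hx) }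
    have : 𝒮 = ⊤ := by
      rw [eq_top_iff, ← hσ, Submodule.span_le]
      rintro _ ⟨m, rfl⟩ x hx
      rw [hS] at hx ⊢
      simp only
      rw [← hL, ← hL, hT, ← map_add, hff, hx, map_zero]
    intro A
    have hA : A ∈ 𝒮 := this ▸ Submodule.mem_top
    exact hA
  have hj : ¬ ∀ v, f (j v) = 0 := fun h => hKtop (hspan K hKG h)
  obtain ⟨v, hv⟩ : ∃ v, f (j v) ≠ 0 := by
    by_contra! h
    exact hj h
  obtain ⟨a, ha⟩ := hrep v
  have hmem : (v - a, -a) ∈ S := by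
    rw [hS, map_sub, map_neg, map_neg, map_add, map_sub, map_neg, ha, map_add]
    abel
  have hne : (v - a, -a) ≠ (0 : E × E) := fun h => by
    obtain ⟨h1, h2⟩ := Prod.mk_eq_zero.1 h
    rw [neg_eq_zero.1 h2, sub_zero] at h1
    exact hv (by rw [h1, map_zero, map_zero])
  rcases forall_mem_of_diagonal_stable hSst hmem hne with h | ⟨α, β, hαβ, h⟩
  · apply hj
    intro v
    have := (hS _).1 (h v)
    simpa using this
  · have h1 : ∀ x, f (α • x + β • T x) = 0 := by
      have := hspan (K.comap (α • 1 + β • T)) (fun g x hx => by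
        change f (α • ρ g x + β • T (ρ g x)) = 0
        change f (α • x + β • T x) = 0 at hx
        rw [hT, ← map_smul, ← map_smul, ← map_add, hff, hx, map_zero]) (fun v => by
          have := (hS _).1 (h v)
          simp only [map_smul] at this
          exact this)
      intro x
      have hx : x ∈ K.comap (α • 1 + β • T) := this ▸ Submodule.mem_top
      exact hx
    -- If `α = β`, then `f` kills every `x + T x`, hence `j v` by `hrep`. Otherwise `(α + β T)² = (α
    -- + β)²` in characteristic two, so `α + β T` is invertible and `f` vanishes on all `j v`.
    by_cases hαβ' : α = β
    · subst hαβ'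
      apply hj
      intro v
      obtain ⟨a, ha⟩ := hrep v
      have h2 := h1 (j a)
      rw [← smul_add, map_smul, smul_eq_zero] at h2
      rw [ha]
      exact h2.resolve_left (by tauto)
    · apply hj
      intro v
      have h2 := h1 (α • j v + β • T (j v))
      have h3 : α • (α • j v + β • T (j v)) + β • T (α • j v + β • T (j v))
          = (α + β) ^ 2 • j v := by
        rw [map_add, map_smul, map_smul, hTT', CharTwo.add_sq, smul_add, smul_add, smul_smul,
          smul_smul, smul_smul, smul_smul, add_smul, pow_two, pow_two, mul_comm β α]
        have h4 : (α * β) • T (j v) + (α * β) • T (j v) = 0 := by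
          rw [← add_smul, CharTwo.add_self_eq_zero, zero_smul]
        calc _ = (α * α) • j v + ((α * β) • T (j v) + (α * β) • T (j v)) + (β * β) • j v := by abel
          _ = _ := by rw [h4, add_zero]
      rw [h3, map_smul, smul_eq_zero] at h2
      refine h2.resolve_left (pow_ne_zero 2 fun h5 => hαβ' ?_)
      rw [← CharTwo.sub_eq_add, sub_eq_zero] at h5
      exact h5

end Abstract

/-! ### The closed and the open cell for the parabolic of size `(n, n)` -/

section Cells

variable {k : Type*} [Field k] {n N : ℕ}

/-- The block permutation matrix which exchanges the two halves. -/
noncomputable def blockSwap (k : Type*) [Field k] (h : n + n = N) : GL (Fin N) k :=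
  ofBlocks h (Matrix.fromBlocks 0 1 1 0) (Matrix.fromBlocks 0 1 1 0)
    (by simp [Matrix.fromBlocks_multiply])

lemma blocks_blockSwap (h : n + n = N) :
    blocks k h (blockSwap k h).val = Matrix.fromBlocks 0 1 1 0 :=
  blocks_ofBlocks _ _ _ _

lemma blockSwap_mul_self (h : n + n = N) : blockSwap k h * blockSwap k h = 1 := by
  apply ext_blocks h
  rw [Units.val_mul, map_mul, blocks_blockSwap, Units.val_one, map_one]
  simp [Matrix.fromBlocks_multiply]

/-- The block unipotent matrix with off-diagonal block `y`. -/
noncomputable def shear (h : n + n = N) (y : Matrix (Fin n) (Fin n) k) : GL (Fin N) k :=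
  ofBlocks h (Matrix.fromBlocks 1 y 0 1) (Matrix.fromBlocks 1 (-y) 0 1)
    (by simp [Matrix.fromBlocks_multiply])

lemma blocks_shear (h : n + n = N) (y : Matrix (Fin n) (Fin n) k) :
    blocks k h (shear h y).val = Matrix.fromBlocks 1 y 0 1 :=
  blocks_ofBlocks _ _ _ _

lemma shear_zero (h : n + n = N) : shear h (0 : Matrix (Fin n) (Fin n) k) = 1 := by
  apply ext_blocks h
  rw [blocks_shear, Units.val_one, map_one, Matrix.fromBlocks_one]

lemma blocks_inv_blockSwap_mul_shear (h : n + n = N) (z : Matrix (Fin n) (Fin n) k) :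
    blocks k h (blockSwap k h * shear h z)⁻¹.val = Matrix.fromBlocks (-z) 1 1 0 := by
  have : (blockSwap k h * shear h z)⁻¹ = shear h (-z) * blockSwap k h := by
    rw [mul_inv_rev, inv_eq_of_mul_eq_one_right (blockSwap_mul_self h)]
    congr 1
    apply inv_eq_of_mul_eq_one_right
    apply ext_blocks h
    rw [Units.val_mul, map_mul, blocks_shear, blocks_shear, Units.val_one, map_one]
    simp [Matrix.fromBlocks_multiply]
  rw [this, Units.val_mul, map_mul, blocks_blockSwap, blocks_shear]
  simp [Matrix.fromBlocks_multiply]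

/-- This turns the Mackey criterion into one on the lower left block of `g`: it is zero on the
parabolic and invertible on the big cell. -/
lemma map_lowerRow_initial (h : n + n = N) (g : Matrix (Fin N) (Fin N) k) :
    (initial k N n).map (lowerRow h g) = LinearMap.range (blocks k h g).toBlocks₂₁.mulVecLin := by
  subst h
  have key : ∀ v ∈ initial k (n + n) n, lowerRow rfl g v
      = (blocks k rfl g).toBlocks₂₁.mulVec (fun j => v (Fin.castAdd n j)) := by
    intro v hv
    ext i
    change (∑ j, g (Fin.natAdd n i) j * v j) = ∑ j : Fin n, _
    rw [Fin.sum_univ_add, add_eq_left.2]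
    · rfl
    · refine Finset.sum_eq_zero fun j _ => ?_
      rw [hv _ (Nat.le_add_right _ _), mul_zero]
  ext x
  constructor
  · rintro ⟨v, hv, rfl⟩
    rw [key v hv]
    exact ⟨_, rfl⟩
  · rintro ⟨v, rfl⟩
    refine ⟨Fin.append v 0, fun i hi => ?_, ?_⟩
    · obtain ⟨j, rfl⟩ : ∃ j : Fin n, i = Fin.natAdd n j :=
        ⟨⟨i.val - n, by omega⟩, Fin.ext (by simp; omega)⟩
      rw [Fin.append_right]
      rfl
    · rw [key]
      · congr 1
        ext j
        rw [Fin.append_left]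
      · intro i hi
        obtain ⟨j, rfl⟩ : ∃ j : Fin n, i = Fin.natAdd n j :=
          ⟨⟨i.val - n, by omega⟩, Fin.ext (by simp; omega)⟩
        rw [Fin.append_right]
        rfl

lemma range_mulVecLin_eq_bot {c : Matrix (Fin n) (Fin n) k} :
    LinearMap.range c.mulVecLin = ⊥ ↔ c = 0 := by
  rw [LinearMap.range_eq_bot]
  constructor
  · intro h
    refine Matrix.ext_of_mulVec_single fun i => ?_
    rw [Matrix.zero_mulVec, ← Matrix.mulVecLin_apply, h]
    rfl
  · rintro rfl
    exact Matrix.mulVecLin_zero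

lemma range_mulVecLin_eq_top {c : Matrix (Fin n) (Fin n) k} :
    LinearMap.range c.mulVecLin = ⊤ ↔ IsUnit c := by
  rw [LinearMap.range_eq_top, ← Matrix.mulVec_surjective_iff_isUnit]
  rfl

variable [Finite k]

lemma shear_mem (h : n + n = N) (y : Matrix (Fin n) (Fin n) k) :
    shear h y ∈ unipotentRadical (initial k N n) := by
  rw [mem_unipotent]
  apply mem_radical_of_blocks h (y := y)
  rw [map_sub, map_one, blocks_shear, ← Matrix.fromBlocks_one, sub_eq_iff_eq_add,
    Matrix.fromBlocks_add]
  simp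

omit [Finite k] in
-- With lower blocks `c` and `d` of `g`, take `z = c⁻¹ d`.
lemma exists_big_cell (h : n + n = N) (g : GL (Fin N) k)
    (hg : IsUnit (blocks k h g.val).toBlocks₂₁) :
    ∃ (q : parabolic k h) (z : Matrix (Fin n) (Fin n) k), g = q * (blockSwap k h * shear h z) := by
  obtain ⟨c, hc⟩ := hg
  let z := c⁻¹.val * (blocks k h g.val).toBlocks₂₂
  refine ⟨⟨g * (blockSwap k h * shear h z)⁻¹, ?_⟩, z, (inv_mul_cancel_right _ _).symm⟩
  change (blocks k h (g * (blockSwap k h * shear h z)⁻¹ : GL (Fin N) k).val).toBlocks₂₁ = 0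
  rw [Units.val_mul, map_mul, blocks_inv_blockSwap_mul_shear,
    ← Matrix.fromBlocks_toBlocks (blocks k h g.val), Matrix.fromBlocks_multiply,
    Matrix.toBlocks_fromBlocks₂₁, ← hc, Matrix.mul_neg, ← mul_assoc, Units.mul_inv, one_mul,
    mul_one, neg_add_cancel]

end Cells

/-! ### Triviality of `-1` in characteristic two -/

section NegOne

variable {k : Type*} [Field k] {n : ℕ} {R : Type*} [Field R] [CharP R 2]
  {V : Type*} [AddCommGroup V] [Module R V] {π : Representation R (GL (Fin n) k) V}

/-- In characteristic two, `-1` acts trivially on irreducible representations. -/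
lemma apply_neg_one (hπ : π.IsIrreducible) : π (-1) = 1 := by
  have key : ∀ v, π (-1) (π (-1) v) = v := fun v => by
    rw [← rep_mul_apply, neg_mul_neg, one_mul, map_one, Module.End.one_apply]
  have hc : ∀ v : V, v + v = 0 := fun v => by
    rw [← two_smul R, CharTwo.two_eq_zero, zero_smul]
  let S : Submodule R V := LinearMap.eqLocus (π (-1)) 1
  have hS : ∃ v ∈ S, v ≠ 0 := by
    obtain ⟨v, hv⟩ := exists_ne_zero_of_irreducible hπ
    -- As `π (-1)` is an involution, `π (-1) v + v` is always fixed; if it is zero, then `v` itself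
    -- is fixed since signs do not matter.
    by_cases h : π (-1) v + v = 0
    · refine ⟨v, ?_, hv⟩
      change π (-1) v = v
      rw [← sub_eq_zero, ← h, sub_eq_add_neg, neg_eq_of_add_eq_zero_left (hc v)]
    · refine ⟨_, ?_, h⟩
      change π (-1) (π (-1) v + v) = π (-1) v + v
      rw [map_add, key, add_comm]
  obtain ⟨v, hv, hv0⟩ := hS
  have := subrep_eq_top hπ S (fun g v hv => by
    change π (-1) (π g v) = π g v
    change π (-1) v = v at hv
    rw [← rep_mul_apply, neg_one_mul, ← mul_neg_one, rep_mul_apply, hv]) hv hv0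
  ext v
  have h : v ∈ S := this ▸ Submodule.mem_top
  exact h

lemma apply_neg (hπ : π.IsIrreducible) (g : GL (Fin n) k) : π (-g) = π g := by
  rw [← neg_one_mul, _root_.map_mul, apply_neg_one hπ, one_mul]

end NegOne

/-! ### The standard intertwining operator -/

section Induced

variable {k : Type*} [Field k] [Finite k] {n N : ℕ} {R : Type u} [Field R]
  {V : Type*} [AddCommGroup V] [Module R V] {π : Representation R (GL (Fin n) k) V}

/-- A function in the space of `π × π` which is invariant under the unipotent radical and
vanishes at `1` and at the block permutation matrix is zero. -/
lemma apply_eq_zero_of_invariant [CharP R 2] (hπ : IsCuspidal π) (hk : ringChar k ≠ 2)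
    (h : n + n = N) {φ : GL (Fin N) k → V ⊗[R] V} (hφ : φ ∈ InducedSpace h π)
    (hY : ∀ u ∈ unipotentRadical (initial k N n), ∀ g, φ (g * u) = φ g) (h1 : φ 1 = 0)
    (hw : φ (blockSwap k h) = 0) (g : GL (Fin N) k) : φ g = 0 := by
  by_contra hg
  have h2 : (initial k N n).map (lowerRow h g.val) = ⊥ ∨
      (initial k N n).map (lowerRow h g.val) = ⊤ := by
    by_contra! hc
    exact hg (apply_eq_zero_of_lowerRow hπ hk h hφ (fun u hu => hY u hu g) hc.1 hc.2)
  rw [map_lowerRow_initial, range_mulVecLin_eq_bot, range_mulVecLin_eq_top] at h2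
  rcases h2 with h2 | h2
  · have := hφ ⟨g, h2⟩ 1
    rw [Subgroup.coe_subtype, mul_one, h1, map_zero] at this
    exact hg this
  · obtain ⟨q, z, rfl⟩ := exists_big_cell h g h2
    have := hφ q (blockSwap k h * shear h z)
    rw [Subgroup.coe_subtype, hY _ (shear_mem h z), hw, map_zero] at this
    exact hg this

/-- The standard intertwining operator on functions. -/
noncomputable def intertwiner (h : n + n = N) :
    (GL (Fin N) k → V ⊗[R] V) →ₗ[R] (GL (Fin N) k → V ⊗[R] V) :=
  letI := Fintype.ofFinite (Matrix (Fin n) (Fin n) k)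
  LinearMap.pi fun g => ∑ y : Matrix (Fin n) (Fin n) k,
    (TensorProduct.comm R V V).toLinearMap ∘ₗ LinearMap.proj (blockSwap k h * shear h y * g)

lemma intertwiner_apply [Fintype (Matrix (Fin n) (Fin n) k)] (h : n + n = N)
    (φ : GL (Fin N) k → V ⊗[R] V) (g : GL (Fin N) k) :
    intertwiner h φ g = ∑ y : Matrix (Fin n) (Fin n) k,
      TensorProduct.comm R V V (φ (blockSwap k h * shear h y * g)) := by
  simp only [intertwiner, LinearMap.pi_apply, LinearMap.sum_apply, LinearMap.comp_apply,
    LinearMap.proj_apply, LinearEquiv.coe_coe]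
  congr!

omit [Finite k] in
lemma blocks_parabolic (h : n + n = N) (q : parabolic k h) :
    blocks k h q.1.val = Matrix.fromBlocks (leviFst k h q).val
      (blocks k h q.1.val).toBlocks₁₂ 0 (leviSnd k h q).val := by
  conv_lhs => rw [← Matrix.fromBlocks_toBlocks (blocks k h q.1.val)]
  congr 1
  exact q.2

/-- Moving an element of the parabolic to the left past the block swap permutes the shears and
exchanges the two diagonal blocks; the flip of the tensor factors restores their order. -/
lemma intertwiner_mem (h : n + n = N) {φ : GL (Fin N) k → V ⊗[R] V}
    (hφ : φ ∈ InducedSpace h π) : intertwiner h φ ∈ InducedSpace h π := by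
  intro q g
  let _ := Fintype.ofFinite (Matrix (Fin n) (Fin n) k)
  rw [intertwiner_apply, intertwiner_apply, map_sum]
  set t₁ := leviFst k h q with ht₁
  set t₂ := leviSnd k h q with ht₂
  set x := (blocks k h q.1.val).toBlocks₁₂ with hx
  let e : Matrix (Fin n) (Fin n) k ≃ Matrix (Fin n) (Fin n) k :=
    { toFun := fun y => t₁⁻¹.val * (x + y * t₂.val)
      invFun := fun z => (t₁.val * z - x) * t₂⁻¹.val
      left_inv := fun y => by
        simp only
        rw [← mul_assoc, Units.mul_inv, one_mul, add_sub_cancel_left, mul_assoc, Units.mul_inv,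
          mul_one]
      right_inv := fun z => by
        simp only
        rw [mul_assoc, Units.inv_mul, mul_one, add_sub_cancel, ← mul_assoc, Units.inv_mul,
          one_mul] }
  refine Fintype.sum_equiv e _ _ fun y => ?_
  have h1 : blockSwap k h * shear h y * q.1
      = blockDiag h t₂ t₁ * (blockSwap k h * shear h (e y)) := by
    apply ext_blocks h
    simp only [Units.val_mul, map_mul]
    rw [blocks_blockSwap, blocks_shear, blocks_shear, blocks_blockDiag, blocks_parabolic h q]
    simp only [Matrix.fromBlocks_multiply, ← ht₁, ← ht₂, ← hx, e, Equiv.coe_fn_mk]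
    simp only [Matrix.zero_mul, Matrix.mul_zero, Matrix.one_mul, Matrix.mul_one, add_zero,
      zero_add, ← mul_assoc, Units.mul_inv]
  have h2 : φ (blockSwap k h * shear h y * (q.1 * g))
      = TensorProduct.map (π t₂) (π t₁) (φ (blockSwap k h * shear h (e y) * g)) := by
    rw [← mul_assoc, h1, mul_assoc (blockDiag h t₂ t₁)]
    apply induced_apply_mul h hφ <;> rw [blocks_blockDiag]
    · rfl
    · rfl
    · rfl
  rw [Subgroup.coe_subtype, h2, inflation, Representation.tprod_apply]
  generalize φ _ = a
  change _ = TensorProduct.map (π t₁) (π t₂) (TensorProduct.comm R V V a)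
  rw [TensorProduct.map_comm]

/-- All terms are equal, and their number is odd. -/
lemma intertwiner_one [CharP R 2] (hk : ringChar k ≠ 2) (h : n + n = N)
    {φ : GL (Fin N) k → V ⊗[R] V}
    (hY : ∀ u ∈ unipotentRadical (initial k N n), ∀ g, φ (g * u) = φ g) :
    intertwiner h φ 1 = TensorProduct.comm R V V (φ (blockSwap k h)) := by
  let _ := Fintype.ofFinite (Matrix (Fin n) (Fin n) k)
  rw [intertwiner_apply]
  simp only [mul_one, hY _ (shear_mem h _), Finset.sum_const, Finset.card_univ,
    ← Nat.card_eq_fintype_card]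
  obtain ⟨m, hm⟩ := odd_card_module hk (Matrix (Fin n) (Fin n) k)
  rw [hm, ← Nat.cast_smul_eq_nsmul R]
  push_cast
  rw [CharTwo.two_eq_zero, zero_mul, zero_add, one_smul]

/-- The term `y = 0` gives the stated value; the terms for `y` and `-y` are equal and cancel in
characteristic two. -/
lemma intertwiner_blockSwap [CharP R 2] (hπ : IsCuspidal π) (hk : ringChar k ≠ 2) (h : n + n = N)
    {φ : GL (Fin N) k → V ⊗[R] V} (hφ : φ ∈ InducedSpace h π)
    (hY : ∀ u ∈ unipotentRadical (initial k N n), ∀ g, φ (g * u) = φ g) :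
    intertwiner h φ (blockSwap k h) = TensorProduct.comm R V V (φ 1) := by
  classical
  let _ := Fintype.ofFinite (Matrix (Fin n) (Fin n) k)
  rw [intertwiner_apply, ← Finset.add_sum_erase _ _ (Finset.mem_univ 0), shear_zero, mul_one,
    blockSwap_mul_self, add_eq_left]
  have hneg : ∀ y : Matrix (Fin n) (Fin n) k, y ≠ 0 →
      φ (blockSwap k h * shear h (-y) * blockSwap k h)
        = φ (blockSwap k h * shear h y * blockSwap k h) := by
    intro y hy
    have hb : ∀ z : Matrix (Fin n) (Fin n) k,
        blocks k h (blockSwap k h * shear h z * blockSwap k h).val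
          = Matrix.fromBlocks 1 0 z 1 := fun z => by
      simp only [Units.val_mul, map_mul]
      rw [blocks_blockSwap, blocks_shear]
      simp [Matrix.fromBlocks_multiply]
    by_cases hu : IsUnit y
    · have hz : ∀ z : GL (Fin n) k, φ (blockSwap k h * shear h z.val * blockSwap k h)
          = TensorProduct.map (π z⁻¹) (π z) (φ (blockSwap k h)) := by
        intro z
        obtain ⟨q, hq⟩ : ∃ q : GL (Fin N) k,
            blocks k h q.val = Matrix.fromBlocks (-z⁻¹).val 1 0 z.val := by
          refine ⟨shear h (z⁻¹).val * blockDiag h (-z⁻¹) z, ?_⟩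
          rw [Units.val_mul, map_mul, blocks_shear, blocks_blockDiag, Matrix.fromBlocks_multiply]
          simp
        have h1 : blockSwap k h * shear h z.val * blockSwap k h
            = q * (blockSwap k h * shear h (z⁻¹).val) := by
          apply ext_blocks h
          rw [hb, Units.val_mul, Units.val_mul, map_mul, map_mul, hq, blocks_blockSwap,
            blocks_shear, Matrix.fromBlocks_multiply, Matrix.fromBlocks_multiply]
          simp
        rw [h1, induced_apply_mul h hφ (t₁ := -z⁻¹) (t₂ := z), hY _ (shear_mem h _),
          apply_neg hπ.1]
        all_goals rw [hq]; rfl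
      obtain ⟨z, rfl⟩ := hu
      rw [hz, ← Units.val_neg, hz, apply_neg hπ.1, inv_neg, apply_neg hπ.1]
    · have hzero : ∀ z : Matrix (Fin n) (Fin n) k, z ≠ 0 → ¬ IsUnit z →
          φ (blockSwap k h * shear h z * blockSwap k h) = 0 := by
        intro z hz hzu
        apply apply_eq_zero_of_lowerRow hπ hk h hφ (fun u hu => hY u hu _)
        · rwa [map_lowerRow_initial, hb, Matrix.toBlocks_fromBlocks₂₁, Ne, range_mulVecLin_eq_bot]
        · rwa [map_lowerRow_initial, hb, Matrix.toBlocks_fromBlocks₂₁, Ne, range_mulVecLin_eq_top]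
      rw [hzero y hy hu, hzero (-y) (neg_ne_zero.2 hy) (by rwa [IsUnit.neg_iff])]
  refine Finset.sum_involution (fun y _ => -y) (fun y hy => ?_) (fun y hy _ => ?_)
    (fun y hy => ?_) (fun y _ => neg_neg y)
  · rw [hneg y (Finset.ne_of_mem_erase hy), ← two_smul R, CharTwo.two_eq_zero, zero_smul]
  · intro h0
    have h2 : (2 : k) ≠ 0 := Ring.two_ne_zero hk
    apply Finset.ne_of_mem_erase hy
    ext i j
    have h3 := congrFun (congrFun h0 i) j
    rw [Matrix.neg_apply] at h3
    have h4 : 2 * y i j = 0 := by linear_combination -h3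
    exact (mul_eq_zero.1 h4).resolve_left h2
  · exact Finset.mem_erase.2 ⟨neg_ne_zero.2 (Finset.ne_of_mem_erase hy), Finset.mem_univ _⟩

end Induced

/-! ### Functions supported on the parabolic subgroup -/

section Supported

variable {k : Type*} [Field k] {n N : ℕ} {R : Type u} [Field R]
  {V : Type*} [AddCommGroup V] [Module R V]

open Classical in
/-- The function supported on the parabolic subgroup with a given value at `1`. -/
noncomputable def supportedFun (h : n + n = N) (π : Representation R (GL (Fin n) k) V) :
    V ⊗[R] V →ₗ[R] GL (Fin N) k → V ⊗[R] V :=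
  LinearMap.pi fun g => if hg : g ∈ parabolic k h then inflation h π π ⟨g, hg⟩ else 0

lemma supportedFun_of_mem (h : n + n = N) (π : Representation R (GL (Fin n) k) V) (v : V ⊗[R] V)
    {g : GL (Fin N) k} (hg : g ∈ parabolic k h) :
    supportedFun h π v g = inflation h π π ⟨g, hg⟩ v := by
  rw [supportedFun, LinearMap.pi_apply, dif_pos hg]

lemma supportedFun_of_notMem (h : n + n = N) (π : Representation R (GL (Fin n) k) V)
    (v : V ⊗[R] V) {g : GL (Fin N) k} (hg : g ∉ parabolic k h) : supportedFun h π v g = 0 := by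
  rw [supportedFun, LinearMap.pi_apply, dif_neg hg, LinearMap.zero_apply]

/-- The function in the space of `π × π` which is supported on the parabolic subgroup and takes a
given value at `1`. -/
noncomputable def supported (h : n + n = N) (π : Representation R (GL (Fin n) k) V) :
    V ⊗[R] V →ₗ[R] InducedSpace h π :=
  (supportedFun h π).codRestrict _ fun v q g => by
    rw [Subgroup.coe_subtype]
    by_cases hg : g ∈ parabolic k h
    · rw [supportedFun_of_mem h π v hg, supportedFun_of_mem h π v (mul_mem q.2 hg),
        ← Module.End.mul_apply, ← _root_.map_mul]
      rfl
    · rw [supportedFun_of_notMem h π v hg,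
        supportedFun_of_notMem h π v ((Subgroup.mul_mem_cancel_left _ q.2).not.2 hg), map_zero]

variable {π : Representation R (GL (Fin n) k) V}

lemma supported_of_mem (h : n + n = N) (v : V ⊗[R] V) {g : GL (Fin N) k}
    (hg : g ∈ parabolic k h) : (supported h π v).1 g = inflation h π π ⟨g, hg⟩ v :=
  supportedFun_of_mem h π v hg

lemma supported_of_notMem (h : n + n = N) (v : V ⊗[R] V) {g : GL (Fin N) k}
    (hg : g ∉ parabolic k h) : (supported h π v).1 g = 0 :=
  supportedFun_of_notMem h π v hg

lemma inflation_apply (h : n + n = N) (q : parabolic k h) :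
    inflation h π π q = TensorProduct.map (π (leviFst k h q)) (π (leviSnd k h q)) := rfl

lemma supported_one (h : n + n = N) (v : V ⊗[R] V) : (supported h π v).1 1 = v := by
  rw [supported_of_mem h v (one_mem _)]
  exact LinearMap.congr_fun (map_one (inflation h π π)) v

lemma parabolicInduction_apply (h : n + n = N) (g x : GL (Fin N) k) (φ : InducedSpace h π) :
    (parabolicInduction h π π g φ).1 x = φ.1 (x * g) := rfl

lemma parabolicInduction_supported (h : n + n = N) (q : parabolic k h) (v : V ⊗[R] V) :
    parabolicInduction h π π q.1 (supported h π v) = supported h π (inflation h π π q v) := by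
  ext x
  rw [parabolicInduction_apply]
  by_cases hx : x ∈ parabolic k h
  · rw [supported_of_mem h _ hx, supported_of_mem h _ (mul_mem hx q.2), ← Module.End.mul_apply,
      ← _root_.map_mul]
    rfl
  · rw [supported_of_notMem h _ hx,
      supported_of_notMem h _ ((Subgroup.mul_mem_cancel_right _ q.2).not.2 hx)]

lemma blockDiag_mem (h : n + n = N) (x y : GL (Fin n) k) : blockDiag h x y ∈ parabolic k h := by
  change (blocks k h (blockDiag h x y).val).toBlocks₂₁ = 0
  rw [blocks_blockDiag]
  rfl

lemma parabolicInduction_blockDiag_supported (h : n + n = N) (x y : GL (Fin n) k) (v : V ⊗[R] V) :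
    parabolicInduction h π π (blockDiag h x y) (supported h π v)
      = supported h π (TensorProduct.map (π x) (π y) v) := by
  rw [parabolicInduction_supported h ⟨_, blockDiag_mem h x y⟩ v, inflation_apply]
  have h1 : leviFst k h ⟨_, blockDiag_mem h x y⟩ = x := Units.ext (by
    change (blocks k h (blockDiag h x y).val).toBlocks₁₁ = _
    rw [blocks_blockDiag]
    rfl)
  have h2 : leviSnd k h ⟨_, blockDiag_mem h x y⟩ = y := Units.ext (by
    change (blocks k h (blockDiag h x y).val).toBlocks₂₂ = _
    rw [blocks_blockDiag]
    rfl)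
  rw [h1, h2]

lemma blockSwap_notMem (hn : 0 < n) (h : n + n = N) : blockSwap k h ∉ parabolic k h := by
  intro hw
  change (blocks k h (blockSwap k h).val).toBlocks₂₁ = 0 at hw
  rw [blocks_blockSwap, Matrix.toBlocks_fromBlocks₂₁] at hw
  have := congrFun (congrFun hw ⟨0, hn⟩) ⟨0, hn⟩
  rw [Matrix.one_apply_eq] at this
  exact one_ne_zero this

variable [Finite k]

lemma parabolicInduction_unipotent_supported (h : n + n = N) {u : GL (Fin N) k}
    (hu : u ∈ unipotentRadical (initial k N n)) (v : V ⊗[R] V) :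
    parabolicInduction h π π u (supported h π v) = supported h π v := by
  have hx : ∀ i j : Fin N, (n ≤ i.val ∨ j.val < n) → u.val i j = (1 : Matrix _ _ k) i j := by
    intro i j hij
    rw [← sub_eq_zero, ← Matrix.sub_apply]
    exact mem_radical_initial.1 hu i j hij
  have hone : ∀ i j : Fin n, (1 : Matrix (Fin N) (Fin N) k) ⟨n + i, by omega⟩ ⟨n + j, by omega⟩
      = (1 : Matrix _ _ k) i j := fun i j => by
    rw [Matrix.one_apply, Matrix.one_apply]
    refine if_congr ?_ rfl rfl
    simp [Fin.ext_iff]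
  have h21 : u ∈ parabolic k h := by
    change (blocks k h u.val).toBlocks₂₁ = 0
    ext i j
    rw [blocks_apply_inr_inl, hx _ _ (Or.inr j.2), Matrix.one_apply_ne]
    · rfl
    · rw [Ne, Fin.ext_iff]
      have := j.2
      simp only
      omega
  have h1 : leviFst k h ⟨u, h21⟩ = 1 := Units.ext (by
    change (blocks k h u.val).toBlocks₁₁ = _
    ext i j
    rw [blocks_apply_inl_inl, hx _ _ (Or.inr j.2), Units.val_one, Matrix.one_apply,
      Matrix.one_apply]
    refine if_congr ?_ rfl rfl
    simp [Fin.ext_iff])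
  have h2 : leviSnd k h ⟨u, h21⟩ = 1 := Units.ext (by
    change (blocks k h u.val).toBlocks₂₂ = _
    ext i j
    rw [blocks_apply_inr_inr, hx _ _ (Or.inl (Nat.le_add_right _ _)), hone, Units.val_one])
  rw [parabolicInduction_supported h ⟨u, h21⟩ v, inflation_apply, h1, h2, map_one, Module.End.one_eq_id,
    TensorProduct.map_id, LinearMap.id_apply]

/-- The functions supported on the parabolic subgroup generate `π × π`. -/
lemma eq_top_of_supported_mem (h : n + n = N) (S : Submodule R (InducedSpace h π))
    (hS : ∀ g, ∀ φ ∈ S, parabolicInduction h π π g φ ∈ S) (hS' : ∀ v, supported h π v ∈ S) :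
    S = ⊤ := by
  rw [eq_top_iff]
  intro φ _
  let _ := Fintype.ofFinite (Quotient (QuotientGroup.rightRel (parabolic k h)))
  have key : φ = ∑ c : Quotient (QuotientGroup.rightRel (parabolic k h)),
      parabolicInduction h π π c.out⁻¹ (supported h π (φ.1 c.out)) := by
    ext x
    rw [AddSubmonoidClass.coe_finsetSum, Finset.sum_apply,
      Finset.sum_eq_single (Quotient.mk _ x)]
    · have hx : x * (Quotient.mk (QuotientGroup.rightRel (parabolic k h)) x).out⁻¹
          ∈ parabolic k h := QuotientGroup.rightRel_apply.1 (Quotient.mk_out x)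
      rw [parabolicInduction_apply, supported_of_mem h _ hx]
      have := φ.2 ⟨_, hx⟩ (Quotient.mk (QuotientGroup.rightRel (parabolic k h)) x).out
      rw [Subgroup.coe_subtype, inv_mul_cancel_right] at this
      exact this
    · intro c _ hc
      rw [parabolicInduction_apply, supported_of_notMem]
      intro hx
      apply hc
      rw [← Quotient.out_eq c]
      exact Quotient.sound (QuotientGroup.rightRel_apply.2 hx)
    · exact fun hx => absurd (Finset.mem_univ _) hx
  rw [key]
  exact Submodule.sum_mem _ fun c _ => hS _ _ (hS' _)

end Supported

/-! ### The intertwining involution and irreducible quotients of `π × π` -/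

section Quotient

variable {k : Type*} [Field k] [Finite k] {n N : ℕ} {R : Type u} [Field R]
  {V : Type*} [AddCommGroup V] [Module R V] {π : Representation R (GL (Fin n) k) V}

omit [Finite k] in
-- The factorwise spanning property suffices because `End (V ⊗ V)` is spanned by tensor products of
-- endomorphisms.
lemma span_range_tensor [FiniteDimensional R V] (hπ : Submodule.span R (Set.range π) = ⊤) :
    Submodule.span R (Set.range fun m : GL (Fin n) k × GL (Fin n) k =>
      TensorProduct.map (π m.1) (π m.2)) = ⊤ := by
  set S := Submodule.span R (Set.range fun m : GL (Fin n) k × GL (Fin n) k =>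
      TensorProduct.map (π m.1) (π m.2)) with hS
  have h1 : ∀ (A : V →ₗ[R] V) (x : GL (Fin n) k), TensorProduct.map A (π x) ∈ S := by
    intro A x
    have hA : A ∈ Submodule.span R (Set.range π) := hπ ▸ Submodule.mem_top
    induction hA using Submodule.span_induction with
    | mem A hA =>
      obtain ⟨y, rfl⟩ := hA
      exact Submodule.subset_span ⟨(y, x), rfl⟩
    | zero => rw [TensorProduct.map_zero_left]; exact S.zero_mem
    | add A B _ _ hA hB => rw [TensorProduct.map_add_left]; exact S.add_mem hA hB
    | smul c A _ hA => rw [TensorProduct.map_smul_left]; exact S.smul_mem c hA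
  have h2 : ∀ A B : V →ₗ[R] V, TensorProduct.map A B ∈ S := by
    intro A B
    have hB : B ∈ Submodule.span R (Set.range π) := hπ ▸ Submodule.mem_top
    induction hB using Submodule.span_induction with
    | mem B hB =>
      obtain ⟨y, rfl⟩ := hB
      exact h1 A y
    | zero => rw [TensorProduct.map_zero_right]; exact S.zero_mem
    | add B B' _ _ hB hB' => rw [TensorProduct.map_add_right]; exact S.add_mem hB hB'
    | smul c B _ hB => rw [TensorProduct.map_smul_right]; exact S.smul_mem c hB
  rw [eq_top_iff]
  intro A _
  obtain ⟨x, rfl⟩ := (homTensorHomEquiv R V V V V).surjective A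
  induction x with
  | zero => rw [map_zero]; exact S.zero_mem
  | tmul A B => rw [homTensorHomEquiv_apply, TensorProduct.homTensorHomMap_apply]; exact h2 A B
  | add x y hx hy => rw [map_add]; exact S.add_mem (hx trivial) (hy trivial)

/-- The standard intertwining operator on `π × π`. -/
noncomputable def inducedIntertwiner (h : n + n = N) (π : Representation R (GL (Fin n) k) V) :
    Module.End R (InducedSpace h π) :=
  (intertwiner h).restrict fun _ hφ => intertwiner_mem h hφ

lemma inducedIntertwiner_val (h : n + n = N) (φ : InducedSpace h π) :
    (inducedIntertwiner h π φ).1 = intertwiner h φ.1 := rfl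

lemma inducedIntertwiner_commute (h : n + n = N) (g : GL (Fin N) k) (φ : InducedSpace h π) :
    inducedIntertwiner h π (parabolicInduction h π π g φ)
      = parabolicInduction h π π g (inducedIntertwiner h π φ) := by
  ext x
  let _ := Fintype.ofFinite (Matrix (Fin n) (Fin n) k)
  rw [parabolicInduction_apply, inducedIntertwiner_val, inducedIntertwiner_val, intertwiner_apply,
    intertwiner_apply]
  simp only [parabolicInduction_apply, mul_assoc]

omit [Finite k] in
lemma mem_eigenvectors_one (h : n + n = N) {U : Subgroup (GL (Fin N) k)} {φ : InducedSpace h π}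
    (hφ : φ ∈ eigenvectors (parabolicInduction h π π) U (fun _ => 1)) {u : GL (Fin N) k}
    (hu : u ∈ U) (g : GL (Fin N) k) : φ.1 (g * u) = φ.1 g := by
  have := hφ u hu
  rw [one_smul] at this
  rw [← parabolicInduction_apply, this]

lemma supported_mem_eigenvectors (h : n + n = N) (v : V ⊗[R] V) :
    supported h π v ∈ eigenvectors (parabolicInduction h π π) (unipotentRadical (initial k N n))
      (fun _ => 1) := fun u hu => by
  rw [parabolicInduction_unipotent_supported h hu, one_smul]

variable [CharP R 2]

lemma eq_of_apply_eq (hπ : IsCuspidal π) (hk : ringChar k ≠ 2) (h : n + n = N)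
    {φ φ' : InducedSpace h π}
    (hφ : φ ∈ eigenvectors (parabolicInduction h π π) (unipotentRadical (initial k N n))
      (fun _ => 1))
    (hφ' : φ' ∈ eigenvectors (parabolicInduction h π π) (unipotentRadical (initial k N n))
      (fun _ => 1))
    (h1 : φ.1 1 = φ'.1 1) (hw : φ.1 (blockSwap k h) = φ'.1 (blockSwap k h)) : φ = φ' := by
  rw [← sub_eq_zero]
  ext g
  refine apply_eq_zero_of_invariant hπ hk h (φ - φ').2 (fun u hu g => ?_) ?_ ?_ g
  · exact mem_eigenvectors_one h (Submodule.sub_mem _ hφ hφ') hu g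
  · change φ.1 1 - φ'.1 1 = 0
    rw [h1, sub_self]
  · change φ.1 _ - φ'.1 _ = 0
    rw [hw, sub_self]

omit [CharP R 2] in
lemma inducedIntertwiner_mem_eigenvectors (h : n + n = N) {U : Subgroup (GL (Fin N) k)}
    {χ : GL (Fin N) k → R} {φ : InducedSpace h π}
    (hφ : φ ∈ eigenvectors (parabolicInduction h π π) U χ) :
    inducedIntertwiner h π φ ∈ eigenvectors (parabolicInduction h π π) U χ := fun u hu => by
  rw [← inducedIntertwiner_commute, hφ u hu, map_smul]

lemma inducedIntertwiner_one (hk : ringChar k ≠ 2) (h : n + n = N) {φ : InducedSpace h π}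
    (hφ : φ ∈ eigenvectors (parabolicInduction h π π) (unipotentRadical (initial k N n))
      (fun _ => 1)) :
    (inducedIntertwiner h π φ).1 1 = TensorProduct.comm R V V (φ.1 (blockSwap k h)) :=
  intertwiner_one hk h fun _ hu g => mem_eigenvectors_one h hφ hu g

lemma inducedIntertwiner_blockSwap (hπ : IsCuspidal π) (hk : ringChar k ≠ 2) (h : n + n = N)
    {φ : InducedSpace h π}
    (hφ : φ ∈ eigenvectors (parabolicInduction h π π) (unipotentRadical (initial k N n))
      (fun _ => 1)) :
    (inducedIntertwiner h π φ).1 (blockSwap k h) = TensorProduct.comm R V V (φ.1 1) :=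
  intertwiner_blockSwap hπ hk h φ.2 fun _ hu g => mem_eigenvectors_one h hφ hu g

/-- On vectors fixed by the radical, the operator exchanges the values at `1` and at the block swap
up to the flip; these two values determine such a vector. -/
lemma inducedIntertwiner_inducedIntertwiner_supported (hπ : IsCuspidal π) (hk : ringChar k ≠ 2)
    (h : n + n = N) (v : V ⊗[R] V) :
    inducedIntertwiner h π (inducedIntertwiner h π (supported h π v)) = supported h π v := by
  have h0 := supported_mem_eigenvectors (π := π) h v
  have h1 := inducedIntertwiner_mem_eigenvectors h h0
  refine eq_of_apply_eq hπ hk h (inducedIntertwiner_mem_eigenvectors h h1) h0 ?_ ?_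
  · rw [inducedIntertwiner_one hk h h1, inducedIntertwiner_blockSwap hπ hk h h0]
    exact TensorProduct.comm_comm _ _ _ _
  · rw [inducedIntertwiner_blockSwap hπ hk h h1, inducedIntertwiner_one hk h h0]
    exact TensorProduct.comm_comm _ _ _ _

lemma inducedIntertwiner_involution (hπ : IsCuspidal π) (hk : ringChar k ≠ 2)
    (h : n + n = N) (φ : InducedSpace h π) :
    inducedIntertwiner h π (inducedIntertwiner h π φ) = φ := by
  have := eq_top_of_supported_mem h
    (LinearMap.eqLocus (inducedIntertwiner h π * inducedIntertwiner h π) 1)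
    (fun g x hx => by
      change inducedIntertwiner h π (inducedIntertwiner h π x) = x at hx
      change inducedIntertwiner h π (inducedIntertwiner h π _) = _
      rw [inducedIntertwiner_commute, inducedIntertwiner_commute, hx]
      rfl)
    (inducedIntertwiner_inducedIntertwiner_supported hπ hk h)
  have hx : φ ∈ LinearMap.eqLocus (inducedIntertwiner h π * inducedIntertwiner h π) 1 :=
    this ▸ Submodule.mem_top
  exact hx

/-- Take `a` to be the value at `1` and `b` the flip of the value at the block swap. Since `n > 0`
the swap is outside the parabolic, so each summand contributes to only one of the two values. -/
lemma eq_supported_add (hn : 0 < n) (hπ : IsCuspidal π) (hk : ringChar k ≠ 2) (h : n + n = N)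
    {φ : InducedSpace h π}
    (hφ : φ ∈ eigenvectors (parabolicInduction h π π) (unipotentRadical (initial k N n))
      (fun _ => 1)) :
    ∃ a b, φ = supported h π a + inducedIntertwiner h π (supported h π b) := by
  refine ⟨φ.1 1, TensorProduct.comm R V V (φ.1 (blockSwap k h)), ?_⟩
  have h0 := supported_mem_eigenvectors (π := π) h
  refine eq_of_apply_eq hπ hk h hφ (Submodule.add_mem _ (h0 _)
    (inducedIntertwiner_mem_eigenvectors h (h0 _))) ?_ ?_
  · rw [Submodule.coe_add, Pi.add_apply, supported_one, inducedIntertwiner_one hk h (h0 _),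
      supported_of_notMem h _ (blockSwap_notMem hn h), map_zero, add_zero]
  · rw [Submodule.coe_add, Pi.add_apply, inducedIntertwiner_blockSwap hπ hk h (h0 _), supported_one,
      supported_of_notMem h _ (blockSwap_notMem hn h), zero_add]
    exact (TensorProduct.comm_comm _ _ _ _).symm

/-- The vectors of `π × π` which are fixed by the standard intertwining operator vanish in every
irreducible quotient. -/
theorem map_eq_zero_of_inducedIntertwiner_eq [IsAlgClosed R] (hn : 0 < n) (hπ : IsCuspidal π)
    (hk : ringChar k ≠ 2) (h : n + n = N) {W : Type*} [AddCommGroup W] [Module R W]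
    {τ : Representation R (GL (Fin N) k) W} (hτ : τ.IsIrreducible)
    (f : (parabolicInduction h π π).IntertwiningMap τ) {φ : InducedSpace h π}
    (hφ : inducedIntertwiner h π φ = φ) : f φ = 0 := by
  have := finiteDimensional_of_irreducible hπ.1
  refine map_eq_zero_of_involution (odd_card_unipotentRadical hk (initial k N n))
    (inducedIntertwiner_commute h) (supported_mem_eigenvectors h)
    (inducedIntertwiner_inducedIntertwiner_supported hπ hk h) (fun v w hvw => ?_)
    (fun φ hφ => eq_supported_add hn hπ hk h hφ) (eq_top_of_supported_mem h)
    (L := fun m : GL (Fin n) k × GL (Fin n) k => blockDiag h m.1 m.2)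
    (fun m v => parabolicInduction_blockDiag_supported h m.1 m.2 v)
    (span_range_tensor (span_range_eq_top hπ.1)) hτ f hφ
  -- The supported functions and their images under the operator are independent: at `1` the former
  -- take the value `v`, the latter `0`.
  have h1 := congrFun (congrArg Subtype.val hvw) 1
  rw [supported_one, inducedIntertwiner_one hk h (supported_mem_eigenvectors h w),
    supported_of_notMem h _ (blockSwap_notMem hn h), map_zero] at h1
  exact h1

end Quotient

/-! ### A combinatorial lemma on subspaces and the standard flag -/

section Jump

variable {k : Type*} [Field k] {n N : ℕ}

/-- A subspace which is too small to contain the complement of a part of the standard flag, but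
meets that part, has a jump of the flag followed by a gap. -/
lemma exists_jump {X : Submodule k (Fin N → k)} (hX : Module.finrank k X + n ≤ N)
    {v : Fin N → k} (hv : v ∈ X) (hv0 : v ≠ 0) (hvn : v ∈ initial k N n) :
    ∃ i j : Fin N, i.val + 1 = j.val ∧ ∃ c ∈ X, ∃ ρ : Fin N → k, c i = 1 ∧ (∀ l, i < l → c l = 0) ∧
      (∀ x ∈ X, ρ ⬝ᵥ x = 0) ∧ (∀ l ≤ i, ρ l = 0) ∧ ρ j = 1 := by
  classical
  by_contra! hcon
  -- The jumps of the flag on `X`: indices that are the last non-zero coordinate of a vector of `X`.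
  let P : Fin N → Prop := fun i => ∃ c ∈ X, c i = 1 ∧ ∀ l, i < l → c l = 0
  -- If `i` is a jump and `j = i + 1` is not, then the basis vector at `j` is outside `X` plus the
  -- span of the earlier ones; a functional separating it is the required `ρ`.
  have hstep : ∀ i j : Fin N, i.val + 1 = j.val → P i → P j := by
    rintro i j hij ⟨c, hc, hci, hcl⟩
    by_contra hj
    have h1 : (Pi.single j 1 : Fin N → k) ∉ X ⊔ initial k N (i.val + 1) := by
      intro hmem
      obtain ⟨x, hx, y, hy, hxy⟩ := Submodule.mem_sup.1 hmem
      refine hj ⟨x, hx, ?_, fun l hl => ?_⟩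
      · have := congrFun hxy j
        rwa [Pi.add_apply, hy j hij.le, add_zero, Pi.single_eq_same] at this
      · have := congrFun hxy l
        rw [Fin.lt_def] at hl
        rwa [Pi.add_apply, hy l (by omega), add_zero, Pi.single_eq_of_ne] at this
        exact fun h => by simp [h] at hl
    obtain ⟨lam, hlam, hlam'⟩ := Submodule.exists_le_ker_of_notMem h1
    refine hcon i j hij c hc (fun b => (lam (Pi.single j 1))⁻¹ * lam (Pi.single b 1)) hci hcl
      (fun x hx => ?_) (fun l hl => ?_) (inv_mul_cancel₀ hlam)
    · have h2 : lam x = ∑ b, x b * lam (Pi.single b 1) := by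
        conv_lhs => rw [pi_eq_sum_univ' x, map_sum]
        simp only [map_smul, smul_eq_mul]
      have h3 : lam x = 0 := hlam' (Submodule.mem_sup_left hx)
      rw [dotProduct]
      calc _ = (lam (Pi.single j 1))⁻¹ * ∑ b, x b * lam (Pi.single b 1) := by
            rw [Finset.mul_sum]
            exact Finset.sum_congr rfl fun b _ => by ring
        _ = 0 := by rw [← h2, h3, mul_zero]
    · have h3 : lam (Pi.single l 1) = 0 := hlam' (Submodule.mem_sup_right fun b hb =>
        Pi.single_eq_of_ne (by
          rw [Ne, Fin.ext_iff]
          rw [Fin.le_def] at hl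
          omega) _)
      simp only [h3, mul_zero]
  obtain ⟨i₀, hi₀, hmax⟩ : ∃ i₀, v i₀ ≠ 0 ∧ ∀ l, i₀ < l → v l = 0 := by
    have hne : (Finset.univ.filter fun i => v i ≠ 0).Nonempty := by
      obtain ⟨i, hi⟩ := Function.ne_iff.1 hv0
      exact ⟨i, by simpa using hi⟩
    obtain ⟨i, hi, hmax⟩ := Finset.exists_max_image _ id hne
    refine ⟨i, by simpa using hi, fun l hl => ?_⟩
    by_contra h
    exact absurd (hmax l (by simpa using h)) (not_le.2 hl)
  have hin : i₀.val < n := by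
    by_contra h
    exact hi₀ (hvn i₀ (not_lt.1 h))
  have hP0 : P i₀ := ⟨(v i₀)⁻¹ • v, X.smul_mem _ hv, inv_mul_cancel₀ hi₀, fun l hl => by
    rw [Pi.smul_apply, hmax l hl, smul_zero]⟩
  have hP : ∀ m, i₀.val ≤ m → ∀ hm : m < N, P ⟨m, hm⟩ := by
    intro m hm
    induction m, hm using Nat.le_induction with
    | base => exact fun _ => hP0
    | succ m _ ih => exact fun hm => hstep ⟨m, by omega⟩ _ rfl (ih _)
  -- Every index from `i₀` on is a jump, so `X` has dimension at least `N - i₀`, which exceeds `N -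
  -- n` as `i₀ < n`.
  have hsup : ∀ m, i₀.val ≤ m → m ≤ N → initial k N m ≤ X ⊔ initial k N i₀.val := by
    intro m hm
    induction m, hm using Nat.le_induction with
    | base => exact fun _ => le_sup_right
    | succ m hm ih =>
      intro hmN w hw
      obtain ⟨c, hc, hci, hcl⟩ := hP m hm hmN
      have h1 : w - w ⟨m, hmN⟩ • c ∈ initial k N m := by
        intro l hl
        rw [Pi.sub_apply, Pi.smul_apply, smul_eq_mul]
        rcases hl.eq_or_lt with h | h
        · have : l = ⟨m, hmN⟩ := Fin.ext h.symm
          rw [this, hci, mul_one, sub_self]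
        · rw [hcl l h, hw l h, mul_zero, sub_zero]
      rw [← sub_add_cancel w (w ⟨m, hmN⟩ • c)]
      exact Submodule.add_mem _ (ih (by omega) h1)
        (Submodule.mem_sup_left (X.smul_mem _ hc))
  have h1 := Submodule.finrank_mono (hsup N i₀.2.le le_rfl)
  rw [finrank_initial le_rfl] at h1
  have h2 := Submodule.finrank_add_le_finrank_add_finrank X (initial k N i₀.val)
  rw [finrank_initial i₀.2.le] at h2
  omega

end Jump

/-! ### Block diagonal elements and derivatives of level `d` -/

section BlockDiagonal

variable {k : Type*} [Field k] {n N : ℕ}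

lemma superdiag_blockDiag (h : n + n = N) {d : ℕ} (hd : d ≤ n) (x y : GL (Fin n) k) :
    superdiag d (blockDiag h x y).val = superdiag d x.val + superdiag 0 y.val := by
  subst h
  have h1 : ∀ i j, (blockDiag rfl x y).val (finSumFinEquiv i) (finSumFinEquiv j)
      = Matrix.fromBlocks x.val 0 0 y.val i j := fun i j => by
    rw [← blocks_blockDiag rfl]
    rfl
  have h11 : ∀ i j, (blockDiag rfl x y).val (Fin.castAdd n i) (Fin.castAdd n j) = x.val i j :=
    fun i j => h1 (.inl i) (.inl j)
  have h12 : ∀ i j, (blockDiag rfl x y).val (Fin.castAdd n i) (Fin.natAdd n j) = 0 :=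
    fun i j => h1 (.inl i) (.inr j)
  have h21 : ∀ i j, (blockDiag rfl x y).val (Fin.natAdd n i) (Fin.castAdd n j) = 0 :=
    fun i j => h1 (.inr i) (.inl j)
  have h22 : ∀ i j, (blockDiag rfl x y).val (Fin.natAdd n i) (Fin.natAdd n j) = y.val i j :=
    fun i j => h1 (.inr i) (.inr j)
  simp only [superdiag, Fin.sum_univ_add, h11, h12, h21, h22, ite_self, Finset.sum_const_zero,
    add_zero, zero_add, Fin.val_castAdd, Fin.val_natAdd]
  congr 1
  refine Finset.sum_congr rfl fun i _ => Finset.sum_congr rfl fun j _ => ?_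
  refine if_congr ?_ rfl rfl
  omega

lemma superdiagChar_blockDiag {R : Type*} [Field R] (ψ : AddChar k R) (h : n + n = N) {d : ℕ}
    (hd : d ≤ n) (x y : GL (Fin n) k) :
    superdiagChar ψ d (blockDiag h x y) = superdiagChar ψ d x * superdiagChar ψ 0 y := by
  rw [superdiagChar, superdiag_blockDiag h hd, AddChar.map_add_eq_mul]
  rfl

lemma blockDiag_mem_unitri [Finite k] (h : n + n = N) {d : ℕ} {x y : GL (Fin n) k}
    (hx : x ∈ unitri k n d) (hy : y ∈ unitri k n 0) (hd : d ≤ n) :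
    blockDiag h x y ∈ unitri k N d := by
  subst h
  intro i j hij
  have h1 : ∀ i j, ((blockDiag rfl x y).val - 1) (finSumFinEquiv i) (finSumFinEquiv j)
      = Matrix.fromBlocks (x.val - 1) 0 0 (y.val - 1) i j := fun i j => by
    have h2 : Matrix.fromBlocks (x.val - 1) 0 0 (y.val - 1)
        = blocks k rfl ((blockDiag rfl x y).val - 1) := by
      rw [map_sub, map_one, blocks_blockDiag, ← Matrix.fromBlocks_one, eq_sub_iff_add_eq,
        Matrix.fromBlocks_add]
      simp
    rw [h2]
    rfl
  obtain ⟨i, rfl⟩ := finSumFinEquiv.surjective i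
  obtain ⟨j, rfl⟩ := finSumFinEquiv.surjective j
  rw [h1]
  rcases i with i | i <;> rcases j with j | j
  · exact hx i j hij
  · rfl
  · rfl
  · refine hy i j (Or.inl ?_)
    rcases hij with hij | hij
    · exact (Fin.natAdd_le_natAdd_iff n).1 hij
    · rw [finSumFinEquiv_apply_right, Fin.val_natAdd] at hij
      omega

lemma blockSwap_mul_blockDiag (h : n + n = N) (x y : GL (Fin n) k) :
    blockSwap k h * blockDiag h x y = blockDiag h y x * blockSwap k h := by
  apply ext_blocks h
  rw [Units.val_mul, Units.val_mul, map_mul, map_mul, blocks_blockSwap, blocks_blockDiag,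
    blocks_blockDiag, Matrix.fromBlocks_multiply, Matrix.fromBlocks_multiply]
  simp

variable [Finite k]

lemma unipotentRadical_initial_le (d : ℕ) : unipotentRadical (initial k N d) ≤ unitri k N d := by
  intro u hu i j hij
  refine mem_radical_initial.1 hu i j ?_
  rcases hij with hij | hij
  · rw [Fin.le_def] at hij
    omega
  · exact Or.inr hij

lemma mem_eigenvectors_unipotentRadical {R V : Type*} [Field R] [AddCommGroup V] [Module R V]
    {ρ : Representation R (GL (Fin N) k) V} {ψ : AddChar k R} {d : ℕ} {v : V}
    (hv : v ∈ eigenvectors ρ (unitri k N d) (superdiagChar ψ d)) :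
    v ∈ eigenvectors ρ (unipotentRadical (initial k N d)) (fun _ => 1) := by
  intro u hu
  rw [hv u (unipotentRadical_initial_le d hu), superdiagChar,
    ← add_sub_cancel 1 u.val, superdiag_one_add, superdiag_eq_zero, AddChar.map_zero_eq_one]
  intro i j _ hi
  exact mem_radical_initial.1 hu i j (Or.inl hi)

end BlockDiagonal

/-! ### Whittaker vectors of `π × π` -/

section InducedWhittaker

variable {k : Type*} [Field k] [Finite k] {n N : ℕ} {R : Type u} [Field R]
  {V : Type*} [AddCommGroup V] [Module R V] {π : Representation R (GL (Fin n) k) V}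
  {ψ : AddChar k R}

/-- The Whittaker vectors of `π × π` are supported on the big cell. -/
lemma isUnit_of_apply_ne_zero (hψ : ψ ≠ 1) (h : n + n = N) {φ : InducedSpace h π}
    (hφ : φ ∈ whittaker (parabolicInduction h π π) ψ) {g : GL (Fin N) k} (hg : φ.1 g ≠ 0) :
    IsUnit (blocks k h g.val).toBlocks₂₁ := by
  by_contra hu
  have hlow : LinearMap.range (lowerRow h g.val) = ⊤ := by
    rw [eq_top_iff]
    intro w _
    refine ⟨(g⁻¹).val.mulVec fun i => if hi : n ≤ i.val then w ⟨i.val - n, by omega⟩ else 0, ?_⟩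
    rw [lowerRow, LinearMap.comp_apply, Matrix.mulVecLin_apply, Matrix.mulVec_mulVec, Units.mul_inv,
      Matrix.one_mulVec]
    ext i
    rw [lower_apply, dif_pos (Nat.le_add_right _ _)]
    congr 1
    exact Fin.ext (Nat.add_sub_cancel_left _ _)
  have hdim := LinearMap.finrank_range_add_finrank_ker (lowerRow h g.val)
  rw [hlow, finrank_top, Module.finrank_fin_fun, Module.finrank_fin_fun] at hdim
  -- Otherwise the lower left block would be injective, hence invertible.
  obtain ⟨v, hv, hv0, hvn⟩ : ∃ v ∈ LinearMap.ker (lowerRow h g.val), v ≠ 0 ∧ v ∈ initial k N n := by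
    by_contra! hcon
    apply hu
    rw [← range_mulVecLin_eq_top, ← map_lowerRow_initial]
    apply Submodule.eq_top_of_finrank_eq
    rw [← LinearMap.range_domRestrict, LinearMap.finrank_range_of_inj,
      finrank_initial (by omega), Module.finrank_fin_fun]
    rw [injective_iff_map_eq_zero]
    intro v hv
    by_contra hv0
    exact hcon v hv (fun h => hv0 (Subtype.ext h)) v.2
  -- The transvection `1 + s c ρ` is upper unitriangular with character `ψ s`. As `c` lies in the
  -- kernel of the lower rows and `ρ` vanishes on that kernel, its conjugate by `g` lies in the
  -- unipotent radical and acts trivially; so `φ g = ψ s • φ g`.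
  obtain ⟨i, j, hij, c, hc, ρ, hci, hcl, hρX, hρl, hρj⟩ := exists_jump (by omega) hv hv0 hvn
  obtain ⟨s, hs⟩ : ∃ s, ψ s ≠ 1 := by
    by_contra! hcon
    exact hψ (by ext x; rw [hcon x]; rfl)
  obtain ⟨u, hu, huv⟩ := exists_unitri_transvection 0 (s • c) ρ (fun a b hab => by
    by_cases ha : i < a
    · left
      rw [Pi.smul_apply, hcl a ha, smul_zero]
    · right
      apply hρl
      rcases hab with hab | hab
      · exact hab.trans (not_lt.1 ha)
      · exact absurd hab (Nat.not_lt_zero _))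
  have hx : ∀ v, (Matrix.vecMulVec (s • c) ρ).mulVec v = (ρ ⬝ᵥ v) • s • c := fun v => by
    rw [Matrix.vecMulVec_mulVec, op_smul_eq_smul]
  let ρ' : (Fin N → k) →ₗ[k] (Fin n → k) :=
    { toFun := fun v => (ρ ⬝ᵥ v) • upperRow h g.val (s • c)
      map_add' := fun v w => by rw [dotProduct_add, add_smul]
      map_smul' := fun a v => by
        rw [dotProduct_smul, smul_assoc]
        rfl }
  obtain ⟨Q, hQ⟩ := exists_factor (lowerRow h g.val) ρ' (fun v hv => by
    have : ρ' v = (ρ ⬝ᵥ v) • upperRow h g.val (s • c) := rfl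
    rw [this, hρX v hv, zero_smul])
  have h1 := induced_apply_mul_right h φ.2 (g := g) huv (t₁ := 1) (t₂ := 1) (E := Q)
    (fun v => by
      rw [Units.val_one, sub_self, Matrix.zero_mulVec, zero_add, hQ, hx, map_smul]
      rfl)
    (fun v => by
      rw [Units.val_one, sub_self, Matrix.zero_mulVec, hx, map_smul, map_smul,
        LinearMap.mem_ker.1 hc, smul_zero, smul_zero])
  rw [map_one, Module.End.one_eq_id, TensorProduct.map_id, LinearMap.id_apply] at h1
  have h2 := congrFun (congrArg Subtype.val (hφ u hu)) g
  rw [parabolicInduction_apply, h1] at h2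
  have h3 : superdiagChar ψ 0 u = ψ s := by
    rw [superdiagChar, huv, superdiag_one_add, superdiag_eq_single 0 i j hij (Nat.zero_le _),
      Matrix.vecMulVec_apply, Pi.smul_apply, hci, hρj, smul_eq_mul, mul_one, mul_one]
    intro a b hab ha
    rw [Matrix.vecMulVec_apply]
    by_cases ha' : i < a
    · rw [Pi.smul_apply, hcl a ha', smul_zero, zero_mul]
    · rw [hρl b, mul_zero]
      have : a.val < i.val := lt_of_le_of_ne (not_lt.1 ha') fun h => ha (Fin.ext h)
      rw [Fin.le_def]
      omega
  rw [h3] at h2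
  have h4 : (1 - ψ s) • φ.1 g = 0 := by
    rw [sub_smul, one_smul, sub_eq_zero]
    exact h2
  rcases smul_eq_zero.1 h4 with h5 | h5
  · exact hs (sub_eq_zero.1 h5).symm
  · exact hg h5

/-- On the big cell a Whittaker function is determined by its value at the block swap, through the
parabolic on the left and the shears on the right. -/
lemma eq_zero_of_apply_blockSwap (hψ : ψ ≠ 1) (h : n + n = N) {φ : InducedSpace h π}
    (hφ : φ ∈ whittaker (parabolicInduction h π π) ψ) (hw : φ.1 (blockSwap k h) = 0) : φ = 0 := by
  ext g
  by_contra hg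
  obtain ⟨q, z, rfl⟩ := exists_big_cell h g (isUnit_of_apply_ne_zero hψ h hφ hg)
  have hz : shear h z ∈ unitri k N 0 :=
    unitri_le (Nat.zero_le n) (unipotentRadical_initial_le n (shear_mem h z))
  have h1 := φ.2 q (blockSwap k h * shear h z)
  have h2 := congrFun (congrArg Subtype.val (hφ _ hz)) (blockSwap k h)
  rw [parabolicInduction_apply] at h2
  apply hg
  change φ.1 _ = 0
  rw [Subgroup.coe_subtype] at h1
  rw [h1, h2]
  change inflation h π π q (superdiagChar ψ 0 (shear h z) • φ.1 (blockSwap k h)) = 0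
  rw [hw, smul_zero, map_zero]

variable [CharP R 2]

/-- Passing block diagonal unipotents through the swap shows that the value there is a Whittaker
vector in each tensor factor. -/
lemma exists_apply_blockSwap_eq (hk : ringChar k ≠ 2) (h : n + n = N) {φ : InducedSpace h π}
    (hφ : φ ∈ whittaker (parabolicInduction h π π) ψ) {ω : V}
    (hω : ∀ v ∈ whittaker π ψ, ∃ c : R, v = c • ω) :
    ∃ c : R, φ.1 (blockSwap k h) = c • (ω ⊗ₜ[R] ω) := by
  have hact : ∀ x ∈ unitri k n 0, ∀ y ∈ unitri k n 0,
      TensorProduct.map (π y) (π x) (φ.1 (blockSwap k h))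
        = (superdiagChar ψ 0 x * superdiagChar ψ 0 y) • φ.1 (blockSwap k h) := by
    intro x hx y hy
    have h1 := congrFun (congrArg Subtype.val
      (hφ _ (blockDiag_mem_unitri h hx hy (Nat.zero_le n)))) (blockSwap k h)
    rw [parabolicInduction_apply, blockSwap_mul_blockDiag,
      superdiagChar_blockDiag ψ h (Nat.zero_le n)] at h1
    rw [← induced_apply_mul h φ.2 (q := blockDiag h y x) (t₁ := y) (t₂ := x), h1]
    · rfl
    all_goals rw [blocks_blockDiag]; rfl
  have hone := (isCharOn_superdiagChar (m := n) ψ 0 0).map_one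
  have h1 := lTensor_eigenProjector (W := V) (ρ := π) (isCharOn_superdiagChar ψ 0 0)
    (odd_card_unitri hk 0) (x := φ.1 (blockSwap k h)) (fun u hu => by
      have := hact u hu 1 (one_mem _)
      rw [map_one, hone, mul_one] at this
      exact this)
  have h2 := rTensor_eigenProjector (W := V) (ρ := π) (isCharOn_superdiagChar ψ 0 0)
    (odd_card_unitri hk 0) (x := φ.1 (blockSwap k h)) (fun u hu => by
      have := hact 1 (one_mem _) u hu
      rw [map_one, hone, one_mul] at this
      exact this)
  have h3 : ∀ y : V ⊗[R] V, ∃ c : R, (whittakerProjector π ψ).rTensor V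
      ((whittakerProjector π ψ).lTensor V y) = c • (ω ⊗ₜ[R] ω) := by
    intro y
    induction y with
    | zero => exact ⟨0, by rw [map_zero, map_zero, zero_smul]⟩
    | tmul a b =>
      obtain ⟨c, hc⟩ := hω _ (whittakerProjector_mem π a)
      obtain ⟨d, hd⟩ := hω _ (whittakerProjector_mem π b)
      refine ⟨d * c, ?_⟩
      rw [LinearMap.lTensor_tmul, LinearMap.rTensor_tmul, hc, hd, TensorProduct.tmul_smul,
        TensorProduct.smul_tmul', smul_smul]
      exact (TensorProduct.smul_tmul' _ _ _).symm
    | add y z hy hz =>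
      obtain ⟨c, hc⟩ := hy
      obtain ⟨d, hd⟩ := hz
      exact ⟨c + d, by rw [map_add, map_add, hc, hd, add_smul]⟩
  obtain ⟨c, hc⟩ := h3 (φ.1 (blockSwap k h))
  rw [h1, h2] at hc
  exact ⟨c, hc⟩

/-- The standard intertwining operator fixes the Whittaker vectors of `π × π`. -/
theorem inducedIntertwiner_eq_of_mem_whittaker [IsAlgClosed R] (hπ : IsCuspidal π)
    (hk : ringChar k ≠ 2) (hψ : ψ ≠ 1) (h : n + n = N) {φ : InducedSpace h π}
    (hφ : φ ∈ whittaker (parabolicInduction h π π) ψ) : inducedIntertwiner h π φ = φ := by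
  obtain ⟨ω, -, hω⟩ := exists_whittaker_le_span π hk hψ hπ.1
  have hTφ := inducedIntertwiner_mem_eigenvectors h hφ
  obtain ⟨c, hc⟩ := exists_apply_blockSwap_eq hk h hφ hω
  obtain ⟨d, hd⟩ := exists_apply_blockSwap_eq hk h hTφ hω
  by_cases hc0 : c = 0
  · have : φ = 0 := eq_zero_of_apply_blockSwap hψ h hφ (by rw [hc, hc0, zero_smul])
    rw [this, map_zero]
  have h1 : inducedIntertwiner h π φ = (d * c⁻¹) • φ := by
    rw [← sub_eq_zero]
    refine eq_zero_of_apply_blockSwap hψ h (Submodule.sub_mem _ hTφ (Submodule.smul_mem _ _ hφ)) ?_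
    change (inducedIntertwiner h π φ).1 _ - (d * c⁻¹) • φ.1 _ = 0
    rw [hc, hd, smul_smul, inv_mul_cancel_right₀ hc0, sub_self]
  have h2 := inducedIntertwiner_involution hπ hk h φ
  rw [h1, map_smul, h1, smul_smul] at h2
  by_cases hφ0 : φ = 0
  · rw [hφ0, map_zero]
  have h4 : d * c⁻¹ * (d * c⁻¹) = 1 := smul_left_injective R hφ0 (h2.trans (one_smul R φ).symm)
  -- The operator acts by a scalar of square `1`; in characteristic two this scalar is `1`.
  have h5 : (d * c⁻¹ + 1) ^ 2 = 0 := by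
    rw [CharTwo.add_sq, one_pow, pow_two, h4, CharTwo.add_self_eq_zero]
  have h6 : d * c⁻¹ = 1 := by
    rw [← sub_eq_zero, CharTwo.sub_eq_add]
    exact pow_eq_zero_iff (two_ne_zero) |>.1 h5
  rw [h1, h6, one_smul]

end InducedWhittaker

/-! ### Embedding `H_n` in the upper block of `H_{2n}` -/

section SymmetricSubgroup

variable {k : Type*} [Field k] {n N : ℕ}

lemma blockDiag_apply (x y : GL (Fin n) k) (i j : Fin n ⊕ Fin n) :
    (blockDiag rfl x y).val (finSumFinEquiv i) (finSumFinEquiv j)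
      = Matrix.fromBlocks x.val 0 0 y.val i j := by
  rw [← blocks_blockDiag rfl]
  rfl

lemma mod_two_eq_of_mem_levi (hk : ringChar k ≠ 2) {g : GL (Fin n) k}
    (hg : g ∈ symmetricSubgroup (SymmetricCase.levi : SymmetricCase k) n) {a b : Fin n}
    (hab : g.val a b ≠ 0) : a.val % 2 = b.val % 2 := by
  rw [symmetricSubgroup, Subgroup.mem_centralizer_singleton_iff] at hg
  have hv : (alternatingSigns k n).val = Matrix.diagonal fun i : Fin n => (-1 : k) ^ (i.val + 1) :=
    rfl
  have h1 : (g.val * (alternatingSigns k n).val) a b = ((alternatingSigns k n).val * g.val) a b := by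
    rw [← Units.val_mul, ← Units.val_mul, hg]
  rw [hv, Matrix.mul_diagonal, Matrix.diagonal_mul, mul_comm] at h1
  have h2 : (-1 : k) ^ (b.val + 1) = (-1) ^ (a.val + 1) := mul_right_cancel₀ hab h1
  have h3 : (-1 : k) ≠ 1 := Ring.neg_one_ne_one_of_char_ne_two hk
  rcases Nat.even_or_odd a.val with ha | ha <;> rcases Nat.even_or_odd b.val with hb | hb
  · rw [Nat.even_iff] at ha hb
    rw [ha, hb]
  · rw [ha.add_one.neg_one_pow, hb.add_one.neg_one_pow] at h2
    exact absurd h2.symm h3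
  · rw [ha.add_one.neg_one_pow, hb.add_one.neg_one_pow] at h2
    exact absurd h2 h3
  · rw [Nat.odd_iff] at ha hb
    rw [ha, hb]

/-- The upper block keeps its row and column indices, so in the Levi case parities match whatever
the parity of `n`. -/
lemma blockDiag_mem_symmetricSubgroup (hk : ringChar k ≠ 2) (c : SymmetricCase k) (h : n + n = N)
    {x : GL (Fin n) k} (hx : x ∈ symmetricSubgroup c n) :
    blockDiag h x 1 ∈ symmetricSubgroup c N := by
  subst h
  cases c with
  | levi =>
    refine mem_symmetricSubgroup_levi fun a b hab => ?_
    obtain ⟨i, rfl⟩ := finSumFinEquiv.surjective a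
    obtain ⟨j, rfl⟩ := finSumFinEquiv.surjective b
    rw [blockDiag_apply] at hab
    rcases i with i | i <;> rcases j with j | j
    · exact mod_two_eq_of_mem_levi hk hx hab
    · exact absurd rfl hab
    · exact absurd rfl hab
    · by_cases h : i = j
      · rw [h]
      · rw [Matrix.fromBlocks_apply₂₂, Units.val_one, Matrix.one_apply_ne h] at hab
        exact absurd rfl hab
  | galois k₀ hq =>
    obtain ⟨x₀, rfl⟩ := hx
    refine mem_symmetricSubgroup_galois hq (blockDiag rfl x₀ 1) fun a b => ?_
    obtain ⟨i, rfl⟩ := finSumFinEquiv.surjective a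
    obtain ⟨j, rfl⟩ := finSumFinEquiv.surjective b
    rw [blockDiag_apply, blockDiag_apply]
    rcases i with i | i <;> rcases j with j | j
    · rfl
    · rfl
    · rfl
    · rw [Matrix.fromBlocks_apply₂₂, Matrix.fromBlocks_apply₂₂, Units.val_one, Units.val_one,
        Matrix.one_apply, Matrix.one_apply]
      split_ifs <;> rfl

end SymmetricSubgroup

/-! ### Derivatives of `τ` and invariant forms -/

section Distinction

variable {k : Type*} [Field k] [Finite k] {n N : ℕ} {R : Type u} [Field R] [CharP R 2]
  {V : Type*} [AddCommGroup V] [Module R V] {π : Representation R (GL (Fin n) k) V}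
  {W : Type*} [AddCommGroup W] [Module R W] {τ : Representation R (GL (Fin N) k) W}
  {ψ : AddChar k R}

/-- The intermediate derivatives of a cuspidal representation vanish. -/
lemma IsCuspidal.derivative_eq_zero (hπ : IsCuspidal π) (hk : ringChar k ≠ 2) {d : ℕ} (hd : 0 < d)
    (hdn : d < n) {v : V} (hv : v ∈ eigenvectors π (unitri k n d) (superdiagChar ψ d)) : v = 0 :=
  hπ.eq_zero_of_initial hk (Nat.add_sub_cancel' hdn.le) hd (Nat.sub_pos_of_lt hdn)
    (mem_eigenvectors_unipotentRadical hv)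

/-- The derivatives of a quotient of `π × π`, except possibly those of order `0`, `n` and `2 n`,
vanish. -/
lemma derivative_eq_zero_of_quotient (hπ : IsCuspidal π) (hk : ringChar k ≠ 2) (h : n + n = N)
    (f : (parabolicInduction h π π).IntertwiningMap τ) (hf : Function.Surjective f) {d : ℕ}
    (hd : 0 < d) (hdN : d < N) (hdn : d ≠ n) {w : W}
    (hw : w ∈ eigenvectors τ (unitri k N d) (superdiagChar ψ d)) : w = 0 := by
  obtain ⟨φ, hφ, rfl⟩ := exists_mem_eigenvectors (IsCharOn.const_one _)
    (odd_card_unipotentRadical hk _) f hf (mem_eigenvectors_unipotentRadical hw)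
  have : φ = 0 := by
    ext g
    exact apply_eq_zero_of_initial hπ hk h φ.2 hd hdN hdn
      fun u hu => mem_eigenvectors_one h hφ hu g
  rw [this, map_zero]

variable [IsAlgClosed R]

/-- An irreducible quotient of `π × π` has no Whittaker vectors. -/
lemma whittaker_eq_zero_of_quotient (hn : 0 < n) (hπ : IsCuspidal π) (hk : ringChar k ≠ 2)
    (hψ : ψ ≠ 1) (h : n + n = N) (hτ : τ.IsIrreducible)
    (f : (parabolicInduction h π π).IntertwiningMap τ) (hf : Function.Surjective f) {w : W}
    (hw : w ∈ whittaker τ ψ) : w = 0 := by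
  obtain ⟨φ, hφ, rfl⟩ := exists_mem_eigenvectors (isCharOn_superdiagChar ψ 0 0)
    (odd_card_unitri hk 0) f hf hw
  exact map_eq_zero_of_inducedIntertwiner_eq hn hπ hk h hτ f
    (inducedIntertwiner_eq_of_mem_whittaker hπ hk hψ h hφ)

/-- The vectors of the derivative of order `n` of an irreducible quotient of `π × π` come from
`π ⊗ Wh(π)`. -/
lemma exists_eq_of_mem_derivative (hn : 0 < n) (hπ : IsCuspidal π) (hk : ringChar k ≠ 2)
    (h : n + n = N) (hτ : τ.IsIrreducible) (f : (parabolicInduction h π π).IntertwiningMap τ)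
    (hf : Function.Surjective f) {w : W}
    (hw : w ∈ eigenvectors τ (unitri k N n) (superdiagChar ψ n)) :
    ∃ x, w = f (supported h π ((whittakerProjector π ψ).lTensor V x)) := by
  obtain ⟨φ, hφ, hφw⟩ := exists_mem_eigenvectors (IsCharOn.const_one _)
    (odd_card_unipotentRadical hk _) f hf (mem_eigenvectors_unipotentRadical hw)
  obtain ⟨a, b, hab⟩ := eq_supported_add hn hπ hk h hφ
  have h1 : w = f (supported h π (a - b)) := by
    -- Vectors `x + T x` are fixed by `T`, hence die in the quotient; so `T` of a supported function
    -- becomes minus that function.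
    have h2 := map_eq_zero_of_inducedIntertwiner_eq hn hπ hk h hτ f
      (φ := supported h π b + inducedIntertwiner h π (supported h π b)) (by
        rw [map_add, inducedIntertwiner_involution hπ hk h, add_comm])
    rw [← hφw, hab, map_sub, map_sub, ← sub_eq_zero, ← map_sub, ← map_sub, ← h2]
    congr 1
    abel
  let σ : Representation R (GL (Fin n) k) W :=
    { toFun := fun x => τ (blockDiag h 1 x)
      map_one' := by rw [blockDiag_one, map_one]
      map_mul' := fun x y => by rw [← _root_.map_mul, ← blockDiag_mul, one_mul] }
  have hσ : w ∈ eigenvectors σ (unitri k n 0) (superdiagChar ψ 0) := by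
    intro x hx
    have h2 := hw _ (blockDiag_mem_unitri h (one_mem _) hx le_rfl)
    rw [superdiagChar_blockDiag ψ h le_rfl, (isCharOn_superdiagChar ψ 0 n).map_one, one_mul] at h2
    exact h2
  -- Equivariance under the lower diagonal block lets the Whittaker projector act on the second
  -- tensor factor without changing the image `w`.
  have h2 := map_eigenProjector (ρ := lTensorRep V π) (σ := σ) (U := unitri k n 0)
    (χ := superdiagChar ψ 0) (f.toLinearMap ∘ₗ supported h π) (fun u _ v => by
      change f (supported h π _) = τ (blockDiag h 1 u) (f (supported h π v))
      have h3 : f (parabolicInduction h π π (blockDiag h 1 u) (supported h π v))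
          = τ (blockDiag h 1 u) (f (supported h π v)) := f.isIntertwining _ _ _ _
      rw [← h3, parabolicInduction_blockDiag_supported, map_one]
      rfl) (a - b)
  have h3 : (f.toLinearMap ∘ₗ supported h π) (a - b) = w := h1.symm
  rw [h3, eigenProjector_apply_of_mem (isCharOn_superdiagChar ψ 0 0) (odd_card_unitri hk 0) hσ,
    eigenProjector_lTensorRep] at h2
  exact ⟨a - b, h2.symm⟩

/-- A linear form on an irreducible quotient of `π × π` which is invariant under the symmetric
subgroup is determined by one of its values. -/
lemma eq_zero_of_apply_supported (hn : 0 < n) (hπ : IsCuspidal π) (hk : ringChar k ≠ 2)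
    (hψ : ψ ≠ 1) (c : SymmetricCase k) (hc : ∀ m, IsMirabolicPair (symmetricSubgroup c m) ψ)
    (h : n + n = N) (hτ : τ.IsIrreducible) (f : (parabolicInduction h π π).IntertwiningMap τ)
    (hf : Function.Surjective f) {ω : V} (hω : ∀ v ∈ whittaker π ψ, ∃ a : R, v = a • ω)
    (l : W →ₗ[R] R) (hl : ∀ g ∈ symmetricSubgroup c N, ∀ w, l (τ g w) = l w)
    (h0 : l (f (supported h π (ω ⊗ₜ[R] ω))) = 0) : l = 0 := by
  have h1 : ∀ v, l (f (supported h π (v ⊗ₜ[R] ω))) = 0 := by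
    -- Restricted to `π ⊗ ω`, the form is invariant under `H_n` acting through the upper block. Only
    -- Whittaker vectors of `π`, all multiples of `ω`, can then detect it.
    let l' : V →ₗ[R] R :=
      l ∘ₗ f.toLinearMap ∘ₗ supported h π ∘ₗ (TensorProduct.mk R V V).flip ω
    have hl' : ∀ v, l' v = l (f (supported h π (v ⊗ₜ[R] ω))) := fun _ => rfl
    have h2 : l' = 0 := by
      refine eq_zero_of_forall_derivative (ρ := π) hk hψ hn (hc n) l' (fun x hx v => ?_)
        fun d hd v hv => ?_
      · have h3 : f (parabolicInduction h π π (blockDiag h x 1) (supported h π (v ⊗ₜ[R] ω)))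
            = τ (blockDiag h x 1) (f (supported h π (v ⊗ₜ[R] ω))) := f.isIntertwining _ _ _ _
        rw [parabolicInduction_blockDiag_supported, TensorProduct.map_tmul, map_one,
          Module.End.one_apply] at h3
        rw [hl', hl', h3, hl _ (blockDiag_mem_symmetricSubgroup hk c h hx)]
      · rcases Nat.eq_zero_or_pos d with rfl | hd0
        · obtain ⟨a, rfl⟩ := hω v hv
          rw [map_smul, hl', h0, smul_zero]
        · rw [hπ.derivative_eq_zero hk hd0 hd hv, map_zero]
    intro v
    rw [← hl', h2, LinearMap.zero_apply]
  refine eq_zero_of_forall_derivative (ρ := τ) hk hψ (by omega) (hc N) l hl fun d hd w hw => ?_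
  rcases Nat.eq_zero_or_pos d with rfl | hd0
  · rw [whittaker_eq_zero_of_quotient hn hπ hk hψ h hτ f hf hw, map_zero]
  by_cases hdn : d = n
  · subst hdn
    obtain ⟨x, hx⟩ := exists_eq_of_mem_derivative hn hπ hk h hτ f hf hw
    rw [hx]
    clear hx hw
    induction x with
    | zero => simp only [map_zero]
    | tmul a b =>
      obtain ⟨r, hr⟩ := hω _ (whittakerProjector_mem π b)
      rw [LinearMap.lTensor_tmul, hr, TensorProduct.tmul_smul, map_smul, map_smul, map_smul, h1,
        smul_zero]
    | add x y hx hy => rw [map_add, map_add, map_add, map_add, hx, hy, add_zero]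
  · rw [derivative_eq_zero_of_quotient hπ hk h f hf hd0 hd hdn hw, map_zero]

end Distinction

end ModularGL

theorem proposition7p7
    {k : Type*} [Field k] [Finite k] (hk : ringChar k ≠ 2)
    {R : Type u} [Field R] [IsAlgClosed R] [CharP R 2]
    (c : ModularGL.SymmetricCase k) (n : ℕ) (hn : 1 ≤ n)
    {V : Type*} [AddCommGroup V] [Module R V] (π : Representation R (GL (Fin n) k) V)
    (hcusp : ModularGL.IsCuspidal π)
    (hdist : ModularGL.IsDistinguished π (ModularGL.symmetricSubgroup c n))
    {W : Type*} [AddCommGroup W] [Module R W] (τ : Representation R (GL (Fin (2 * n)) k) W)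
    (hirr : τ.IsIrreducible)
    (hquot : ∃ f : (ModularGL.parabolicInduction (two_mul n).symm π π).IntertwiningMap τ,
      Function.Surjective f) :
    Module.rank R (ModularGL.InvariantForms τ (ModularGL.symmetricSubgroup c (2 * n))) ≤ 1 := by
  obtain ⟨f, hf⟩ := hquot
  obtain ⟨ψ, hψ, hc⟩ := ModularGL.exists_addChar_isMirabolicPair (R := R) hk c
  obtain ⟨ω, -, hω⟩ := ModularGL.exists_whittaker_le_span π hk hψ hcusp.1
  -- Evaluation at `w` is injective on invariant forms, so any form non-zero at `w` spans them.
  let w := f (ModularGL.supported (two_mul n).symm π (ω ⊗ₜ[R] ω))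
  have key : ∀ l : ModularGL.InvariantForms τ (ModularGL.symmetricSubgroup c (2 * n)),
      l w = 0 → l = 0 := by
    intro l hlw
    have h1 := ModularGL.eq_zero_of_apply_supported hn hcusp hk hψ c hc (two_mul n).symm hirr f hf hω
      l.toLinearMap (fun g hg w => l.isIntertwining _ _ ⟨g, hg⟩ w) hlw
    ext v
    exact LinearMap.congr_fun h1 v
  rw [rank_le_one_iff]
  by_cases h : ∃ l₀ : ModularGL.InvariantForms τ (ModularGL.symmetricSubgroup c (2 * n)), l₀ w ≠ 0
  · obtain ⟨l₀, hl₀⟩ := h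
    refine ⟨l₀, fun l => ⟨l w / l₀ w, ?_⟩⟩
    rw [← sub_eq_zero]
    apply key
    change l w / l₀ w * l₀ w - l w = 0
    rw [div_mul_cancel₀ _ hl₀, sub_self]
  · push Not at h
    exact ⟨0, fun l => ⟨0, by rw [key l (h l), zero_smul]⟩⟩
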